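/- All graphs are finite, undirected and simple; $n$ and $m$ denote the numbers of vertices and edges of the input graph $G=(V,E)$, which is assumed to be connected, and $\delta(G)$ is its minimum degree. A vertex dominates itself and its neighbours. A set $D\subseteq V$ is an efficient dominating set (e.d.) of $G$ if every vertex of $G$ is dominated by exactly one vertex of $D$. The problem WED asks, for a graph $G$ with vertex weights $w:V\to\mathbb N$, for an e.d. of minimum total weight, or for the answer that $G$ has no e.d. A graph is $(P_4+P_2)$-free if it has no induced subgraph isomorphic to the disjoint union of a chordless path on $4$ vertices and one on $2$ vertices. A graph is prime if it has no homogeneous set, i.e. no set $H\neq V$ of at least two vertices such that every vertex outside $H$ is adjacent to all or to none of the vertices of $H$. For $v\in V$ let $N_i$ be the set of vertices at distance $i$ from $v$, let $R=V\setminus(\{v\}\cup N_1\cup N_2)$ and $G_v=G[N_2\cup R]$; for weights $w:V\to\mathbb N\cup\{\infty\}$, the vertices of $R$ keep their weight in $G_v$ and those of $N_2$ get weight $\infty$. The machine model is the unit-cost word RAM with addition, truncated subtraction, comparison and indirect addressing, with words of $O(\log(n+M))$ bits, where $M$ is the largest number given with a vertex (a weight, or the code of a weight). Graphs are given by adjacency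 lists (in any order). (1) There is an algorithm that, given a connected graph $G$, a vertex $v$ for which $G_v$ is prime, and weights $w:V\to\mathbb N\cup\{\infty\}$, runs in time $O(m+1)$ and outputs either an e.d. of $G_v$ whose weight is finite and minimum among all e.d.s of $G_v$, or the negative answer; it gives the negative answer only if $G$ is not $(P_4+P_2)$-free or $G_v$ has no e.d. of finite weight. In particular, if $G$ is $(P_4+P_2)$-free, it finds a finite minimum weight e.d. of $G_v$ or correctly reports that there is none. (2) There is an algorithm that, given a connected $(P_4+P_2)$-free graph $G$ with weights $w:V\to\mathbb N$, runs in time $O(\delta(G)\cdot m+1)$ and outputs an e.d. of $G$ of minimum weight if $G$ has an e.d., and the negative answer otherwise. That is, WED is solvable in time $O(\delta(G)\cdot m)$ on connected $(P_4+P_2)$-free graphs with at least two vertices. -/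

import Mathlib

/-! ## Efficient domination, homogeneous sets, distance levels -/

namespace WED

/-- `D` is an efficient dominating set: every vertex is dominated by exactly one vertex of `D`,
where a vertex dominates itself and its neighbours. -/
def IsED {V : Type*} (G : SimpleGraph V) (D : Finset V) : Prop :=
  ∀ x : V, ∃! d : V, d ∈ D ∧ (d = x ∨ G.Adj d x)

/-- `D` is an efficient dominating set of minimum weight. -/
def IsMinED {V α : Type*} [AddCommMonoid α] [LE α] (G : SimpleGraph V) (w : V → α)
    (D : Finset V) : Prop :=
  IsED G D ∧ ∀ D' : Finset V, IsED G D' → ∑ x ∈ D, w x ≤ ∑ x ∈ D', w x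

/-- `G` has no induced subgraph isomorphic to the disjoint union of the paths on `4` and on
`2` vertices. -/
def P4P2Free {V : Type*} (G : SimpleGraph V) : Prop :=
  IsEmpty ((SimpleGraph.pathGraph 4 ⊕g SimpleGraph.pathGraph 2) ↪g G)

/-- Homogeneous sets (nontrivial modules). -/
def IsHomogeneous {V : Type*} (G : SimpleGraph V) (H : Set V) : Prop :=
  H.Nontrivial ∧ H ≠ Set.univ ∧
    ∀ x, x ∉ H → (∀ h ∈ H, G.Adj x h) ∨ (∀ h ∈ H, ¬ G.Adj x h)

/-- A graph is prime if it has no homogeneous set. -/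
def IsPrimeGraph {V : Type*} (G : SimpleGraph V) : Prop :=
  ∀ H : Set V, ¬ IsHomogeneous G H

/-- The distance level `N_i(v)`. -/
def level {V : Type*} (G : SimpleGraph V) (v : V) (i : ℕ) : Set V :=
  {x | G.edist v x = i}

/-- `R = V \ ({v} ∪ N_1 ∪ N_2)`. -/
def farSet {V : Type*} (G : SimpleGraph V) (v : V) : Set V :=
  Set.univ \ ({v} ∪ level G v 1 ∪ level G v 2)

/-- The vertex set `N_2 ∪ R` of `G_v`. -/
def subVerts {V : Type*} (G : SimpleGraph V) (v : V) : Set V :=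
  level G v 2 ∪ farSet G v

/-- The graph `G_v = G[N_2 ∪ R]`. -/
def subGraph {V : Type*} (G : SimpleGraph V) (v : V) : SimpleGraph (subVerts G v) :=
  G.induce (subVerts G v)

open Classical in
/-- The weights on `G_v`: vertices in `N_2` get weight `∞`, the others keep their weight. -/
noncomputable def subWeight {V : Type*} (G : SimpleGraph V) (v : V) (w : V → ℕ∞)
    (x : subVerts G v) : ℕ∞ :=
  if (x : V) ∈ level G v 2 then ⊤ else w x

/-- `D` is an efficient dominating set of `G_v` of finite minimum weight. -/
def IsMinFiniteSubED {V : Type*} (G : SimpleGraph V) (v : V) (w : V → ℕ∞)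
    (D : Finset (subVerts G v)) : Prop :=
  IsMinED (subGraph G v) (subWeight G v w) D ∧ ∑ x ∈ D, subWeight G v w x ≠ ⊤

/-! ## A unit-cost word RAM

Programs are structured (sequence, branching, loops) and work on a fixed finite number of
registers and of arrays, all named by numbers that occur in the program text.  The arithmetic
operations are addition, truncated subtraction and comparison.  Every operation costs one step.
A bound `B` limits the numbers that may occur (a word holds a number `≤ B`): a program that
computes a larger number is stuck. -/

/-- The memory: registers and arrays of natural numbers. -/
structure Mem where
  reg : ℕ → ℕ
  arr : ℕ → ℕ → ℕ

inductive Expr where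
  | lit (k : ℕ)
  | reg (x : ℕ)
  | get (a : ℕ) (i : Expr)
  | add (e f : Expr)
  | sub (e f : Expr)
  | lt (e f : Expr)
  | eq (e f : Expr)

namespace Expr

def eval (s : Mem) : Expr → ℕ
  | lit k => k
  | reg x => s.reg x
  | get a i => s.arr a (i.eval s)
  | add e f => e.eval s + f.eval s
  | sub e f => e.eval s - f.eval s
  | lt e f => if e.eval s < f.eval s then 1 else 0
  | eq e f => if e.eval s = f.eval s then 1 else 0

/-- The number of steps an evaluation takes: one for each node of the expression. -/
def cost : Expr → ℕ
  | lit _ => 1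
  | reg _ => 1
  | get _ i => i.cost + 1
  | add e f => e.cost + f.cost + 1
  | sub e f => e.cost + f.cost + 1
  | lt e f => e.cost + f.cost + 1
  | eq e f => e.cost + f.cost + 1

/-- All numbers that occur in the evaluation are at most `B`. -/
def Fits (B : ℕ) (s : Mem) : Expr → Prop
  | lit k => k ≤ B
  | reg x => s.reg x ≤ B
  | get a i => i.Fits B s ∧ s.arr a (i.eval s) ≤ B
  | add e f => e.Fits B s ∧ f.Fits B s ∧ e.eval s + f.eval s ≤ B
  | sub e f => e.Fits B s ∧ f.Fits B s
  | lt e f => e.Fits B s ∧ f.Fits B s ∧ 1 ≤ B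
  | eq e f => e.Fits B s ∧ f.Fits B s ∧ 1 ≤ B

end Expr

inductive Prog where
  | skip
  | assign (x : ℕ) (e : Expr)
  | put (a : ℕ) (i e : Expr)
  | seq (p q : Prog)
  | cond (e : Expr) (p q : Prog)
  | loop (e : Expr) (p : Prog)

/-- `Run B p s t s'`: with word bound `B`, program `p` started in memory `s` halts in
memory `s'` after exactly `t` steps.  A test is true when its value is not `0`. -/
inductive Run (B : ℕ) : Prog → Mem → ℕ → Mem → Prop
  | skip (s : Mem) : Run B Prog.skip s 1 s
  | assign (s : Mem) (x : ℕ) (e : Expr) (he : e.Fits B s) :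
      Run B (Prog.assign x e) s (e.cost + 1)
        { s with reg := Function.update s.reg x (e.eval s) }
  | put (s : Mem) (a : ℕ) (i e : Expr) (hi : i.Fits B s) (he : e.Fits B s) :
      Run B (Prog.put a i e) s (i.cost + e.cost + 1)
        { s with arr :=
            Function.update s.arr a (Function.update (s.arr a) (i.eval s) (e.eval s)) }
  | seq {p q : Prog} {s₁ s₂ s₃ : Mem} {t u : ℕ} (hp : Run B p s₁ t s₂) (hq : Run B q s₂ u s₃) :
      Run B (Prog.seq p q) s₁ (t + u) s₃
  | condTrue {e : Expr} {p q : Prog} {s s' : Mem} {t : ℕ} (hf : e.Fits B s)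
      (he : e.eval s ≠ 0) (hp : Run B p s t s') :
      Run B (Prog.cond e p q) s (e.cost + 1 + t) s'
  | condFalse {e : Expr} {p q : Prog} {s s' : Mem} {t : ℕ} (hf : e.Fits B s)
      (he : e.eval s = 0) (hq : Run B q s t s') :
      Run B (Prog.cond e p q) s (e.cost + 1 + t) s'
  | loopTrue {e : Expr} {p : Prog} {s₁ s₂ s₃ : Mem} {t u : ℕ} (hf : e.Fits B s₁)
      (he : e.eval s₁ ≠ 0) (hp : Run B p s₁ t s₂) (hl : Run B (Prog.loop e p) s₂ u s₃) :
      Run B (Prog.loop e p) s₁ (e.cost + 1 + t + u) s₃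
  | loopFalse {e : Expr} {p : Prog} {s : Mem} (hf : e.Fits B s) (he : e.eval s = 0) :
      Run B (Prog.loop e p) s (e.cost + 1) s

/-- `s` is an initial memory holding the graph `G` on `{0, …, n-1}` by adjacency lists, a number
for each vertex, and one further number `aux`.  Register `0` holds `n` and register `1` holds
`aux`; the neighbours of `i`, in any order, are the entries of array `1` at the positions from
`A₀[i]` (inclusive) to `A₀[i+1]` (exclusive), where `A₀[i]` is the sum of the degrees of the
vertices before `i`; array `2` holds the numbers of the vertices.  The rest of the memory
is `0`. -/
structure IsInput {n : ℕ} (G : SimpleGraph (Fin n)) [DecidableRel G.Adj] (num : Fin n → ℕ)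
    (aux : ℕ) (s : Mem) : Prop where
  size : s.reg 0 = n
  aux : s.reg 1 = aux
  reg_zero : ∀ x, 2 ≤ x → s.reg x = 0
  offset : ∀ i, i ≤ n → s.arr 0 i = ∑ j : Fin n, if (j : ℕ) < i then G.degree j else 0
  offset_zero : ∀ i, n < i → s.arr 0 i = 0
  neighbour : ∀ i j : Fin n, G.Adj i j ↔
    ∃ p, s.arr 0 i ≤ p ∧ p < s.arr 0 (i + 1) ∧ s.arr 1 p = j
  neighbour_zero : ∀ p, s.arr 0 n ≤ p → s.arr 1 p = 0
  number : ∀ i : Fin n, s.arr 2 i = num i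
  number_zero : ∀ i, n ≤ i → s.arr 2 i = 0
  arr_zero : ∀ a i, 3 ≤ a → s.arr a i = 0

/-- The answer "here is the vertex set `D`": register `0` holds `1`, and array `3` is nonzero
exactly at the members of `D` (among the vertices). -/
def Answers {n : ℕ} (s : Mem) (D : Finset (Fin n)) : Prop :=
  s.reg 0 = 1 ∧ ∀ i : Fin n, s.arr 3 i ≠ 0 ↔ i ∈ D

/-- The negative answer: register `0` holds `0`. -/
def Rejects (s : Mem) : Prop := s.reg 0 = 0

/-- The word bound `(n + M + 2) ^ C`, with `M` the largest number given with a vertex: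
words of `O(log (n + M))` bits. -/
def wordBound (C : ℕ) {n : ℕ} (num : Fin n → ℕ) : ℕ :=
  (n + Finset.univ.sup num + 2) ^ C

/-- The code of a weight in `ℕ ∪ {∞}`: `0` stands for `∞` and `k + 1` for `k`. -/
def weightCode : ℕ∞ → ℕ
  | none => 0
  | some k => k + 1

end WED

/-! Let z be a vertex of minimum degree. An e.d. contains a vertex of N[z], so it is enough to find,
for each v in N[z], a lightest e.d. through v: δ + 1 runs of a linear-time procedure. By
`IsED.erase` and `IsRestrictedED.insert`, the e.d.s of G through v are the sets {v} ∪ D where D ⊆ R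
dominates each vertex of N_2 ∪ R exactly once. By `isED_subGraph_iff` such D, restricted to vertices
of finite weight, are also the e.d.s of G_v of finite weight.

Freeness enters twice. An edge at v has no neighbour in R, so G[R] has no induced P_4
(`P4P2Free.noPathIn`). If a D exists, each component of G[R] is then dominated by a single member of
D, and its universal vertices are exactly the local maxima of the degree in G[R]
(`coherent_of_isRestrictedED`, `Coherent.code_eq_iff`). Thus D is a choice of one universal vertex
in each component that hits every vertex of N_2 once (`Coherent.isRestrictedED_iff`).

Now fix x₀ in N_2 and let u be its neighbour in D. The other members of D miss x₀. Two universal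
vertices of another component that both miss x₀ would be an edge forming an induced P_4+P_2 with a
path v, y, x₀, u (`P4P2Free.edgesMet`). So u determines D (`IsChoice.eq_exchange`). The candidate
sets for the various u arise from one reference set by exchanging a single vertex, and tables of how
often the reference set hits each vertex of N_2 decide all u together in linear time (`hitTest_iff`,
`sum_exchange`). If N_2 is empty, then so is R, and D = ∅. Positive answers are verified by the
program itself; freeness is needed only to justify negative ones.

The program is a list of passes over vertices or adjacency lists, each writing a fresh array, so
that after a block of passes the equations defining its arrays hold together (`exec_passesProg`).
Word size needs no separate analysis: every addition has a small right operand, so numbers grow at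
most linearly with time (`Run.tame_run`). -/

namespace WED

/-! ## Executions without a word bound -/

namespace Expr

theorem Fits.mono {B B' : ℕ} (h : B ≤ B') {s : Mem} : ∀ {e : Expr}, e.Fits B s → e.Fits B' s
  | lit _, he => le_trans he h
  | reg _, he => le_trans he h
  | get _ _, he => ⟨he.1.mono h, he.2.trans h⟩
  | add _ _, he => ⟨he.1.mono h, he.2.1.mono h, he.2.2.trans h⟩
  | sub _ _, he => ⟨he.1.mono h, he.2.mono h⟩
  | lt _ _, he => ⟨he.1.mono h, he.2.1.mono h, he.2.2.trans h⟩
  | eq _ _, he => ⟨he.1.mono h, he.2.1.mono h, he.2.2.trans h⟩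

theorem exists_fits (s : Mem) : ∀ e : Expr, ∃ B, e.Fits B s
  | lit k => ⟨k, le_refl k⟩
  | reg x => ⟨s.reg x, le_refl _⟩
  | get a i => by
    obtain ⟨B, hB⟩ := exists_fits s i
    exact ⟨max B (s.arr a (i.eval s)), hB.mono (le_max_left _ _), le_max_right _ _⟩
  | add e f => by
    obtain ⟨B, hB⟩ := exists_fits s e
    obtain ⟨C, hC⟩ := exists_fits s f
    exact ⟨max B (max C (e.eval s + f.eval s)), hB.mono (by simp), hC.mono (by simp), by simp⟩
  | sub e f => by
    obtain ⟨B, hB⟩ := exists_fits s e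
    obtain ⟨C, hC⟩ := exists_fits s f
    exact ⟨max B C, hB.mono (by simp), hC.mono (by simp)⟩
  | lt e f => by
    obtain ⟨B, hB⟩ := exists_fits s e
    obtain ⟨C, hC⟩ := exists_fits s f
    exact ⟨max B (max C 1), hB.mono (by simp), hC.mono (by simp), by simp⟩
  | eq e f => by
    obtain ⟨B, hB⟩ := exists_fits s e
    obtain ⟨C, hC⟩ := exists_fits s f
    exact ⟨max B (max C 1), hB.mono (by simp), hC.mono (by simp), by simp⟩

end Expr

theorem Run.mono {B B' : ℕ} (h : B ≤ B') {p : Prog} {s s' : Mem} {t : ℕ}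
    (r : Run B p s t s') : Run B' p s t s' := by
  induction r with
  | skip s => exact .skip s
  | assign s x e he => exact .assign s x e (he.mono h)
  | put s a i e hi he => exact .put s a i e (hi.mono h) (he.mono h)
  | seq _ _ ih1 ih2 => exact .seq ih1 ih2
  | condTrue hf he _ ih => exact .condTrue (hf.mono h) he ih
  | condFalse hf he _ ih => exact .condFalse (hf.mono h) he ih
  | loopTrue hf he _ _ ih1 ih2 => exact .loopTrue (hf.mono h) he ih1 ih2
  | loopFalse hf he => exact .loopFalse (hf.mono h) he

/-- Started in `s`, the program halts in `s'` after `t` steps, for some word bound. -/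
def Exec (p : Prog) (s : Mem) (t : ℕ) (s' : Mem) : Prop := ∃ B, Run B p s t s'

def Mem.setReg (s : Mem) (x k : ℕ) : Mem := { s with reg := Function.update s.reg x k }

def Mem.setArr (s : Mem) (a i k : ℕ) : Mem :=
  { s with arr := Function.update s.arr a (Function.update (s.arr a) i k) }

theorem Exec.skip (s : Mem) : Exec .skip s 1 s := ⟨0, .skip s⟩

theorem Exec.assign (s : Mem) (x : ℕ) (e : Expr) :
    Exec (.assign x e) s (e.cost + 1) (s.setReg x (e.eval s)) := by
  obtain ⟨B, hB⟩ := e.exists_fits s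
  exact ⟨B, .assign s x e hB⟩

theorem Exec.put (s : Mem) (a : ℕ) (i e : Expr) :
    Exec (.put a i e) s (i.cost + e.cost + 1) (s.setArr a (i.eval s) (e.eval s)) := by
  obtain ⟨B, hB⟩ := e.exists_fits s
  obtain ⟨C, hC⟩ := i.exists_fits s
  exact ⟨max B C, .put s a i e (hC.mono (by simp)) (hB.mono (by simp))⟩

theorem Exec.seq {p q : Prog} {s₁ s₂ s₃ : Mem} {t u : ℕ} (hp : Exec p s₁ t s₂)
    (hq : Exec q s₂ u s₃) : Exec (.seq p q) s₁ (t + u) s₃ := by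
  obtain ⟨B, hB⟩ := hp
  obtain ⟨C, hC⟩ := hq
  exact ⟨max B C, .seq (hB.mono (by simp)) (hC.mono (by simp))⟩

/-- Conditional assignment. -/
theorem Exec.condAssign (s : Mem) (x : ℕ) (c e : Expr) :
    ∃ t, t ≤ c.cost + e.cost + 2 ∧ Exec (.cond c (.assign x e) .skip) s t
      (if c.eval s ≠ 0 then s.setReg x (e.eval s) else s) := by
  obtain ⟨B, hB⟩ := c.exists_fits s
  by_cases h : c.eval s = 0
  · refine ⟨c.cost + 1 + 1, by omega, B, ?_⟩
    simpa [h] using Run.condFalse (q := .skip) hB h (.skip s)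
  · obtain ⟨C, hC⟩ := Exec.assign s x e
    refine ⟨c.cost + 1 + (e.cost + 1), by omega, max B C, ?_⟩
    simpa [h] using Run.condTrue (p := .assign x e) (q := .skip) (hB.mono (le_max_left B C)) h
      (hC.mono (le_max_right B C))

/-- `for r = lo, …, hi - 1`. -/
def forRange (r : ℕ) (lo hi : Expr) (body : Prog) : Prog :=
  .seq (.assign r lo)
    (.loop (.lt (.reg r) hi) (.seq body (.assign r (.add (.reg r) (.lit 1)))))

/-- The invariant is indexed by the counter, and the body must leave the counter alone. Besides `T
k`, each round pays for the test and the increment, which together cost `hi.cost + 7`. -/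
theorem Exec.loop_range {r : ℕ} {hi : Expr} {body : Prog} (Inv : ℕ → Mem → Prop) (T : ℕ → ℕ)
    (a b : ℕ) (hab : a ≤ b)
    (hreg : ∀ k s, Inv k s → s.reg r = k) (hhi : ∀ k s, Inv k s → hi.eval s = b)
    (hstep : ∀ k, a ≤ k → k < b → ∀ s, Inv k s →
      ∃ t s', Exec body s t s' ∧ t ≤ T k ∧ s'.reg r = k ∧ Inv (k + 1) (s'.setReg r (k + 1)))
    (s : Mem) (hs : Inv a s) :
    ∃ t s', Exec (.loop (.lt (.reg r) hi) (.seq body (.assign r (.add (.reg r) (.lit 1))))) s t s' ∧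
      t ≤ ∑ k ∈ Finset.Ico a b, (T k + (hi.cost + 8)) + (hi.cost + 8) ∧ Inv b s' := by
  obtain ⟨d, rfl⟩ := Nat.exists_eq_add_of_le hab
  induction d generalizing a s with
  | zero =>
    obtain ⟨B, hB⟩ := (Expr.lt (.reg r) hi).exists_fits s
    refine ⟨_, s, ⟨B, .loopFalse hB ?_⟩, ?_, hs⟩
    · simp [Expr.eval, hreg _ _ hs, hhi _ _ hs]
    · simp [Expr.cost]; omega
  | succ d ih =>
    obtain ⟨t, s', ⟨B, hB⟩, ht, hr, hI⟩ := hstep a le_rfl (by omega) s hs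
    obtain ⟨u, s'', ⟨C, hC⟩, hu, hI'⟩ := ih (a + 1) _ hI (by omega)
      (fun k s h => by rw [hhi k s h]; omega) (fun k h1 h2 => hstep k (by omega) (by omega))
    obtain ⟨D, hD⟩ := (Expr.lt (.reg r) hi).exists_fits s
    obtain ⟨E, hE⟩ := Exec.assign s' r (.add (.reg r) (.lit 1))
    have he : (Expr.add (.reg r) (.lit 1)).eval s' = a + 1 := by simp [Expr.eval, hr]
    rw [he] at hE
    refine ⟨_, s'', ⟨max (max B C) (max D E), .loopTrue (hD.mono (by simp)) ?_
      (.seq (hB.mono (by simp)) (hE.mono (by simp))) (hC.mono (by simp))⟩, ?_, ?_⟩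
    · simp [Expr.eval, hreg _ _ hs, hhi _ _ hs]
    · rw [show a + (d + 1) = a + 1 + d by ring, Finset.sum_eq_sum_Ico_succ_bot (by omega)]
      simp only [Expr.cost]
      omega
    · rwa [show a + (d + 1) = a + 1 + d by ring]

theorem Exec.forRange {r : ℕ} {lo hi : Expr} {body : Prog} (Inv : ℕ → Mem → Prop) (T : ℕ → ℕ)
    (a b : ℕ) (hab : a ≤ b)
    (hreg : ∀ k s, Inv k s → s.reg r = k) (hhi : ∀ k s, Inv k s → hi.eval s = b)
    (hstep : ∀ k, a ≤ k → k < b → ∀ s, Inv k s →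
      ∃ t s', Exec body s t s' ∧ t ≤ T k ∧ s'.reg r = k ∧ Inv (k + 1) (s'.setReg r (k + 1)))
    (s : Mem) (ha : lo.eval s = a) (hs : Inv a (s.setReg r a)) :
    ∃ t s', Exec (WED.forRange r lo hi body) s t s' ∧
      t ≤ ∑ k ∈ Finset.Ico a b, (T k + (hi.cost + 8)) + (hi.cost + lo.cost + 9) ∧ Inv b s' := by
  obtain ⟨t, s', h, ht, hI⟩ := Exec.loop_range Inv T a b hab hreg hhi hstep _ hs
  refine ⟨_, s', .seq (.assign s r lo) (by rw [ha]; exact h), by omega, hI⟩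

/-! ## Tame programs: the numbers grow at most linearly with time -/

namespace Expr

/-- The value is bounded by the literals and by the entries of array `2`. -/
def small : Expr → Bool
  | lit k => k ≤ 2
  | get a _ => a = 2
  | sub e _ => e.small
  | _ => false

/-- Every addition has a small right operand. -/
def tame : Expr → Bool
  | lit k => k ≤ 2
  | reg _ => true
  | get _ i => i.tame
  | add e f => e.tame && f.tame && f.small
  | sub e f => e.tame && f.tame
  | lt e f => e.tame && f.tame
  | eq e f => e.tame && f.tame

end Expr

/-- Every addition has a small right operand, and array `2` is never written. -/
def Prog.tame : Prog → Bool
  | skip => true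
  | assign _ e => e.tame
  | put a i e => (a ≠ 2) && i.tame && e.tame
  | seq p q => p.tame && q.tame
  | cond e p q => e.tame && p.tame && q.tame
  | loop e p => e.tame && p.tame

def Mem.Bounded (b : ℕ) (s : Mem) : Prop := (∀ x, s.reg x ≤ b) ∧ ∀ a i, s.arr a i ≤ b

theorem Expr.small_eval_le {M : ℕ} {s : Mem} (hM : ∀ i, s.arr 2 i ≤ M) :
    ∀ e : Expr, e.small → e.eval s ≤ M + 2
  | lit k, h => by simp [small] at h; simp [eval]; omega
  | get a i, h => by
    simp only [small, decide_eq_true_eq] at h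
    subst h
    exact (hM _).trans (by omega)
  | sub e f, h => (Nat.sub_le _ _).trans (small_eval_le hM e h)

theorem Expr.cost_pos (e : Expr) : 1 ≤ e.cost := by cases e <;> simp [cost]

/-- Each node of the expression can raise the value by at most M + 2: an addition does so through
its small right operand, a literal is at most 2, and every other node returns a stored number, a
smaller one, or a truth value. -/
theorem Expr.tame_bound {M b : ℕ} {s : Mem} (hM : ∀ i, s.arr 2 i ≤ M) (hb : s.Bounded b) :
    ∀ e : Expr, e.tame → e.eval s ≤ b + e.cost * (M + 2) ∧
      ∀ B, b + e.cost * (M + 2) ≤ B → e.Fits B s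
  | lit k, h => by
    simp only [tame, decide_eq_true_eq] at h
    simp only [eval, cost, Fits]
    constructor
    · omega
    · intro B hB; omega
  | reg x, _ => by
    have := hb.1 x
    simp only [eval, cost, Fits]
    constructor
    · omega
    · intro B hB; omega
  | get a i, h => by
    have := tame_bound hM hb i h
    have h2 := hb.2 a (i.eval s)
    simp only [eval, cost, Fits, add_mul] at *
    refine ⟨by omega, fun B hB => ⟨this.2 B (by omega), by omega⟩⟩
  | add e f, h => by
    simp only [tame, Bool.and_eq_true] at h
    have he := tame_bound hM hb e h.1.1
    have hf := tame_bound hM hb f h.1.2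
    have h3 := small_eval_le hM f h.2
    -- The cost of the right operand, at least 1, pays for its value.
    have h4 : 1 * (M + 2) ≤ f.cost * (M + 2) := Nat.mul_le_mul_right _ f.cost_pos
    simp only [eval, cost, Fits, add_mul] at *
    refine ⟨by omega, fun B hB => ⟨he.2 B (by omega), hf.2 B (by omega), by omega⟩⟩
  | sub e f, h => by
    simp only [tame, Bool.and_eq_true] at h
    have he := tame_bound hM hb e h.1
    have hf := tame_bound hM hb f h.2
    simp only [eval, cost, Fits, add_mul] at *
    refine ⟨by omega, fun B hB => ⟨he.2 B (by omega), hf.2 B (by omega)⟩⟩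
  | lt e f, h => by
    simp only [tame, Bool.and_eq_true] at h
    have he := tame_bound hM hb e h.1
    have hf := tame_bound hM hb f h.2
    simp only [eval, cost, Fits, add_mul] at *
    refine ⟨by split_ifs <;> omega, fun B hB => ⟨he.2 B (by omega), hf.2 B (by omega), by omega⟩⟩
  | eq e f, h => by
    simp only [tame, Bool.and_eq_true] at h
    have he := tame_bound hM hb e h.1
    have hf := tame_bound hM hb f h.2
    simp only [eval, cost, Fits, add_mul] at *
    refine ⟨by split_ifs <;> omega, fun B hB => ⟨he.2 B (by omega), hf.2 B (by omega), by omega⟩⟩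

theorem Mem.Bounded.mono {b b' : ℕ} (h : b ≤ b') {s : Mem} (hs : s.Bounded b) : s.Bounded b' :=
  ⟨fun x => (hs.1 x).trans h, fun a i => (hs.2 a i).trans h⟩

/-- By induction along the run. Array 2 is never written, so M keeps bounding it, and each step adds
at most M + 2 to the largest number in memory. The same run is therefore legal under every word
bound above this linear growth. -/
theorem Run.tame_run {B : ℕ} {p : Prog} {s s' : Mem} {t : ℕ} (r : Run B p s t s') {M : ℕ} :
    ∀ {b : ℕ}, p.tame → (∀ i, s.arr 2 i ≤ M) → s.Bounded b →
      s'.Bounded (b + t * (M + 2)) ∧ s'.arr 2 = s.arr 2 ∧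
        ∀ B', b + t * (M + 2) ≤ B' → Run B' p s t s' := by
  induction r with
  | skip s =>
    intro b _ _ hb
    exact ⟨hb.mono (by omega), rfl, fun _ _ => .skip s⟩
  | assign s x e he =>
    intro b h hM hb
    have := e.tame_bound hM hb h
    simp only [add_mul]
    refine ⟨⟨fun y => ?_, fun a i => ?_⟩, trivial,
      fun B' hB' => .assign s x e (this.2 _ (by omega))⟩
    · by_cases hxy : y = x
      · subst hxy; simp; omega
      · simpa [hxy] using (hb.1 y).trans (by omega)
    · exact (hb.2 a i).trans (by omega)
  | put s a i e hi he =>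
    intro b h hM hb
    simp only [Prog.tame, Bool.and_eq_true, decide_eq_true_eq] at h
    have h1 := e.tame_bound hM hb h.2
    have h2 := i.tame_bound hM hb h.1.2
    simp only [add_mul]
    refine ⟨⟨fun y => (hb.1 y).trans (by omega), fun a' j => ?_⟩, ?_,
      fun B' hB' => .put s a i e (h2.2 _ (by omega)) (h1.2 _ (by omega))⟩
    · have h3 := hb.2 a' j
      by_cases hxy : a' = a
      · subst hxy
        by_cases hj : j = i.eval s
        · subst hj; simp; omega
        · simp [hj]; omega
      · simp [hxy]; omega
    · simp [Ne.symm h.1.1]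
  | seq _ _ ih1 ih2 =>
    intro b h hM hb
    simp only [Prog.tame, Bool.and_eq_true] at h
    obtain ⟨h1, h2, h3⟩ := ih1 h.1 hM hb
    obtain ⟨h4, h5, h6⟩ := ih2 h.2 (by rwa [h2]) h1
    simp only [add_mul, ← add_assoc]
    exact ⟨h4, h5.trans h2, fun B' hB' => .seq (h3 _ (by omega)) (h6 _ hB')⟩
  | condTrue hf he _ ih =>
    intro b h hM hb
    simp only [Prog.tame, Bool.and_eq_true] at h
    obtain ⟨h1, h2, h3⟩ := ih h.1.2 hM hb
    have := Expr.tame_bound hM hb _ h.1.1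
    simp only [add_mul]
    exact ⟨h1.mono (by omega), h2, fun B' hB' =>
      .condTrue (this.2 _ (by omega)) he (h3 _ (by omega))⟩
  | condFalse hf he _ ih =>
    intro b h hM hb
    simp only [Prog.tame, Bool.and_eq_true] at h
    obtain ⟨h1, h2, h3⟩ := ih h.2 hM hb
    have := Expr.tame_bound hM hb _ h.1.1
    simp only [add_mul]
    exact ⟨h1.mono (by omega), h2, fun B' hB' =>
      .condFalse (this.2 _ (by omega)) he (h3 _ (by omega))⟩
  | loopTrue hf he _ _ ih1 ih2 =>
    intro b h hM hb
    have h' := h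
    simp only [Prog.tame, Bool.and_eq_true] at h
    obtain ⟨h1, h2, h3⟩ := ih1 h.2 hM hb
    obtain ⟨h4, h5, h6⟩ := ih2 h' (by rwa [h2]) h1
    have := Expr.tame_bound hM hb _ h.1
    simp only [add_mul]
    refine ⟨h4.mono (by omega), h5.trans h2, fun B' hB' =>
      .loopTrue (this.2 _ (by omega)) he (h3 _ (by omega)) (h6 _ (by omega))⟩
  | loopFalse hf he =>
    intro b h hM hb
    simp only [Prog.tame, Bool.and_eq_true] at h
    have := Expr.tame_bound hM hb _ h.1
    simp only [add_mul]
    exact ⟨hb.mono (by omega), trivial, fun B' hB' => .loopFalse (this.2 _ (by omega)) he⟩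

end WED

namespace WED

/-! ## Passes over the vertices and the adjacency lists -/

/-- The memory with the three working registers set. -/
def Mem.at (s : Mem) (i p acc : ℕ) : Mem :=
  { s with reg := fun r => if r = 2 then i else if r = 3 then p else if r = 4 then acc
      else s.reg r }

/-- `s'` agrees with `s` outside the working registers and the arrays in `L`. -/
structure Mem.EqOff (L : List ℕ) (s s' : Mem) : Prop where
  reg : ∀ r, r ≠ 2 → r ≠ 3 → r ≠ 4 → s'.reg r = s.reg r
  arr : ∀ b, b ∉ L → s'.arr b = s.arr b

theorem Mem.EqOff.refl (L : List ℕ) (s : Mem) : s.EqOff L s := ⟨fun _ _ _ _ => rfl, fun _ _ => rfl⟩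

theorem Mem.EqOff.trans {L L' : List ℕ} {s s' s'' : Mem} (h : s.EqOff L s') (h' : s'.EqOff L' s'') :
    s.EqOff (L ++ L') s'' :=
  ⟨fun r h1 h2 h3 => (h'.reg r h1 h2 h3).trans (h.reg r h1 h2 h3), fun b hb => by
    simp only [List.mem_append, not_or] at hb
    exact (h'.arr b hb.2).trans (h.arr b hb.1)⟩

theorem Mem.EqOff.setReg {L : List ℕ} {s s' : Mem} (h : s.EqOff L s') {r : ℕ}
    (hr : r = 2 ∨ r = 3 ∨ r = 4) (k : ℕ) : s.EqOff L (s'.setReg r k) :=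
  ⟨fun x h1 h2 h3 => by
    have : x ≠ r := by rintro rfl; tauto
    simp [Mem.setReg, this, h.reg x h1 h2 h3], h.arr⟩

theorem Mem.EqOff.setArr {L : List ℕ} {s s' : Mem} (h : s.EqOff L s') {a : ℕ} (ha : a ∈ L)
    (i k : ℕ) : s.EqOff L (s'.setArr a i k) :=
  ⟨h.reg, fun b hb => by
    have : b ≠ a := by rintro rfl; exact hb ha
    simp [Mem.setArr, this, h.arr b hb]⟩

namespace Expr

/-- The expression does not read the array. -/
def avoids (a : ℕ) : Expr → Bool
  | lit _ => true
  | reg _ => true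
  | get b i => (b ≠ a) && i.avoids a
  | add e f => e.avoids a && f.avoids a
  | sub e f => e.avoids a && f.avoids a
  | lt e f => e.avoids a && f.avoids a
  | eq e f => e.avoids a && f.avoids a

theorem eval_congr {s s' : Mem} (hr : s'.reg = s.reg) : ∀ {e : Expr},
    (∀ b, e.avoids b = false → s'.arr b = s.arr b) → e.eval s' = e.eval s
  | lit _, _ => rfl
  | reg _, _ => by simp [eval, hr]
  | get b i, h => by
    have h1 := eval_congr hr (e := i) (fun c hc => h c (by simp [avoids, hc]))
    simp [eval, h1, h b (by simp [avoids])]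
  | add e f, h => by
    have h1 := eval_congr hr (e := e) (fun c hc => h c (by simp [avoids, hc]))
    have h2 := eval_congr hr (e := f) (fun c hc => h c (by simp [avoids, hc]))
    simp [eval, h1, h2]
  | sub e f, h => by
    have h1 := eval_congr hr (e := e) (fun c hc => h c (by simp [avoids, hc]))
    have h2 := eval_congr hr (e := f) (fun c hc => h c (by simp [avoids, hc]))
    simp [eval, h1, h2]
  | lt e f, h => by
    have h1 := eval_congr hr (e := e) (fun c hc => h c (by simp [avoids, hc]))
    have h2 := eval_congr hr (e := f) (fun c hc => h c (by simp [avoids, hc]))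
    simp [eval, h1, h2]
  | eq e f, h => by
    have h1 := eval_congr hr (e := e) (fun c hc => h c (by simp [avoids, hc]))
    have h2 := eval_congr hr (e := f) (fun c hc => h c (by simp [avoids, hc]))
    simp [eval, h1, h2]

theorem eval_at_congr {L : List ℕ} {s s' : Mem} (h : s.EqOff L s') {e : Expr}
    (he : ∀ b ∈ L, e.avoids b) (i p acc : ℕ) : e.eval (s'.at i p acc) = e.eval (s.at i p acc) := by
  apply eval_congr
  · funext r
    simp only [Mem.at]
    split_ifs with h1 h2 h3 <;> first | rfl | exact h.reg r h1 h2 h3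
  · intro b hb
    refine h.arr b fun hbL => ?_
    simp [he b hbL] at hb

end Expr

theorem Mem.at_self (s : Mem) : s.at (s.reg 2) (s.reg 3) (s.reg 4) = s := by
  cases s
  simp only [Mem.at, Mem.mk.injEq, and_true]
  funext r
  split_ifs with h1 h2 h3 <;> simp_all

/-- Passes are specified by evaluations in the memory at their start, with only the working
registers varied. This holds in the middle of a pass because its expressions avoid the array being
written. -/
theorem Expr.eval_eq_at {L : List ℕ} {s s' : Mem} (h : s.EqOff L s') {e : Expr}
    (he : ∀ b ∈ L, e.avoids b) {i p acc : ℕ} (hi : s'.reg 2 = i) (hp : s'.reg 3 = p)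
    (hacc : s'.reg 4 = acc) : e.eval s' = e.eval (s.at i p acc) := by
  rw [← eval_at_congr h he, ← hi, ← hp, ← hacc, Mem.at_self]

/-- `f (lo + k - 1) (⋯ (f lo acc))`. -/
def foldRange (f : ℕ → ℕ → ℕ) (lo : ℕ) : ℕ → ℕ → ℕ
  | 0, acc => acc
  | k + 1, acc => f (lo + k) (foldRange f lo k acc)

/-- A pass computes an array.  The accumulator (register `4`) starts as `v₀` if the test `c₀`
holds, else as `0`; at each step it is replaced by `v` if `c` holds.  In a gathering pass there is
an accumulator for each vertex `i` (register `2`), and the steps go through the positions `p`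
(register `3`) of the adjacency list of `i`; otherwise there is one accumulator, and the steps go
through the vertices. -/
structure Pass where
  gather : Bool
  tgt : ℕ
  c₀ : Expr
  v₀ : Expr
  c : Expr
  v : Expr

namespace Pass

/-- A single update of the accumulator. -/
def upd (c v : Expr) (s : Mem) (i p acc : ℕ) : ℕ :=
  if c.eval (s.at i p acc) ≠ 0 then v.eval (s.at i p acc) else acc

def value (P : Pass) (s : Mem) (i : ℕ) : ℕ :=
  foldRange (fun p acc => upd P.c P.v s i p acc) (s.arr 0 i) (s.arr 0 (i + 1) - s.arr 0 i)
    (upd P.c₀ P.v₀ s i 0 0)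

def total (P : Pass) (s : Mem) : ℕ :=
  foldRange (fun i acc => upd P.c P.v s i 0 acc) 0 (s.reg 0) (upd P.c₀ P.v₀ s 0 0 0)

/-- Both sides refer to one memory, the one after the pass. For a pass that does not read its target
this is the same as evaluating before it, and such equations can be collected and read as
definitions of the arrays. -/
def Holds (P : Pass) (s : Mem) : Prop :=
  if P.gather then ∀ i < s.reg 0, s.arr P.tgt i = P.value s i else s.arr P.tgt 0 = P.total s

def avoids (P : Pass) (a : ℕ) : Bool :=
  P.c₀.avoids a && P.v₀.avoids a && P.c.avoids a && P.v.avoids a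

def condAssign (c v : Expr) : Prog := .cond c (.assign 4 v) .skip

/-- The position and the accumulator are cleared first, so the starting value depends on the vertex
alone and not on what earlier passes left in the registers. -/
def gatherBody (P : Pass) : Prog :=
  .seq (.assign 3 (.lit 0)) (.seq (.assign 4 (.lit 0)) (.seq (condAssign P.c₀ P.v₀)
    (.seq (forRange 3 (.get 0 (.reg 2)) (.get 0 (.add (.reg 2) (.lit 1))) (condAssign P.c P.v))
      (.put P.tgt (.reg 2) (.reg 4)))))

def prog (P : Pass) : Prog :=
  if P.gather then forRange 2 (.lit 0) (.reg 0) P.gatherBody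
  else .seq (.assign 2 (.lit 0)) (.seq (.assign 3 (.lit 0)) (.seq (.assign 4 (.lit 0))
    (.seq (condAssign P.c₀ P.v₀) (.seq (forRange 2 (.lit 0) (.reg 0) (condAssign P.c P.v))
      (.put P.tgt (.lit 0) (.reg 4))))))

def size (P : Pass) : ℕ := P.c₀.cost + P.v₀.cost + P.c.cost + P.v.cost + 50

theorem avoids_iff {P : Pass} {a : ℕ} : P.avoids a ↔
    P.c₀.avoids a ∧ P.v₀.avoids a ∧ P.c.avoids a ∧ P.v.avoids a := by
  simp [avoids, and_assoc]

theorem upd_congr {L : List ℕ} {s s' : Mem} (h : s.EqOff L s') {c v : Expr}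
    (hc : ∀ b ∈ L, c.avoids b) (hv : ∀ b ∈ L, v.avoids b) (i p acc : ℕ) :
    upd c v s' i p acc = upd c v s i p acc := by
  simp only [upd, Expr.eval_at_congr h hc, Expr.eval_at_congr h hv]

theorem value_congr {L : List ℕ} {s s' : Mem} (h : s.EqOff L s') {P : Pass}
    (hP : ∀ b ∈ L, P.avoids b) (h0 : 0 ∉ L) (i : ℕ) : P.value s' i = P.value s i := by
  simp only [avoids_iff] at hP
  simp only [value, h.arr 0 h0, upd_congr h (fun b hb => (hP b hb).1) (fun b hb => (hP b hb).2.1),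
    upd_congr h (fun b hb => (hP b hb).2.2.1) (fun b hb => (hP b hb).2.2.2)]

theorem total_congr {L : List ℕ} {s s' : Mem} (h : s.EqOff L s') {P : Pass}
    (hP : ∀ b ∈ L, P.avoids b) : P.total s' = P.total s := by
  simp only [avoids_iff] at hP
  simp only [total, h.reg 0 (by decide) (by decide) (by decide),
    upd_congr h (fun b hb => (hP b hb).1) (fun b hb => (hP b hb).2.1),
    upd_congr h (fun b hb => (hP b hb).2.2.1) (fun b hb => (hP b hb).2.2.2)]

theorem Holds.congr {L : List ℕ} {s s' : Mem} (h : s.EqOff L s') {P : Pass}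
    (hP : ∀ b ∈ L, P.avoids b) (h0 : 0 ∉ L) (ht : P.tgt ∉ L) (H : P.Holds s) : P.Holds s' := by
  simp only [Holds, value_congr h hP h0, total_congr h hP, h.arr _ ht,
    h.reg 0 (by decide) (by decide) (by decide)] at *
  exact H

/-- The conditional assignment of the accumulator. -/
theorem exec_condAssign {a : ℕ} {s s' : Mem} (h : s.EqOff [a] s') {c v : Expr}
    (hc : c.avoids a) (hv : v.avoids a) {i p acc : ℕ} (hi : s'.reg 2 = i) (hp : s'.reg 3 = p)
    (hacc : s'.reg 4 = acc) :
    ∃ t s'', Exec (condAssign c v) s' t s'' ∧ t ≤ c.cost + v.cost + 2 ∧ s.EqOff [a] s'' ∧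
      s''.reg 2 = i ∧ s''.reg 3 = p ∧ s''.reg 4 = upd c v s i p acc ∧ s''.arr = s'.arr := by
  obtain ⟨t, ht, he⟩ := Exec.condAssign s' 4 c v
  refine ⟨t, _, he, ht, ?_⟩
  rw [Expr.eval_eq_at h (by simpa using hc) hi hp hacc,
    Expr.eval_eq_at h (by simpa using hv) hi hp hacc, upd]
  split_ifs with h0
  · exact ⟨h.setReg (by simp) _, by simp [Mem.setReg, hi], by simp [Mem.setReg, hp],
      by simp [Mem.setReg], rfl⟩
  · exact ⟨h, hi, hp, hacc, rfl⟩

theorem exec_gatherBody {P : Pass} (hP : P.avoids P.tgt) (h0 : P.tgt ≠ 0) {s s' : Mem}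
    (h : s.EqOff [P.tgt] s') {i : ℕ} (hi : s'.reg 2 = i) (hmono : s.arr 0 i ≤ s.arr 0 (i + 1)) :
    ∃ t s'', Exec P.gatherBody s' t s'' ∧
      t ≤ P.size * (s.arr 0 (i + 1) - s.arr 0 i) + P.size ∧ s.EqOff [P.tgt] s'' ∧
      s''.reg 2 = i ∧ s''.arr P.tgt = Function.update (s'.arr P.tgt) i (P.value s i) := by
  rw [avoids_iff] at hP
  obtain ⟨hc0, hv0, hc, hv⟩ := hP
  have e1 := Exec.assign s' 3 (.lit 0)
  have e2 := Exec.assign (s'.setReg 3 0) 4 (.lit 0)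
  obtain ⟨t3, s3, e3, ht3, hs3, h32, h33, h34, h3a⟩ :=
    exec_condAssign (s' := (s'.setReg 3 0).setReg 4 0)
    ((h.setReg (r := 3) (by simp) 0).setReg (r := 4) (by simp) 0) hc0 hv0 (i := i) (p := 0)
    (acc := 0) (by simp [Mem.setReg, hi]) (by simp [Mem.setReg]) (by simp [Mem.setReg])
  have ha0 : ∀ s'' : Mem, s.EqOff [P.tgt] s'' → s''.arr 0 = s.arr 0 :=
    fun s'' h'' => h''.arr 0 (by simpa using h0.symm)
  obtain ⟨t4, s4, e4, ht4, hs4, h42, h43, h44, h4a⟩ := Exec.forRange (r := 3)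
    (lo := .get 0 (.reg 2)) (hi := .get 0 (.add (.reg 2) (.lit 1))) (body := condAssign P.c P.v)
    (fun k m => s.EqOff [P.tgt] m ∧ m.reg 2 = i ∧ m.reg 3 = k ∧
      m.reg 4 = foldRange (fun p acc => upd P.c P.v s i p acc) (s.arr 0 i) (k - s.arr 0 i)
        (upd P.c₀ P.v₀ s i 0 0) ∧ m.arr = s'.arr) (fun _ => P.c.cost + P.v.cost + 2)
    (s.arr 0 i) (s.arr 0 (i + 1)) hmono (fun k m hm => hm.2.2.1)
    (fun k m hm => by simp [Expr.eval, hm.2.1, ha0 _ hm.1])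
    (by
      rintro k hk1 hk2 m ⟨hm1, hm2, hm3, hm4, hm5⟩
      obtain ⟨t, s'', e, ht, hs, h2, h3, h4, h5⟩ := exec_condAssign hm1 hc hv hm2 hm3 hm4
      refine ⟨t, s'', e, ht, h3, hs.setReg (by simp) _, by simp [Mem.setReg, h2],
        by simp [Mem.setReg], ?_, by simp [Mem.setReg, h5, hm5]⟩
      simp only [Mem.setReg, ne_eq, Nat.reduceEqDiff, not_false_eq_true,
        Function.update_of_ne, h4]
      obtain ⟨d, rfl⟩ := Nat.exists_eq_add_of_le hk1
      rw [show s.arr 0 i + d + 1 - s.arr 0 i = d + 1 by omega, add_tsub_cancel_left]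
      rfl)
    s3 (by simp [Expr.eval, h32, ha0 _ hs3])
    ⟨hs3.setReg (by simp) _, by simp [Mem.setReg, h32], by simp [Mem.setReg],
      by simp [Mem.setReg, h34, foldRange], by simp [Mem.setReg, h3a]⟩
  have e5 := Exec.put s4 P.tgt (.reg 2) (.reg 4)
  refine ⟨_, _, e1.seq (e2.seq (e3.seq (e4.seq e5))), ?_, hs4.setArr (by simp) _ _, ?_, ?_⟩
  · simp only [Finset.sum_const, Nat.card_Ico, smul_eq_mul, Expr.cost, size] at ht4 ⊢
    have : (s.arr 0 (i + 1) - s.arr 0 i) * (P.c.cost + P.v.cost + 2 + (1 + 1 + 1 + 1 + 8)) ≤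
      (P.c₀.cost + P.v₀.cost + P.c.cost + P.v.cost + 50) * (s.arr 0 (i + 1) - s.arr 0 i) := by
      rw [mul_comm]
      exact Nat.mul_le_mul_right _ (by omega)
    omega
  · simp [Mem.setArr, h42]
  · simp [Mem.setArr, h42, h4a, Expr.eval, h44, value]

theorem exec_prog {P : Pass} (hP : P.avoids P.tgt) (h0 : P.tgt ≠ 0) (s : Mem)
    (hmono : ∀ i < s.reg 0, s.arr 0 i ≤ s.arr 0 (i + 1)) :
    ∃ t s', Exec P.prog s t s' ∧
      t ≤ P.size * (s.reg 0 + s.arr 0 (s.reg 0) + 1) * 2 ∧ s.EqOff [P.tgt] s' ∧ P.Holds s' := by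
  by_cases hg : P.gather
  · simp only [prog, hg, if_true]
    obtain ⟨t, s', e, ht, hs, h2, hv⟩ := Exec.forRange (r := 2) (lo := .lit 0) (hi := .reg 0)
      (body := P.gatherBody)
      (fun k m => s.EqOff [P.tgt] m ∧ m.reg 2 = k ∧ ∀ i < k, m.arr P.tgt i = P.value s i)
      (fun i => P.size * (s.arr 0 (i + 1) - s.arr 0 i) + P.size) 0 (s.reg 0) (Nat.zero_le _)
      (fun k m hm => hm.2.1)
      (fun k m hm => by simp [Expr.eval, hm.1.reg 0 (by decide) (by decide) (by decide)])
      (by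
        rintro k - hk m ⟨hm1, hm2, hm3⟩
        obtain ⟨t, s'', e, ht, hs, h2, h3⟩ := exec_gatherBody hP h0 hm1 hm2 (hmono k hk)
        refine ⟨t, s'', e, ht, h2, hs.setReg (by simp) _, by simp [Mem.setReg], fun i hi => ?_⟩
        simp only [Mem.setReg, h3]
        by_cases hik : i = k
        · simp [hik]
        · simp [hik, hm3 i (by omega)])
      s rfl ⟨(Mem.EqOff.refl _ s).setReg (by simp) _, by simp [Mem.setReg], by simp⟩
    refine ⟨t, s', e, ht.trans ?_, hs, ?_⟩
    -- The lengths of the adjacency lists telescope to the last offset.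
    · have h1 : ∀ b ≤ s.reg 0, ∑ i ∈ Finset.Ico 0 b, (P.size * (s.arr 0 (i + 1) - s.arr 0 i) +
          P.size + (Expr.cost (.reg 0) + 8)) ≤ P.size * s.arr 0 b + b * (P.size + 9) := by
        intro b
        induction b with
        | zero => simp
        | succ b ih =>
          intro hb
          rw [Finset.sum_Ico_succ_top (by omega)]
          have h2 := hmono b (by omega)
          have h3 : P.size * s.arr 0 (b + 1) =
              P.size * s.arr 0 b + P.size * (s.arr 0 (b + 1) - s.arr 0 b) := by
            rw [← mul_add]; congr 1; omega
          have := ih (by omega)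
          simp only [Expr.cost, add_mul] at *
          omega
      have h2 := h1 _ le_rfl
      have h3 : s.reg 0 * (P.size + 9) ≤ s.reg 0 * (P.size * 2) :=
        Nat.mul_le_mul_left _ (by simp only [size]; omega)
      have h4 : P.size * (s.reg 0 + s.arr 0 (s.reg 0) + 1) * 2 =
        s.reg 0 * (P.size * 2) + P.size * s.arr 0 (s.reg 0) * 2 + P.size * 2 := by ring
      have h5 : 50 ≤ P.size := by simp only [size]; omega
      simp only [Expr.cost] at *
      omega
    · simp only [Holds, hg, if_true]
      intro i hi
      rw [value_congr hs (by simpa using hP) (by simpa using h0.symm)]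
      exact hv i (by rwa [hs.reg 0 (by decide) (by decide) (by decide)] at hi)
  · simp only [prog, hg, if_false, Bool.false_eq_true]
    have hP' := avoids_iff.1 hP
    obtain ⟨hc0, hv0, hc, hv⟩ := hP'
    have e0 := Exec.assign s 2 (.lit 0)
    have e1 := Exec.assign (s.setReg 2 0) 3 (.lit 0)
    have e2 := Exec.assign ((s.setReg 2 0).setReg 3 0) 4 (.lit 0)
    obtain ⟨t3, s3, e3, ht3, hs3, h32, h33, h34, h3a⟩ :=
      exec_condAssign (s' := ((s.setReg 2 0).setReg 3 0).setReg 4 0) (s := s)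
      ((((Mem.EqOff.refl [P.tgt] s).setReg (r := 2) (by simp) 0).setReg (r := 3) (by simp) 0).setReg
        (r := 4) (by simp) 0) hc0 hv0 (i := 0) (p := 0)
      (acc := 0) (by simp [Mem.setReg]) (by simp [Mem.setReg]) (by simp [Mem.setReg])
    obtain ⟨t4, s4, e4, ht4, hs4, h42, h43, h44⟩ := Exec.forRange (r := 2)
      (lo := .lit 0) (hi := .reg 0) (body := condAssign P.c P.v)
      (fun k m => s.EqOff [P.tgt] m ∧ m.reg 2 = k ∧ m.reg 3 = 0 ∧
        m.reg 4 = foldRange (fun i acc => upd P.c P.v s i 0 acc) 0 k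
          (upd P.c₀ P.v₀ s 0 0 0)) (fun _ => P.c.cost + P.v.cost + 2)
      0 (s.reg 0) (Nat.zero_le _) (fun k m hm => hm.2.1)
      (fun k m hm => by simp [Expr.eval, hm.1.reg 0 (by decide) (by decide) (by decide)])
      (by
        rintro k - hk2 m ⟨hm1, hm2, hm3, hm4⟩
        obtain ⟨t, s'', e, ht, hs, h2, h3, h4, h5⟩ := exec_condAssign hm1 hc hv hm2 hm3 hm4
        refine ⟨t, s'', e, ht, h2, hs.setReg (by simp) _, by simp [Mem.setReg],
          by simp [Mem.setReg, h3], ?_⟩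
        simp only [Mem.setReg, ne_eq, Nat.reduceEqDiff, not_false_eq_true,
          Function.update_of_ne, h4, foldRange, zero_add])
      s3 (by simp [Expr.eval])
      ⟨hs3.setReg (by simp) _, by simp [Mem.setReg], by simp [Mem.setReg, h33],
        by simp [Mem.setReg, h34, foldRange]⟩
    have e5 := Exec.put s4 P.tgt (.lit 0) (.reg 4)
    have hs5 := hs4.setArr (a := P.tgt) (by simp) (Expr.eval s4 (.lit 0)) (Expr.eval s4 (.reg 4))
    refine ⟨_, _, e0.seq (e1.seq (e2.seq (e3.seq (e4.seq e5)))), ?_, hs5, ?_⟩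
    · simp only [Finset.sum_const, Nat.card_Ico, smul_eq_mul, Expr.cost] at ht4 ⊢
      have h3 : (s.reg 0 - 0) * (P.c.cost + P.v.cost + 2 + (1 + 8)) ≤ s.reg 0 * (P.size * 2) :=
        Nat.mul_le_mul (by omega) (by simp only [size]; omega)
      have h4 : P.size * (s.reg 0 + s.arr 0 (s.reg 0) + 1) * 2 =
        s.reg 0 * (P.size * 2) + P.size * s.arr 0 (s.reg 0) * 2 + P.size * 2 := by ring
      have h5 : 50 + (P.c₀.cost + P.v₀.cost + P.c.cost + P.v.cost) ≤ P.size := by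
        simp only [size]; omega
      omega
    · simp only [Holds, hg, if_false, Bool.false_eq_true]
      rw [total_congr hs5 (by simpa using hP)]
      simp [Mem.setArr, Expr.eval, h44, total]

end Pass

/-- Each pass avoids the targets of itself and of the later passes, which are new and not the
arrays of the input. -/
def ssa : List Pass → Bool
  | [] => true
  | P :: Ps => (2 < P.tgt) && P.avoids P.tgt &&
      Ps.all (fun Q => P.avoids Q.tgt && (P.tgt ≠ Q.tgt)) && ssa Ps

def passesProg : List Pass → Prog
  | [] => .skip
  | P :: Ps => .seq P.prog (passesProg Ps)

def passesSize : List Pass → ℕ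
  | [] => 1
  | P :: Ps => P.size * 2 + passesSize Ps

theorem ssa_two_lt : ∀ {Ps : List Pass}, ssa Ps → ∀ a ∈ Ps.map Pass.tgt, 2 < a
  | [], _ => by simp
  | P :: Ps, h => by
    simp only [ssa, Bool.and_eq_true, decide_eq_true_eq] at h
    simp only [List.map_cons, List.mem_cons, forall_eq_or_imp]
    exact ⟨h.1.1.1, ssa_two_lt h.2⟩

/-- Single assignment: no later pass writes the target of an earlier one or an array that it reads,
so the equation of each pass survives to the end. The targets need not be empty beforehand, so a
block can be run repeatedly. -/
theorem exec_passesProg : ∀ {Ps : List Pass}, ssa Ps → ∀ (s : Mem),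
    (∀ i < s.reg 0, s.arr 0 i ≤ s.arr 0 (i + 1)) →
    ∃ t s', Exec (passesProg Ps) s t s' ∧
      t ≤ passesSize Ps * (s.reg 0 + s.arr 0 (s.reg 0) + 1) ∧
      s.EqOff (Ps.map Pass.tgt) s' ∧ ∀ P ∈ Ps, P.Holds s'
  | [], _, s, _ => ⟨1, s, .skip s, by simp [passesSize], .refl _ _, by simp⟩
  | P :: Ps, h, s, hmono => by
    have h' := h
    simp only [ssa, Bool.and_eq_true, decide_eq_true_eq, List.all_eq_true] at h
    obtain ⟨⟨⟨h1, h2⟩, h3⟩, h4⟩ := h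
    obtain ⟨t, s', e, ht, hs, hP⟩ := Pass.exec_prog h2 (by omega) s hmono
    have hr := hs.reg 0 (by decide) (by decide) (by decide)
    have ha := hs.arr 0 (by simp; omega)
    obtain ⟨u, s'', e', hu, hs', hPs⟩ := exec_passesProg h4 s' (by rwa [hr, ha])
    rw [hr, ha] at hu
    refine ⟨_, s'', e.seq e', ?_, hs.trans hs', ?_⟩
    · rw [passesSize, add_mul, mul_right_comm]
      omega
    · simp only [List.mem_cons, forall_eq_or_imp]
      refine ⟨hP.congr hs' ?_ ?_ ?_, hPs⟩
      · intro b hb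
        obtain ⟨Q, hQ, rfl⟩ := List.mem_map.1 hb
        exact (h3 Q hQ).1
      · intro hb
        have := ssa_two_lt h4 0 hb
        omega
      · intro hb
        obtain ⟨Q, hQ, hQ'⟩ := List.mem_map.1 hb
        exact (h3 Q hQ).2 hQ'.symm

end WED

namespace WED

/-! ## Memories that hold a graph -/

/-- The memory holds the graph and the numbers of the vertices. -/
structure HoldsGraph {n : ℕ} (G : SimpleGraph (Fin n)) [DecidableRel G.Adj] (num : Fin n → ℕ)
    (s : Mem) : Prop where
  size : s.reg 0 = n
  offset : ∀ i, i ≤ n → s.arr 0 i = ∑ j : Fin n, if (j : ℕ) < i then G.degree j else 0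
  neighbour : ∀ i j : Fin n, G.Adj i j ↔
    ∃ p, s.arr 0 i ≤ p ∧ p < s.arr 0 (i + 1) ∧ s.arr 1 p = j
  number : ∀ i : Fin n, s.arr 2 i = num i

section

variable {n : ℕ} {G : SimpleGraph (Fin n)} [DecidableRel G.Adj] {num : Fin n → ℕ} {s : Mem}

theorem IsInput.holdsGraph {aux : ℕ} (h : IsInput G num aux s) : HoldsGraph G num s :=
  ⟨h.size, h.offset, h.neighbour, h.number⟩

theorem HoldsGraph.congr (H : HoldsGraph G num s) {s' : Mem} (hr : s'.reg 0 = s.reg 0)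
    (h0 : s'.arr 0 = s.arr 0) (h1 : s'.arr 1 = s.arr 1) (h2 : s'.arr 2 = s.arr 2) :
    HoldsGraph G num s' := by
  constructor
  · rw [hr, H.size]
  · rw [h0]; exact H.offset
  · rw [h0, h1]; exact H.neighbour
  · rw [h2]; exact H.number

theorem HoldsGraph.eqOff (H : HoldsGraph G num s) {s' : Mem} {L : List ℕ} (h : s.EqOff L s')
    (hL : ∀ a ∈ L, 2 < a) : HoldsGraph G num s' := by
  have h2 : ∀ a ≤ 2, a ∉ L := fun a ha h' => by have := hL a h'; omega
  exact H.congr (h.reg 0 (by decide) (by decide) (by decide)) (h.arr 0 (h2 0 (by decide)))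
    (h.arr 1 (h2 1 (by decide))) (h.arr 2 (h2 2 (by decide)))

theorem HoldsGraph.offset_succ (H : HoldsGraph G num s) (i : Fin n) :
    s.arr 0 (i + 1) = s.arr 0 i + G.degree i := by
  rw [H.offset _ (by omega), H.offset _ (by omega)]
  have : ∀ j : Fin n, (if (j : ℕ) < i + 1 then G.degree j else 0) =
      (if (j : ℕ) < i then G.degree j else 0) + if j = i then G.degree j else 0 := by
    intro j
    by_cases h : j = i
    · subst h; simp
    · have h' : (j : ℕ) ≠ i := fun h' => h (Fin.ext h')
      have : (j : ℕ) < i + 1 ↔ (j : ℕ) < i := by omega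
      simp [h, this]
  rw [Finset.sum_congr rfl fun j _ => this j, Finset.sum_add_distrib]
  simp

theorem HoldsGraph.mono (H : HoldsGraph G num s) : ∀ i < s.reg 0, s.arr 0 i ≤ s.arr 0 (i + 1) := by
  intro i hi
  rw [H.size] at hi
  have := H.offset_succ ⟨i, hi⟩
  simp only at this
  omega

theorem HoldsGraph.offset_last (H : HoldsGraph G num s) :
    s.arr 0 (s.reg 0) = 2 * G.edgeFinset.card := by
  rw [H.size, H.offset n le_rfl, ← G.sum_degrees_eq_twice_card_edges]
  simp

/-- The positions of the adjacency list of `i`. -/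
abbrev block (s : Mem) (i : ℕ) : Finset ℕ := Finset.Ico (s.arr 0 i) (s.arr 0 (i + 1))

/-- The block of `i` has as many positions as `i` has neighbours, and each neighbour occurs in it.
By counting, there are no repetitions. -/
theorem HoldsGraph.image_block (H : HoldsGraph G num s) (i : Fin n) :
    Set.InjOn (s.arr 1) (block s i) ∧
      (block s i).image (s.arr 1) = (G.neighborFinset i).image (fun j : Fin n => (j : ℕ)) := by
  have hcard : (block s i).card = ((G.neighborFinset i).image (fun j : Fin n => (j : ℕ))).card := by
    rw [Finset.card_image_of_injective _ Fin.val_injective, Nat.card_Ico, H.offset_succ i,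
      G.card_neighborFinset_eq_degree]
    omega
  have hsub : (G.neighborFinset i).image (fun j : Fin n => (j : ℕ)) ⊆
      (block s i).image (s.arr 1) := by
    intro k hk
    obtain ⟨j, hj, rfl⟩ := Finset.mem_image.1 hk
    rw [SimpleGraph.mem_neighborFinset, H.neighbour] at hj
    obtain ⟨p, h1, h2, h3⟩ := hj
    exact Finset.mem_image.2 ⟨p, Finset.mem_Ico.2 ⟨h1, h2⟩, h3⟩
  have heq := Finset.eq_of_subset_of_card_le hsub (by rw [← hcard]; exact Finset.card_image_le)
  refine ⟨?_, heq.symm⟩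
  apply Finset.injOn_of_card_image_eq
  rw [← heq, hcard]

theorem HoldsGraph.block_mem (H : HoldsGraph G num s) {i : Fin n} {p : ℕ} (hp : p ∈ block s i) :
    ∃ j : Fin n, G.Adj i j ∧ s.arr 1 p = j := by
  have := Finset.mem_image_of_mem (s.arr 1) hp
  rw [(H.image_block i).2] at this
  obtain ⟨j, hj, hj'⟩ := Finset.mem_image.1 this
  exact ⟨j, by simpa using hj, hj'.symm⟩

theorem HoldsGraph.card_block (H : HoldsGraph G num s) (i : Fin n) (C : ℕ → Prop)
    [DecidablePred C] : ((block s i).filter (fun p => C (s.arr 1 p))).card =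
      (Finset.univ.filter (fun j : Fin n => G.Adj i j ∧ C j)).card := by
  have h1 : ((block s i).filter (fun p => C (s.arr 1 p))).card =
      (((block s i).image (s.arr 1)).filter C).card := by
    rw [Finset.filter_image, Finset.card_image_of_injOn]
    exact (H.image_block i).1.mono fun x hx => (Finset.mem_filter.1 hx).1
  rw [h1, (H.image_block i).2, Finset.filter_image,
    Finset.card_image_of_injective _ Fin.val_injective]
  congr 1
  ext j
  simp

end

/-! ## Kinds of passes -/

namespace Expr

/-- Truth values are 0 and 1, so the strict comparison holds only if `a = 0` is false and `0 < b` is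
true. -/
def band (a b : Expr) : Expr := lt (eq a (lit 0)) (lt (lit 0) b)

def bnot (a : Expr) : Expr := eq a (lit 0)

def bor (a b : Expr) : Expr := bnot (band (bnot a) (bnot b))

@[simp] theorem eval_band (a b : Expr) (s : Mem) :
    (band a b).eval s = if a.eval s ≠ 0 ∧ b.eval s ≠ 0 then 1 else 0 := by
  simp only [band, eval]
  rcases Nat.eq_zero_or_pos (a.eval s) with ha | ha <;>
    rcases Nat.eq_zero_or_pos (b.eval s) with hb | hb <;> simp [ha, hb, Nat.ne_of_gt]

@[simp] theorem eval_bnot (a : Expr) (s : Mem) :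
    (bnot a).eval s = if a.eval s = 0 then 1 else 0 := rfl

@[simp] theorem eval_bor (a b : Expr) (s : Mem) :
    (bor a b).eval s = if a.eval s ≠ 0 ∨ b.eval s ≠ 0 then 1 else 0 := by
  simp only [bor, eval_bnot, eval_band]
  split_ifs <;> simp_all

end Expr

namespace Pass

open _root_.WED.Expr

/-- The number of neighbours with `c`, plus one if `c₀` holds. -/
def cnt (a : ℕ) (c₀ c : Expr) : Pass := ⟨true, a, c₀, lit 1, c, add (reg 4) (lit 1)⟩

/-- The largest value of `v` on the neighbours with `c` (and of `v₀` if `c₀` holds). -/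
def mx (a : ℕ) (c₀ v₀ c v : Expr) : Pass := ⟨true, a, c₀, v₀, band c (lt (reg 4) v), v⟩

/-- The value `v₀` where `c₀` holds. -/
def map (a : ℕ) (c₀ v₀ : Expr) : Pass := ⟨true, a, c₀, v₀, lit 0, lit 0⟩

def mark (a : ℕ) (c₀ : Expr) : Pass := map a c₀ (lit 1)

/-- The sum of `v` over the vertices with `c`. -/
def sum (a : ℕ) (c v : Expr) : Pass := ⟨false, a, lit 0, lit 0, c, add (reg 4) v⟩

/-- The number of vertices with `c`. -/
def count (a : ℕ) (c : Expr) : Pass := sum a c (lit 1)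

/-- The single value `v₀`, if `c₀` holds. -/
def const (a : ℕ) (c₀ v₀ : Expr) : Pass := ⟨false, a, c₀, v₀, lit 0, lit 0⟩

end Pass

theorem foldRange_card {C : ℕ → Prop} [DecidablePred C] {f : ℕ → ℕ → ℕ} {lo : ℕ} : ∀ {k acc : ℕ},
    (∀ p, lo ≤ p → p < lo + k → ∀ a, f p a = if C p then a + 1 else a) →
    foldRange f lo k acc = acc + ((Finset.Ico lo (lo + k)).filter C).card
  | 0, _, _ => by simp [foldRange]
  | k + 1, acc, h => by
    simp only [foldRange]
    rw [h _ (by omega) (by omega), foldRange_card (k := k) fun p h1 h2 => h p h1 (by omega),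
      ← add_assoc, Nat.Ico_succ_right_eq_insert_Ico (by omega), Finset.filter_insert]
    split_ifs with hC
    · rw [Finset.card_insert_of_notMem (by simp)]; omega
    · rfl

theorem foldRange_sum {w : ℕ → ℕ} {C : ℕ → Prop} [DecidablePred C] {f : ℕ → ℕ → ℕ} : ∀ {k : ℕ},
    (∀ p, p < k → ∀ a, f p a = if C p then a + w p else a) →
    foldRange f 0 k 0 = ∑ p ∈ (Finset.range k).filter C, w p
  | 0, _ => by simp [foldRange]
  | k + 1, h => by
    simp only [foldRange, zero_add]
    rw [h _ (by omega), foldRange_sum (k := k) fun p h1 => h p (by omega),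
      Finset.range_add_one, Finset.filter_insert]
    split_ifs with hC
    · rw [Finset.sum_insert (by simp)]; omega
    · rfl

theorem foldRange_max {C : ℕ → Prop} [DecidablePred C] {w : ℕ → ℕ} {f : ℕ → ℕ → ℕ} {lo : ℕ} :
    ∀ {k acc : ℕ},
    (∀ p, lo ≤ p → p < lo + k → ∀ a, f p a = if C p ∧ a < w p then w p else a) →
    foldRange f lo k acc = max acc (((Finset.Ico lo (lo + k)).filter C).sup w)
  | 0, _, _ => by simp [foldRange]
  | k + 1, acc, h => by
    simp only [foldRange]
    rw [h _ (by omega) (by omega), foldRange_max (k := k) fun p h1 h2 => h p h1 (by omega),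
      ← add_assoc, Nat.Ico_succ_right_eq_insert_Ico (by omega), Finset.filter_insert]
    by_cases hC : C (lo + k)
    · simp only [hC, true_and, if_true, Finset.sup_insert]
      split_ifs with h' <;> simp only [max_def] at * <;> split_ifs at * <;> omega
    · simp [hC]

theorem foldRange_id {f : ℕ → ℕ → ℕ} {lo : ℕ} : ∀ {k acc : ℕ},
    (∀ p a, f p a = a) → foldRange f lo k acc = acc
  | 0, _, _ => rfl
  | k + 1, acc, h => by simp only [foldRange]; rw [h, foldRange_id h]

namespace Pass

variable {n : ℕ} {G : SimpleGraph (Fin n)} [DecidableRel G.Adj] {num : Fin n → ℕ} {s : Mem}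

theorem cnt_eq (H : HoldsGraph G num s) {a : ℕ} {c₀ c : Expr} (h : (cnt a c₀ c).Holds s)
    (D : Fin n → Prop) (C : Fin n → Fin n → Prop) [DecidablePred D] [∀ i, DecidablePred (C i)]
    (hD : ∀ i : Fin n, c₀.eval (s.at i 0 0) ≠ 0 ↔ D i)
    (hC : ∀ (i j : Fin n) (p acc : ℕ), s.arr 1 p = j → (c.eval (s.at i p acc) ≠ 0 ↔ C i j))
    (i : Fin n) :
    s.arr a i = (if D i then 1 else 0) + (Finset.univ.filter fun j => G.Adj i j ∧ C i j).card := by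
  simp only [Holds, cnt, if_true] at h
  rw [h i (by rw [H.size]; exact i.2), value]
  simp only
  classical
  rw [foldRange_card (C := fun p => ∃ j : Fin n, s.arr 1 p = j ∧ C i j)]
  · rw [Nat.add_sub_cancel' (H.mono i (by rw [H.size]; exact i.2)),
      H.card_block i (fun k => ∃ j : Fin n, k = j ∧ C i j)]
    simp only [upd, Expr.eval, hD]
    congr 3
    ext j
    simp only [and_congr_right_iff]
    intro _
    constructor
    · rintro ⟨k, hk, hk'⟩
      rwa [Fin.ext hk]
    · exact fun h => ⟨j, rfl, h⟩
  · intro p h1 h2 acc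
    obtain ⟨j, hj, hp⟩ := H.block_mem (i := i) (p := p) (Finset.mem_Ico.2 ⟨h1, by omega⟩)
    have : (∃ j : Fin n, s.arr 1 p = j ∧ C i j) ↔ C i j := by
      constructor
      · rintro ⟨k, hk, hk'⟩
        rwa [Fin.ext (hp.symm.trans hk)]
      · exact fun h => ⟨j, hp, h⟩
    simp only [upd, this, hC i j p acc hp]
    simp [Expr.eval, Mem.at]

/-- Counting in closed neighbourhoods. -/
theorem cnt_closed (H : HoldsGraph G num s) {a : ℕ} {c₀ c : Expr} (h : (cnt a c₀ c).Holds s)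
    (C : Fin n → Prop) [DecidablePred C]
    (hD : ∀ i : Fin n, c₀.eval (s.at i 0 0) ≠ 0 ↔ C i)
    (hC : ∀ (i j : Fin n) (p acc : ℕ), s.arr 1 p = j → (c.eval (s.at i p acc) ≠ 0 ↔ C j))
    (i : Fin n) :
    s.arr a i = (Finset.univ.filter fun j => (j = i ∨ G.Adj i j) ∧ C j).card := by
  rw [cnt_eq H h C (fun _ j => C j) hD hC i]
  have : (Finset.univ.filter fun j => (j = i ∨ G.Adj i j) ∧ C j) =
      (Finset.univ.filter fun j => j = i ∧ C i) ∪
        (Finset.univ.filter fun j => G.Adj i j ∧ C j) := by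
    ext j
    simp only [Finset.mem_filter, Finset.mem_univ, true_and, Finset.mem_union]
    constructor
    · rintro ⟨rfl | h, h'⟩ <;> tauto
    · rintro (⟨rfl, h⟩ | h) <;> tauto
  rw [this, Finset.card_union_of_disjoint]
  · congr 1
    split_ifs with h <;> simp [h, Finset.filter_eq']
  · rw [Finset.disjoint_filter]
    rintro j - ⟨rfl, h⟩ ⟨h', -⟩
    exact G.loopless.irrefl _ h'

theorem mx_eq (H : HoldsGraph G num s) {a : ℕ} {c₀ v₀ c v : Expr} (h : (mx a c₀ v₀ c v).Holds s)
    (D : Fin n → Prop) (C : Fin n → Prop) (w : Fin n → ℕ) [DecidablePred D] [DecidablePred C]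
    (hD : ∀ i : Fin n, c₀.eval (s.at i 0 0) ≠ 0 ↔ D i)
    (hC : ∀ (i j : Fin n) (p acc : ℕ), s.arr 1 p = j → (c.eval (s.at i p acc) ≠ 0 ↔ C j))
    (hw : ∀ (i j : Fin n) (p acc : ℕ), s.arr 1 p = j → v.eval (s.at i p acc) = w j)
    (i : Fin n) :
    s.arr a i = max (if D i then v₀.eval (s.at i 0 0) else 0)
      ((Finset.univ.filter fun j => G.Adj i j ∧ C j).sup w) := by
  simp only [Holds, mx, if_true] at h
  rw [h i (by rw [H.size]; exact i.2), value]
  simp only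
  classical
  -- The default 0 outside the vertex range is harmless: every entry of a block is a vertex.
  set w' : ℕ → ℕ := fun k => if hk : k < n then w ⟨k, hk⟩ else 0
  rw [foldRange_max (C := fun p => ∃ j : Fin n, s.arr 1 p = j ∧ C j) (w := fun p => w' (s.arr 1 p))]
  · rw [Nat.add_sub_cancel' (H.mono i (by rw [H.size]; exact i.2))]
    simp only [upd, hD]
    congr 1
    apply le_antisymm
    · apply Finset.sup_le
      intro p hp
      rw [Finset.mem_filter] at hp
      obtain ⟨j, hj, hpj⟩ := H.block_mem hp.1
      obtain ⟨k, hk, hk'⟩ := hp.2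
      obtain rfl : j = k := Fin.ext (hpj.symm.trans hk)
      simp only [hpj, w', j.2, dif_pos]
      exact Finset.le_sup (f := w) (by simp [hj, hk'])
    · apply Finset.sup_le
      intro j hj
      simp only [Finset.mem_filter, Finset.mem_univ, true_and] at hj
      obtain ⟨p, h1, h2, h3⟩ := (H.neighbour i j).1 hj.1
      have : w j = w' (s.arr 1 p) := by simp [h3, w']
      rw [this]
      exact Finset.le_sup (f := fun p => w' (s.arr 1 p))
        (Finset.mem_filter.2 ⟨Finset.mem_Ico.2 ⟨h1, h2⟩, j, h3, hj.2⟩)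
  · intro p h1 h2 acc
    obtain ⟨j, hj, hp⟩ := H.block_mem (i := i) (p := p) (Finset.mem_Ico.2 ⟨h1, by omega⟩)
    have h3 : (∃ j : Fin n, s.arr 1 p = j ∧ C j) ↔ C j := by
      constructor
      · rintro ⟨k, hk, hk'⟩
        rwa [Fin.ext (hp.symm.trans hk)]
      · exact fun h => ⟨j, hp, h⟩
    have h4 : w' (s.arr 1 p) = w j := by simp [hp, w']
    have h5 := hC i j p acc hp
    simp only [upd, Expr.eval_band, Expr.eval, hw i j p acc hp, h3, h4, ← h5]
    simp only [Mem.at]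
    simp
    exact if_congr Iff.rfl rfl rfl

/-- Maxima over closed neighbourhoods. -/
theorem mx_closed (H : HoldsGraph G num s) {a : ℕ} {c₀ v₀ c v : Expr}
    (h : (mx a c₀ v₀ c v).Holds s) (C : Fin n → Prop) (w : Fin n → ℕ) [DecidablePred C]
    (hD : ∀ i : Fin n, c₀.eval (s.at i 0 0) ≠ 0 ↔ C i)
    (hv : ∀ i : Fin n, v₀.eval (s.at i 0 0) = w i)
    (hC : ∀ (i j : Fin n) (p acc : ℕ), s.arr 1 p = j → (c.eval (s.at i p acc) ≠ 0 ↔ C j))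
    (hw : ∀ (i j : Fin n) (p acc : ℕ), s.arr 1 p = j → v.eval (s.at i p acc) = w j)
    (i : Fin n) :
    s.arr a i = (Finset.univ.filter fun j => (j = i ∨ G.Adj i j) ∧ C j).sup w := by
  rw [mx_eq H h C C w hD hC hw i, hv]
  have : (Finset.univ.filter fun j => (j = i ∨ G.Adj i j) ∧ C j) =
      (Finset.univ.filter fun j => j = i ∧ C i) ∪
        (Finset.univ.filter fun j => G.Adj i j ∧ C j) := by
    ext j
    simp only [Finset.mem_filter, Finset.mem_univ, true_and, Finset.mem_union]
    constructor
    · rintro ⟨rfl | h, h'⟩ <;> tauto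
    · rintro (⟨rfl, h⟩ | h) <;> tauto
  rw [this, Finset.sup_union]
  congr 1
  split_ifs with h <;> simp [h, Finset.filter_eq']

theorem map_eq (H : HoldsGraph G num s) {a : ℕ} {c₀ v₀ : Expr} (h : (map a c₀ v₀).Holds s)
    (i : Fin n) : s.arr a i = if c₀.eval (s.at i 0 0) ≠ 0 then v₀.eval (s.at i 0 0) else 0 := by
  simp only [Holds, map, if_true] at h
  rw [h i (by rw [H.size]; exact i.2), value]
  simp only
  rw [foldRange_id (by simp [upd, Expr.eval])]
  rfl

theorem mark_iff (H : HoldsGraph G num s) {a : ℕ} {c₀ : Expr} (h : (mark a c₀).Holds s)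
    (i : Fin n) : s.arr a i ≠ 0 ↔ c₀.eval (s.at i 0 0) ≠ 0 := by
  rw [map_eq H h]
  split_ifs with h' <;> simp [Expr.eval, h']

theorem sum_eq (H : HoldsGraph G num s) {a : ℕ} {c v : Expr} (h : (sum a c v).Holds s)
    (C : Fin n → Prop) (w : Fin n → ℕ) [DecidablePred C]
    (hC : ∀ (i : Fin n) (acc : ℕ), c.eval (s.at i 0 acc) ≠ 0 ↔ C i)
    (hw : ∀ (i : Fin n) (acc : ℕ), v.eval (s.at i 0 acc) = w i) :
    s.arr a 0 = ∑ i ∈ Finset.univ.filter C, w i := by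
  classical
  simp only [Holds, sum, Bool.false_eq_true, if_false] at h
  rw [h, total]
  simp only [H.size]
  have h0 : upd (.lit 0) (.lit 0) s 0 0 0 = 0 := rfl
  rw [h0, foldRange_sum (C := fun k => ∃ hk : k < n, C ⟨k, hk⟩)
    (w := fun k => if hk : k < n then w ⟨k, hk⟩ else 0)]
  · rw [Finset.sum_filter, Finset.sum_filter, Finset.sum_range]
    simp
  · intro p hp acc
    have h1 := hC ⟨p, hp⟩ acc
    have h2 := hw ⟨p, hp⟩ acc
    simp only at h1 h2
    simp only [upd, h1, hp, dif_pos, exists_true_left, Expr.eval, h2]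
    simp [Mem.at]

theorem count_eq (H : HoldsGraph G num s) {a : ℕ} {c : Expr} (h : (count a c).Holds s)
    (C : Fin n → Prop) [DecidablePred C]
    (hC : ∀ (i : Fin n) (acc : ℕ), c.eval (s.at i 0 acc) ≠ 0 ↔ C i) :
    s.arr a 0 = (Finset.univ.filter C).card := by
  rw [sum_eq H h C (fun _ => 1) hC (fun _ _ => rfl)]
  simp

theorem const_eq {a : ℕ} {c₀ v₀ : Expr} (h : (const a c₀ v₀).Holds s) :
    s.arr a 0 = if c₀.eval (s.at 0 0 0) ≠ 0 then v₀.eval (s.at 0 0 0) else 0 := by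
  simp only [Holds, const, Bool.false_eq_true, if_false] at h
  rw [h, total]
  simp only
  rw [foldRange_id (by simp [upd, Expr.eval])]
  rfl

end Pass

end WED

namespace WED

/-! ## Efficient domination of `N_2 ∪ R` by vertices of `R` -/

/-- `D ⊆ R`, and every vertex of `N ∪ R` is dominated by exactly one vertex of `D`. -/
def IsRestrictedED {V : Type*} (G : SimpleGraph V) (N R : V → Prop) (D : Finset V) : Prop :=
  (∀ d ∈ D, R d) ∧ ∀ x, N x ∨ R x → ∃! d, d ∈ D ∧ (d = x ∨ G.Adj d x)

/-- No induced path on four vertices in `R`. -/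
def NoPathIn {V : Type*} (G : SimpleGraph V) (R : V → Prop) : Prop :=
  ∀ a b c d, R a → R b → R c → R d → G.Adj a b → G.Adj b c → G.Adj c d →
    a ≠ c → b ≠ d → ¬ G.Adj a c → ¬ G.Adj b d → ¬ G.Adj a d → a ≠ d → False

/-- An edge in `R` that is not met by a vertex `x ∈ N` is met by each neighbour of `x` in `R`. -/
def EdgesMet {V : Type*} (G : SimpleGraph V) (N R : V → Prop) : Prop :=
  ∀ x u a b, N x → R u → R a → R b → G.Adj x u → G.Adj a b → ¬ G.Adj x a → ¬ G.Adj x b →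
    u ≠ a → u ≠ b → ¬ G.Adj u a → ¬ G.Adj u b → False

section Classes

variable {n : ℕ} (G : SimpleGraph (Fin n)) (R : Fin n → Prop)

open Classical in
/-- The degree in `G[R]`. -/
noncomputable def degIn (i : Fin n) : ℕ := (Finset.univ.filter fun j => G.Adj i j ∧ R j).card

/-- The vertices of `R` that have no neighbour of larger degree in `G[R]`. -/
def LocMax (i : Fin n) : Prop := R i ∧ ∀ j, G.Adj i j → R j → degIn G R j ≤ degIn G R i

open Classical in
/-- A code of the largest local maximum in the closed neighbourhood. -/
noncomputable def code (i : Fin n) : ℕ :=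
  (Finset.univ.filter fun j => (j = i ∨ G.Adj i j) ∧ LocMax G R j).sup fun j => (j : ℕ) + 1

/-- The codes distinguish the components of `G[R]`, each of which has a universal vertex. -/
def Coherent : Prop :=
  (∀ i, R i → code G R i ≠ 0) ∧ ∀ i j, R i → R j → G.Adj i j → code G R i = code G R j

variable {G R}

theorem card_closed [DecidableRel G.Adj] [DecidablePred R] {u : Fin n} (hu : R u) :
    (Finset.univ.filter fun j => (j = u ∨ G.Adj u j) ∧ R j).card = degIn G R u + 1 := by
  have : (Finset.univ.filter fun j => (j = u ∨ G.Adj u j) ∧ R j) =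
      insert u (Finset.univ.filter fun j => G.Adj u j ∧ R j) := by
    ext j
    simp only [Finset.mem_filter, Finset.mem_univ, true_and, Finset.mem_insert]
    constructor
    · rintro ⟨rfl | h, h'⟩ <;> tauto
    · rintro (rfl | h) <;> tauto
  rw [this, Finset.card_insert_of_notMem (by simp)]
  unfold degIn
  congr!

/-- The shift by one in the code separates vertex 0 from the empty supremum. -/
theorem exists_of_code_ne_zero {i : Fin n} (h : code G R i ≠ 0) :
    ∃ c : Fin n, (c = i ∨ G.Adj i c) ∧ LocMax G R c ∧ code G R i = c + 1 := by
  classical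
  set S := Finset.univ.filter fun j => (j = i ∨ G.Adj i j) ∧ LocMax G R j with hS
  have hne : S.Nonempty := by
    rw [Finset.nonempty_iff_ne_empty]
    intro he
    apply h
    unfold code
    convert Finset.sup_empty
    rfl
  obtain ⟨c, hc, hc'⟩ := Finset.exists_mem_eq_sup S hne fun j => (j : ℕ) + 1
  rw [hS, Finset.mem_filter] at hc
  refine ⟨c, hc.2.1, hc.2.2, ?_⟩
  rw [← hc']
  unfold code
  congr!

theorem le_code {i j : Fin n} (h : j = i ∨ G.Adj i j) (hj : LocMax G R j) :
    (j : ℕ) + 1 ≤ code G R i := by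
  classical
  exact Finset.le_sup (f := fun j : Fin n => (j : ℕ) + 1) (by simp [h, hj])

/-- The local maximum that attains the code lies in the same class, so its own code is the same: it
represents the class. Centers make it possible to count classes by counting vertices. -/
theorem Coherent.code_center (H : Coherent G R) {i : Fin n} (hi : R i) :
    ∃ c : Fin n, (c = i ∨ G.Adj i c) ∧ LocMax G R c ∧ code G R i = c + 1 ∧ code G R c = c + 1 := by
  obtain ⟨c, h1, h2, h3⟩ := exists_of_code_ne_zero (H.1 i hi)
  refine ⟨c, h1, h2, h3, ?_⟩
  rcases h1 with rfl | h1
  · exact h3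
  · rw [← h3, H.2 i c hi h2.1 h1]

/-- A local maximum is universal in its class. -/
theorem Coherent.code_eq_iff (H : Coherent G R) {u r : Fin n} (hu : LocMax G R u) (hr : R r) :
    code G R r = code G R u ↔ r = u ∨ G.Adj u r := by
  classical
  obtain ⟨c, h1, h2, h3, h4⟩ := H.code_center hu.1
  -- Each vertex of the class attains its code in its own closed neighbourhood, hence at `c`: the
  -- center sees the whole class.
  have hc : ∀ r, R r → code G R r = code G R u → r = c ∨ G.Adj c r := by
    intro r hr h
    obtain ⟨d, h1', h2', h3', -⟩ := H.code_center hr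
    have : d = c := by rw [h3, h3'] at h; exact Fin.ext (by omega)
    subst this
    rcases h1' with rfl | h
    · exact Or.inl rfl
    · exact Or.inr h.symm
  constructor
  swap
  · rintro (rfl | h)
    · rfl
    · exact (H.2 u r hu.1 hr h).symm
  intro h
  have hsub : (Finset.univ.filter fun j => (j = u ∨ G.Adj u j) ∧ R j) ⊆
      Finset.univ.filter fun j => (j = c ∨ G.Adj c j) ∧ R j := by
    intro j hj
    simp only [Finset.mem_filter, Finset.mem_univ, true_and] at hj ⊢
    refine ⟨hc j hj.2 ?_, hj.2⟩
    rcases hj.1 with rfl | h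
    · rfl
    · exact (H.2 u j hu.1 hj.2 h).symm
  -- As `c` is `u` or a neighbour of the local maximum `u`, comparing degrees turns the inclusion of
  -- closed neighbourhoods into an equality.
  have hle : degIn G R c ≤ degIn G R u := by
    rcases h1 with rfl | h1
    · rfl
    · exact hu.2 c h1 h2.1
  have heq := Finset.eq_of_subset_of_card_le hsub
      (by rw [card_closed hu.1, card_closed h2.1]; omega)
  have hmem : r ∈ Finset.univ.filter fun j => (j = c ∨ G.Adj c j) ∧ R j := by
    simp [hr, hc r hr h]
  rw [← heq] at hmem
  simpa [hr] using hmem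

/-- If `G[R]` has no induced path on four vertices and an efficient dominating set, then the
codes distinguish the components. -/
theorem coherent_of_isRestrictedED {N : Fin n → Prop} (hP : NoPathIn G R) {D : Finset (Fin n)}
    (hD : IsRestrictedED G N R D) : Coherent G R := by
  classical
  have hex : ∀ r, R r → ∃ d, d ∈ D ∧ (d = r ∨ G.Adj d r) := fun r hr => (hD.2 r (.inr hr)).exists
  have huniq : ∀ {r d d'}, R r → d ∈ D → d' ∈ D → (d = r ∨ G.Adj d r) → (d' = r ∨ G.Adj d' r) →
      d = d' := fun hr h1 h2 h3 h4 => (hD.2 _ (.inr hr)).unique ⟨h1, h3⟩ ⟨h2, h4⟩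
  -- neighbours in `R` are dominated by the same vertex
  have hsame : ∀ {r r' d}, R r → R r' → G.Adj r r' → d ∈ D → (d = r ∨ G.Adj d r) →
      (d = r' ∨ G.Adj d r') := by
    intro r r' d hr hr' hrr hd hdr
    by_contra hcon
    push Not at hcon
    obtain ⟨d', hd', hdr'⟩ := hex r' hr'
    rcases hdr with rfl | hdr
    · exact hcon.2 hrr
    have hne : d ≠ d' := by
      rintro rfl
      rcases hdr' with h | h
      · exact hcon.1 h
      · exact hcon.2 h
    have h1 : ¬ (d' = r ∨ G.Adj d' r) := fun h => hne (huniq hr hd hd' (.inr hdr) h)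
    push Not at h1
    have h2 : ¬ G.Adj d d' := fun h => hne (huniq (hD.1 d' hd') hd hd' (.inr h) (.inl rfl))
    rcases hdr' with rfl | hdr'
    · exact h1.2 hrr.symm
    -- Otherwise `d`, `r`, `r'`, `d'` would be an induced path in `R`.
    · exact hP d r r' d' (hD.1 d hd) hr hr' (hD.1 d' hd') hdr hrr hdr'.symm hcon.1 h1.1.symm hcon.2
        (fun h => h1.2 h.symm) h2 hne
  -- The dominator of `j` also dominates the neighbours of `j` in `R`. So within `R` its closed
  -- neighbourhood contains that of `j`, and equals it if the degrees agree.
  have hcard : ∀ {d j}, d ∈ D → R j → (d = j ∨ G.Adj d j) →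
      degIn G R j ≤ degIn G R d ∧ (degIn G R d ≤ degIn G R j → ∀ k, R k → (d = k ∨ G.Adj d k) →
        (k = j ∨ G.Adj j k)) := by
    intro d j hd hj hdj
    have hsub : (Finset.univ.filter fun k => (k = j ∨ G.Adj j k) ∧ R k) ⊆
        Finset.univ.filter fun k => (k = d ∨ G.Adj d k) ∧ R k := by
      intro k hk
      simp only [Finset.mem_filter, Finset.mem_univ, true_and] at hk ⊢
      refine ⟨?_, hk.2⟩
      rcases hk.1 with rfl | h
      · exact hdj.imp Eq.symm id
      · exact (hsame hj hk.2 h hd hdj).imp Eq.symm id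
    have h1 := Finset.card_le_card hsub
    rw [card_closed hj, card_closed (hD.1 d hd)] at h1
    refine ⟨by omega, fun hle k hk hdk => ?_⟩
    have heq := Finset.eq_of_subset_of_card_le hsub
        (by rw [card_closed hj, card_closed (hD.1 d hd)]; omega)
    have hmem : k ∈ Finset.univ.filter fun k => (k = d ∨ G.Adj d k) ∧ R k := by
      simp [hk, hdk.imp Eq.symm id]
    rw [← heq] at hmem
    simpa [hk] using hmem
  have hlm : ∀ d ∈ D, LocMax G R d := fun d hd =>
    ⟨hD.1 d hd, fun j hj hRj => (hcard hd hRj (.inr hj)).1⟩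
  -- the local maxima near a vertex are those that its dominator dominates
  have hnear : ∀ {d r j}, d ∈ D → R r → (d = r ∨ G.Adj d r) → LocMax G R j →
      ((j = r ∨ G.Adj r j) ↔ (d = j ∨ G.Adj d j)) := by
    intro d r j hd hr hdr hj
    constructor
    · rintro (rfl | h)
      · exact hdr
      · exact hsame hr hj.1 h hd hdr
    · intro hdj
      have h1 := (hcard hd hj.1 hdj).2 (by
        rcases hdj with rfl | h
        · rfl
        · exact hj.2 d h.symm (hD.1 d hd)) r hr hdr
      exact h1.imp Eq.symm fun h => h.symm
  refine ⟨fun r hr => ?_, fun r r' hr hr' hrr => ?_⟩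
  · obtain ⟨d, hd, hdr⟩ := hex r hr
    have := le_code (i := r) (hdr.imp id fun h => h.symm) (hlm d hd)
    omega
  · obtain ⟨d, hd, hdr⟩ := hex r hr
    have hdr' := hsame hr hr' hrr hd hdr
    unfold code
    congr 1
    ext j
    simp only [Finset.mem_filter, Finset.mem_univ, true_and]
    constructor
    · rintro ⟨h1, h2⟩
      exact ⟨(hnear hd hr' hdr' h2).2 ((hnear hd hr hdr h2).1 h1), h2⟩
    · rintro ⟨h1, h2⟩
      exact ⟨(hnear hd hr hdr h2).2 ((hnear hd hr' hdr' h2).1 h1), h2⟩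

/-- The efficient dominating sets choose a local maximum in each class. -/
theorem Coherent.isRestrictedED_iff (H : Coherent G R) {N : Fin n → Prop} (hN : ∀ x, N x → ¬ R x)
    {D : Finset (Fin n)} :
    IsRestrictedED G N R D ↔ (∀ d ∈ D, LocMax G R d) ∧
      (∀ r, R r → ∃! d, d ∈ D ∧ code G R d = code G R r) ∧
      ∀ x, N x → ∃! d, d ∈ D ∧ G.Adj d x := by
  constructor
  · intro hD
    have hcls : ∀ {r d}, R r → d ∈ D → (d = r ∨ G.Adj d r) → code G R d = code G R r := by
      rintro r d hr hd (rfl | h)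
      · rfl
      · exact H.2 d r (hD.1 d hd) hr h
    -- Two members of `D` in one class would both dominate its center.
    have huniq : ∀ {d d'}, d ∈ D → d' ∈ D → code G R d = code G R d' → d = d' := by
      intro d d' hd hd' h
      obtain ⟨c, h1, h2, h3, h4⟩ := H.code_center (hD.1 d hd)
      have hc := (H.code_eq_iff h2 (hD.1 d hd)).1 (h3.trans h4.symm)
      have hc' := (H.code_eq_iff h2 (hD.1 d' hd')).1 (h.symm.trans (h3.trans h4.symm))
      exact (hD.2 c (.inr h2.1)).unique ⟨hd, hc.imp id fun h => h.symm⟩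
        ⟨hd', hc'.imp id fun h => h.symm⟩
    have huniv : ∀ {r d}, R r → d ∈ D → code G R d = code G R r → (d = r ∨ G.Adj d r) := by
      intro r d hr hd h
      obtain ⟨d', ⟨hd', h'⟩, -⟩ := hD.2 r (.inr hr)
      rwa [huniq hd hd' (h.trans (hcls hr hd' h').symm)]
    refine ⟨fun d hd => ⟨hD.1 d hd, fun j hj hRj => ?_⟩, fun r hr => ?_, fun x hx => ?_⟩
    · classical
      unfold degIn
      -- The closed neighbourhood of `j` in `R` stays in the class, all of which is dominated by
      -- `d`.
      have hsub : (insert j (Finset.univ.filter fun k => G.Adj j k ∧ R k)) ⊆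
          insert d (Finset.univ.filter fun k => G.Adj d k ∧ R k) := by
        have hjd := H.2 d j (hD.1 d hd) hRj hj
        intro k hk
        have hRk : R k ∧ code G R d = code G R k := by
          simp only [Finset.mem_insert, Finset.mem_filter, Finset.mem_univ, true_and] at hk
          rcases hk with rfl | ⟨h1, h2⟩
          · exact ⟨hRj, hjd⟩
          · exact ⟨h2, hjd.trans (H.2 j k hRj h2 h1)⟩
        simp only [Finset.mem_insert, Finset.mem_filter, Finset.mem_univ, true_and]
        rcases huniv hRk.1 hd hRk.2 with h | h
        · exact .inl h.symm
        · exact .inr ⟨h, hRk.1⟩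
      have := Finset.card_le_card hsub
      rw [Finset.card_insert_of_notMem (by simp), Finset.card_insert_of_notMem (by simp)] at this
      convert Nat.le_of_succ_le_succ this
    · obtain ⟨d, ⟨hd, h⟩, -⟩ := hD.2 r (.inr hr)
      have := hcls hr hd h
      exact ⟨d, ⟨hd, this⟩, fun d' hd' => huniq hd'.1 hd (hd'.2.trans this.symm)⟩
    · obtain ⟨d, ⟨hd, h⟩, hu⟩ := hD.2 x (.inl hx)
      refine ⟨d, ⟨hd, h.resolve_left ?_⟩, fun d' hd' => hu d' ⟨hd'.1, .inr hd'.2⟩⟩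
      rintro rfl
      exact hN _ hx (hD.1 _ hd)
  · rintro ⟨h1, h2, h3⟩
    refine ⟨fun d hd => (h1 d hd).1, fun x hx => ?_⟩
    by_cases hr : R x
    · obtain ⟨d, ⟨hd, h⟩, hu⟩ := h2 x hr
      have key : ∀ d ∈ D, (d = x ∨ G.Adj d x) ↔ code G R d = code G R x := fun d hd => by
        rw [eq_comm (a := d), ← H.code_eq_iff (h1 d hd) hr, eq_comm]
      exact ⟨d, ⟨hd, (key d hd).2 h⟩, fun d' hd' => hu d' ⟨hd'.1, (key d' hd'.1).1 hd'.2⟩⟩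
    · have hx' := hx.resolve_right hr
      obtain ⟨d, ⟨hd, h⟩, hu⟩ := h3 x hx'
      refine ⟨d, ⟨hd, .inr h⟩, fun d' hd' => hu d' ⟨hd'.1, hd'.2.resolve_left ?_⟩⟩
      rintro rfl
      exact hr (h1 _ hd'.1).1

end Classes

end WED

namespace WED

/-! ## Exchanging one vertex of a reference set -/

section Exchange

variable {n : ℕ} (G : SimpleGraph (Fin n)) (cl : Fin n → ℕ) (U : Fin n → Prop) (x₀ : Fin n)

/-- `U` is the set of admissible choices and `x₀` a fixed vertex of `N`. In a solution every chosen
vertex except the one that hits `x₀` is missed. -/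
def Missed (i : Fin n) : Prop := U i ∧ ¬ G.Adj i x₀

open Classical in
/-- The number of missed vertices in a class. -/
noncomputable def missCount (k : ℕ) : ℕ :=
  (Finset.univ.filter fun j => Missed G U x₀ j ∧ cl j = k).card

open Classical in
/-- A code of the last missed vertex in a class. -/
noncomputable def missCode (k : ℕ) : ℕ :=
  (Finset.univ.filter fun j => Missed G U x₀ j ∧ cl j = k).sup fun j => (j : ℕ) + 1

/-- The reference set: the last missed vertex of each class. -/
def Ref (i : Fin n) : Prop := Missed G U x₀ i ∧ missCode G cl U x₀ (cl i) = i + 1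

open Classical in
noncomputable def hits (x : Fin n) : ℕ :=
  (Finset.univ.filter fun j => G.Adj x j ∧ Ref G cl U x₀ j).card

open Classical in
/-- The class of the reference vertex adjacent to `x`, if there is just one. -/
noncomputable def hitClass (x : Fin n) : ℕ :=
  (Finset.univ.filter fun j => G.Adj x j ∧ Ref G cl U x₀ j).sup cl

open Classical in
/-- The reference set with `u` in place of the reference vertex of its class. -/
noncomputable def exchange (u : Fin n) : Finset (Fin n) :=
  Finset.univ.filter fun i => i = u ∨ Ref G cl U x₀ i ∧ cl i ≠ cl u

variable {G cl U x₀}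

theorem missCode_eq_succ {k : ℕ} {d : Fin n} (h : missCode G cl U x₀ k = d + 1) :
    Ref G cl U x₀ d ∧ cl d = k := by
  classical
  set S := Finset.univ.filter fun j => Missed G U x₀ j ∧ cl j = k with hS
  have hk : missCode G cl U x₀ k = S.sup fun j => (j : ℕ) + 1 := by unfold missCode; congr!
  have hne : S.Nonempty := by
    rw [Finset.nonempty_iff_ne_empty]
    intro he
    rw [hk, he] at h
    simp at h
  obtain ⟨c, hc, hc'⟩ := Finset.exists_mem_eq_sup S hne fun j => (j : ℕ) + 1
  have hcd : c = d := Fin.ext (by omega)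
  subst hcd
  rw [hS, Finset.mem_filter] at hc
  exact ⟨⟨hc.2.1, by rw [hc.2.2, h]⟩, hc.2.2⟩

theorem Ref.missCode_eq {d : Fin n} (h : Ref G cl U x₀ d) : missCode G cl U x₀ (cl d) = d + 1 := h.2

theorem Ref.eq {d e : Fin n} (hd : Ref G cl U x₀ d) (he : Ref G cl U x₀ e) (h : cl d = cl e) :
    d = e := by
  have h1 := hd.2
  have h2 := he.2
  rw [h] at h1
  exact Fin.ext (by omega)

theorem Missed.exists_ref {j : Fin n} (h : Missed G U x₀ j) : ∃ d, Ref G cl U x₀ d ∧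
    cl d = cl j := by
  classical
  have h1 : (j : ℕ) + 1 ≤ missCode G cl U x₀ (cl j) :=
    Finset.le_sup (f := fun j : Fin n => (j : ℕ) + 1) (by simp [h])
  have h2 : missCode G cl U x₀ (cl j) ≤ n := Finset.sup_le fun i _ => i.2
  exact ⟨⟨missCode G cl U x₀ (cl j) - 1, by omega⟩, missCode_eq_succ (by simp; omega)⟩

theorem missCode_ne_zero {k : ℕ} : missCode G cl U x₀ k ≠ 0 ↔ ∃ d, Ref G cl U x₀ d ∧ cl d = k := by
  constructor
  · intro h
    have h2 : missCode G cl U x₀ k ≤ n := Finset.sup_le fun i _ => i.2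
    exact ⟨⟨missCode G cl U x₀ k - 1, by omega⟩, missCode_eq_succ (by simp; omega)⟩
  · rintro ⟨d, hd, rfl⟩
    rw [hd.2]
    omega

theorem exists_missed_of_missCount {k : ℕ} (h : missCount G cl U x₀ k ≠ 0) :
    ∃ j, Missed G U x₀ j ∧ cl j = k := by
  classical
  obtain ⟨j, hj⟩ := Finset.card_ne_zero.1 h
  exact ⟨j, by simpa using hj⟩

theorem missCount_pos {j : Fin n} (h : Missed G U x₀ j) : 1 ≤ missCount G cl U x₀ (cl j) := by
  classical
  exact Finset.card_pos.2 ⟨j, by simp [h]⟩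

theorem Missed.ref_of_missCount {j : Fin n} (h : Missed G U x₀ j)
    (h1 : missCount G cl U x₀ (cl j) ≤ 1) : Ref G cl U x₀ j := by
  classical
  obtain ⟨d, hd, hdj⟩ := h.exists_ref (cl := cl)
  have : d = j := Finset.card_le_one.1 h1 d (by simp [hd.1, hdj]) j (by simp [h])
  exact this ▸ hd

variable {R N : Fin n → Prop}

/-- A choice of one vertex in each class that hits `N` exactly. -/
structure IsChoice (G : SimpleGraph (Fin n)) (cl : Fin n → ℕ) (R N U : Fin n → Prop)
    (D : Finset (Fin n)) : Prop where
  mem : ∀ d ∈ D, U d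
  cls : ∀ r, R r → ∃! d, d ∈ D ∧ cl d = cl r
  hit : ∀ x, N x → ∃! d, d ∈ D ∧ G.Adj d x

theorem mem_exchange {u i : Fin n} :
    i ∈ exchange G cl U x₀ u ↔ i = u ∨ Ref G cl U x₀ i ∧ cl i ≠ cl u := by
  simp [exchange]

/-- The vertex `u` is the member of `D` that hits `x₀`. Any other member is missed, hence the only
missed candidate of its class and so the reference vertex there. The bound is assumed only after `u`
is known, since it says nothing about the class of `u`; that the other counts are not 0 is witnessed
by `D`. -/
theorem IsChoice.eq_exchange (hUR : ∀ u, U u → R u) (hx : N x₀) {D : Finset (Fin n)}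
    (hD : IsChoice G cl R N U D) : ∃ u, U u ∧ G.Adj u x₀ ∧
      ((∀ r, R r → cl r ≠ cl u → missCount G cl U x₀ (cl r) ≤ 1) →
        (∀ r, R r → cl r ≠ cl u → missCount G cl U x₀ (cl r) = 1) ∧
          D = exchange G cl U x₀ u) := by
  obtain ⟨u, ⟨hu, hux⟩, huu⟩ := hD.hit x₀ hx
  have hcu : ∀ d ∈ D, cl d = cl u → d = u := fun d hd h =>
    (hD.cls u (hUR u (hD.mem u hu))).unique ⟨hd, h⟩ ⟨hu, rfl⟩
  have hmiss : ∀ d ∈ D, cl d ≠ cl u → Missed G U x₀ d := fun d hd h =>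
    ⟨hD.mem d hd, fun h' => h (by rw [huu d ⟨hd, h'⟩])⟩
  refine ⟨u, hD.mem u hu, hux, fun hle => ⟨fun r hr hru => ?_, ?_⟩⟩
  · obtain ⟨d, ⟨hd, hdr⟩, -⟩ := hD.cls r hr
    have := missCount_pos (cl := cl) (hmiss d hd (by rwa [hdr]))
    rw [hdr] at this
    exact le_antisymm (hle r hr hru) this
  · ext d
    rw [mem_exchange]
    constructor
    · intro hd
      by_cases h : cl d = cl u
      · exact .inl (hcu d hd h)
      · exact .inr ⟨(hmiss d hd h).ref_of_missCount (hle d (hUR d (hD.mem d hd)) h), h⟩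
    · rintro (rfl | ⟨h1, h2⟩)
      · exact hu
      · obtain ⟨e, ⟨he, hed⟩, -⟩ := hD.cls d (hUR d h1.1.1)
        have h3 := hmiss e he (by rwa [hed])
        have h4 := h3.ref_of_missCount (hle e (hUR e h3.1) (by rwa [hed]))
        rwa [h1.eq h4 hed.symm]

/-- In the other classes a count of one supplies the reference vertex. The class of `u` may have no
missed vertex at all, as `u` itself represents it. -/
theorem exchange_isChoice {u : Fin n} (hu : U u)
    (h1 : ∀ r, R r → cl r ≠ cl u → missCount G cl U x₀ (cl r) = 1)
    (hit : ∀ x, N x → ∃! d, d ∈ exchange G cl U x₀ u ∧ G.Adj d x) :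
    IsChoice G cl R N U (exchange G cl U x₀ u) := by
  refine ⟨fun d hd => ?_, fun r hr => ?_, hit⟩
  · rcases mem_exchange.1 hd with rfl | h
    · exact hu
    · exact h.1.1.1
  · by_cases h : cl r = cl u
    · refine ⟨u, ⟨mem_exchange.2 (.inl rfl), h.symm⟩, fun d hd => ?_⟩
      rcases mem_exchange.1 hd.1 with h' | h'
      · exact h'
      · exact absurd (hd.2.trans h) h'.2
    · obtain ⟨j, hj, hjr⟩ := exists_missed_of_missCount (by rw [h1 r hr h]; exact one_ne_zero)
      obtain ⟨d, hd, hdj⟩ := hj.exists_ref (cl := cl)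
      have hdr := hdj.trans hjr
      refine ⟨d, ⟨mem_exchange.2 (.inr ⟨hd, by rwa [hdr]⟩), hdr⟩, fun e he => ?_⟩
      rcases mem_exchange.1 he.1 with rfl | h'
      · exact absurd he.2.symm h
      · exact h'.1.eq hd (he.2.trans hdr.symm)

theorem existsUnique_iff_card {α : Type*} [Fintype α] (p : α → Prop) [DecidablePred p] :
    (∃! a, p a) ↔ (Finset.univ.filter p).card = 1 := by
  rw [Finset.card_eq_one]
  constructor
  · rintro ⟨a, ha, hu⟩
    exact ⟨a, by ext b; simpa using ⟨hu b, fun h => h ▸ ha⟩⟩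
  · rintro ⟨a, ha⟩
    have : ∀ b, p b ↔ b = a := fun b => by rw [← Finset.mem_singleton, ← ha]; simp
    exact ⟨a, (this a).2 rfl, fun b hb => (this b).1 hb⟩

-- The exchange adds `u` and discards the reference vertex of its class, if there is one. Correction
-- terms stand on both sides to avoid subtraction.
open Classical in
theorem card_exchange_hits {u : Fin n} (hu : G.Adj u x₀) (x : Fin n) :
    (Finset.univ.filter fun d => d ∈ exchange G cl U x₀ u ∧ G.Adj d x).card +
      (if ∃ d, Ref G cl U x₀ d ∧ cl d = cl u ∧ G.Adj d x then 1 else 0) =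
    hits G cl U x₀ x + if G.Adj u x then 1 else 0 := by
  have h1 : (Finset.univ.filter fun d => d ∈ exchange G cl U x₀ u ∧ G.Adj d x) =
      (Finset.univ.filter fun d => Ref G cl U x₀ d ∧ cl d ≠ cl u ∧ G.Adj d x) ∪
        Finset.univ.filter fun d => d = u ∧ G.Adj u x := by
    ext d
    simp only [mem_exchange, Finset.mem_filter, Finset.mem_univ, true_and, Finset.mem_union]
    constructor
    · rintro ⟨rfl | h, h'⟩ <;> tauto
    · rintro (h | ⟨rfl, h⟩) <;> tauto
  have h2 : (Finset.univ.filter fun d => G.Adj x d ∧ Ref G cl U x₀ d) =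
      (Finset.univ.filter fun d => Ref G cl U x₀ d ∧ cl d ≠ cl u ∧ G.Adj d x) ∪
        Finset.univ.filter fun d => Ref G cl U x₀ d ∧ cl d = cl u ∧ G.Adj d x := by
    ext d
    simp only [Finset.mem_filter, Finset.mem_univ, true_and, Finset.mem_union, G.adj_comm x d]
    tauto
  have h3 : (Finset.univ.filter fun d => d = u ∧ G.Adj u x).card = if G.Adj u x then 1 else 0 := by
    split_ifs with h <;> simp [h, Finset.filter_eq']
  have h4 : (Finset.univ.filter fun d => Ref G cl U x₀ d ∧ cl d = cl u ∧ G.Adj d x).card =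
      if ∃ d, Ref G cl U x₀ d ∧ cl d = cl u ∧ G.Adj d x then 1 else 0 := by
    split_ifs with h
    · rw [← existsUnique_iff_card]
      obtain ⟨d, hd⟩ := h
      exact ⟨d, hd, fun e he => he.1.eq hd.1 (he.2.1.trans hd.2.1.symm)⟩
    · rw [Finset.card_eq_zero, Finset.filter_eq_empty_iff]
      exact fun d _ hd => h ⟨d, hd⟩
  unfold hits
  rw [h1, h2, Finset.card_union_of_disjoint, Finset.card_union_of_disjoint, h3, h4]
  · ring
  · rw [Finset.disjoint_filter]
    rintro d - h h'
    exact h.2.1 h'.2.1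
  · rw [Finset.disjoint_filter]
    rintro d - h ⟨rfl, -⟩
    exact h.2.1 rfl

variable (G cl U x₀) in
/-- The vertices that `u` must hit. -/
def MustHit (u x : Fin n) : Prop :=
  hits G cl U x₀ x = 0 ∨ hits G cl U x₀ x = 1 ∧ hitClass G cl U x₀ x = cl u

/-- With a single hit, the supremum runs over one vertex and so identifies the class. For other
numbers of hits the value is never consulted. -/
theorem hitClass_eq_iff {x : Fin n} (h : hits G cl U x₀ x = 1) (k : ℕ) :
    hitClass G cl U x₀ x = k ↔ ∃ d, Ref G cl U x₀ d ∧ cl d = k ∧ G.Adj d x := by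
  classical
  obtain ⟨d, hd⟩ := Finset.card_eq_one.1 h
  have hd' : ∀ e, (G.Adj x e ∧ Ref G cl U x₀ e) ↔ e = d := fun e => by
    rw [← Finset.mem_singleton, ← hd]; simp
  have : hitClass G cl U x₀ x = cl d := by
    unfold hitClass
    rw [hd, Finset.sup_singleton]
  rw [this]
  constructor
  · rintro rfl
    have := (hd' d).2 rfl
    exact ⟨d, this.2, rfl, this.1.symm⟩
  · rintro ⟨e, he, rfl, hex⟩
    rw [(hd' e).1 ⟨hex.symm, he⟩]

/-- Discarding the old vertex of the class can lower the count by one, and `u` can raise it by one.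
If the remaining count is 0, then `u` must hit `x`; if it is 1, then `u` must not; more cannot be
repaired. Two hits are thus acceptable only if one of them comes from the discarded vertex. -/
theorem exchange_hit_iff {u : Fin n} (hu : G.Adj u x₀) (x : Fin n) :
    (∃! d, d ∈ exchange G cl U x₀ u ∧ G.Adj d x) ↔
      (G.Adj u x ↔ MustHit G cl U x₀ u x) ∧ hits G cl U x₀ x ≤ 2 ∧
        (hits G cl U x₀ x = 2 → ∃ d, Ref G cl U x₀ d ∧ cl d = cl u ∧ G.Adj d x) := by
  classical
  rw [existsUnique_iff_card]
  have h1 := card_exchange_hits (cl := cl) (U := U) hu x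
  have h0 : hits G cl U x₀ x = 0 → ¬ ∃ d, Ref G cl U x₀ d ∧ cl d = cl u ∧ G.Adj d x := by
    rintro h ⟨d, hd, -, hdx⟩
    have := Finset.card_eq_zero.1 h
    exact Finset.notMem_empty d (this ▸ by simp [hd, hdx.symm])
  have h2 := fun h => hitClass_eq_iff (G := G) (cl := cl) (U := U) (x₀ := x₀) (x := x) h (cl u)
  unfold MustHit
  by_cases ha : ∃ d, Ref G cl U x₀ d ∧ cl d = cl u ∧ G.Adj d x
  · simp only [ha, if_true, not_true, iff_true, imp_false] at h0 h1 h2 ⊢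
    have h3 : hits G cl U x₀ x = 1 ∧ hitClass G cl U x₀ x = cl u ↔ hits G cl U x₀ x = 1 :=
      and_iff_left_of_imp h2
    by_cases hb : G.Adj u x
    · simp only [hb, if_true, true_iff, h3, implies_true, and_true] at h1 ⊢
      omega
    · simp only [hb, if_false, false_iff, h3, implies_true, and_true] at h1 ⊢
      omega
  · simp only [ha, if_false, iff_false] at h1 h2 ⊢
    have h3 : ¬ (hits G cl U x₀ x = 1 ∧ hitClass G cl U x₀ x = cl u) := fun h => h2 h.1 h.2
    by_cases hb : G.Adj u x
    · simp only [hb, if_true, true_iff, h3, or_false, imp_false] at h1 ⊢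
      omega
    · simp only [hb, if_false, false_iff, h3, or_false, imp_false] at h1 ⊢
      omega

theorem card_filter_eq_iff {α : Type*} [Fintype α] {p q : α → Prop} [DecidablePred p]
    [DecidablePred q] (hpq : ∀ x, p x → q x) :
    (Finset.univ.filter p).card = (Finset.univ.filter q).card ↔ ∀ x, q x → p x := by
  have hsub : Finset.univ.filter p ⊆ Finset.univ.filter q := fun x hx => by
    simp only [Finset.mem_filter, Finset.mem_univ, true_and] at hx ⊢
    exact hpq x hx
  constructor
  · intro h x hx
    have := Finset.eq_of_subset_of_card_le hsub h.ge
    have hx' : x ∈ Finset.univ.filter q := by simp [hx]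
    rw [← this] at hx'
    simpa using hx'
  · intro h
    congr 1
    ext x
    simp only [Finset.mem_filter, Finset.mem_univ, true_and]
    exact ⟨hpq x, h x⟩

variable (G cl U x₀ N) in
open Classical in
/-- The test, by counting, that the exchange at `u` hits every vertex of `N` exactly once. -/
def HitTest (u : Fin n) (c₁ c₂ : ℕ) : Prop :=
  (Finset.univ.filter fun x => G.Adj u x ∧ N x ∧ MustHit G cl U x₀ u x).card =
      (Finset.univ.filter fun x => N x ∧ hits G cl U x₀ x = 0).card + c₁ ∧
    (Finset.univ.filter fun x => G.Adj u x ∧ N x ∧ ¬ MustHit G cl U x₀ u x).card = 0 ∧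
    (Finset.univ.filter fun x => N x ∧ 2 < hits G cl U x₀ x).card = 0 ∧
    (Finset.univ.filter fun x => N x ∧ hits G cl U x₀ x = 2).card = c₂

variable (G cl U x₀ N) in
open Classical in
/-- The number of vertices of `N` with exactly `k` hits adjacent to `d`. -/
noncomputable def hitDegree (k : ℕ) (d : Fin n) : ℕ :=
  (Finset.univ.filter fun x => G.Adj d x ∧ N x ∧ hits G cl U x₀ x = k).card

open Classical in
theorem hitDegree_of_ref {d u : Fin n} (hd : Ref G cl U x₀ d) (hdu : cl d = cl u) (k : ℕ) :
    hitDegree G cl U x₀ N k d = (Finset.univ.filter fun x =>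
      (N x ∧ hits G cl U x₀ x = k) ∧ ∃ d, Ref G cl U x₀ d ∧ cl d = cl u ∧ G.Adj d x).card := by
  unfold hitDegree
  congr 1
  ext x
  simp only [Finset.mem_filter, Finset.mem_univ, true_and]
  constructor
  · rintro ⟨h1, h2⟩
    exact ⟨h2, d, hd, hdu, h1⟩
  · rintro ⟨h2, e, he, heu, hex⟩
    rw [hd.eq he (hdu.trans heu.symm)]
    exact ⟨hex, h2⟩

/-- Set inclusions are replaced by cardinalities. The vertices that `u` must hit are those with no
hit and those hit only by the discarded vertex; the latter number `c₁`, so the first equation says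
that `u` reaches all of them. In the same way `c₂` compares the vertices hit twice with those among
them that the discarded vertex hits. Both numbers are attached to that vertex, so they can be
tabulated once for all `u`. -/
theorem hitTest_iff {u : Fin n} (hu : G.Adj u x₀) {c₁ c₂ : ℕ}
    (hc : ∀ d, Ref G cl U x₀ d → cl d = cl u →
      c₁ = hitDegree G cl U x₀ N 1 d ∧ c₂ = hitDegree G cl U x₀ N 2 d)
    (hc' : (¬ ∃ d, Ref G cl U x₀ d ∧ cl d = cl u) → c₁ = 0 ∧ c₂ = 0) :
    HitTest G cl U x₀ N u c₁ c₂ ↔ ∀ x, N x → ∃! d, d ∈ exchange G cl U x₀ u ∧ G.Adj d x := by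
  classical
  have hc'' : ∀ (k c : ℕ), (∀ d, Ref G cl U x₀ d → cl d = cl u → c = hitDegree G cl U x₀ N k d) →
      ((¬ ∃ d, Ref G cl U x₀ d ∧ cl d = cl u) → c = 0) → c = (Finset.univ.filter fun x =>
      (N x ∧ hits G cl U x₀ x = k) ∧ ∃ d, Ref G cl U x₀ d ∧ cl d = cl u ∧ G.Adj d x).card := by
    intro k c h1 h2
    by_cases h : ∃ d, Ref G cl U x₀ d ∧ cl d = cl u
    · obtain ⟨d, hd, hdu⟩ := h
      rw [h1 d hd hdu, hitDegree_of_ref hd hdu]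
    · rw [h2 h, eq_comm, Finset.card_eq_zero, Finset.filter_eq_empty_iff]
      rintro x - ⟨-, d, hd, hdu, -⟩
      exact h ⟨d, hd, hdu⟩
  have e1 := hc'' 1 c₁ (fun d hd hdu => (hc d hd hdu).1) fun h => (hc' h).1
  have e2 := hc'' 2 c₂ (fun d hd hdu => (hc d hd hdu).2) fun h => (hc' h).2
  have e3 : (Finset.univ.filter fun x => N x ∧ hits G cl U x₀ x = 0).card + c₁ =
      (Finset.univ.filter fun x => N x ∧ MustHit G cl U x₀ u x).card := by
    rw [e1, ← Finset.card_union_of_disjoint]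
    · congr 1
      ext x
      simp only [Finset.mem_filter, Finset.mem_univ, true_and, Finset.mem_union]
      constructor
      · rintro (h | ⟨⟨h1, h2⟩, h3⟩)
        · exact ⟨h.1, Or.inl h.2⟩
        · exact ⟨h1, Or.inr ⟨h2, (hitClass_eq_iff h2 _).2 h3⟩⟩
      · rintro ⟨h1, h2 | ⟨h2, h3⟩⟩
        · exact .inl ⟨h1, h2⟩
        · exact .inr ⟨⟨h1, h2⟩, (hitClass_eq_iff h2 _).1 h3⟩
    · rw [Finset.disjoint_filter]
      rintro x - ⟨-, h⟩ ⟨⟨-, h'⟩, -⟩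
      omega
  unfold HitTest
  rw [e3, e2, card_filter_eq_iff (fun x h => h.2), eq_comm (a := (Finset.univ.filter fun x => N x ∧
    hits G cl U x₀ x = 2).card), card_filter_eq_iff (fun x h => h.1), Finset.card_eq_zero,
    Finset.card_eq_zero, Finset.filter_eq_empty_iff, Finset.filter_eq_empty_iff]
  simp only [exchange_hit_iff hu]
  constructor
  · rintro ⟨h1, h2, h3, h4⟩ x hx
    refine ⟨⟨fun h => ?_, fun h => (h1 x ⟨hx, h⟩).1⟩, ?_, fun h => (h4 x ⟨hx, h⟩).2⟩
    · by_contra h'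
      exact h2 (Finset.mem_univ x) ⟨h, hx, h'⟩
    · by_contra h'
      exact h3 (Finset.mem_univ x) ⟨hx, by omega⟩
  · intro h
    refine ⟨fun x hx => ⟨(h x hx.1).1.2 hx.2, hx⟩, fun x _ hx => hx.2.2 ((h x hx.2.1).1.1 hx.1),
      fun x _ hx => ?_, fun x hx => ⟨hx, (h x hx.1).2.2 hx.2⟩⟩
    have := (h x hx.1).2.1
    omega

-- The number `a` is 0 or a summand of the reference sum, so the truncated subtraction is exact.
open Classical in
theorem sum_exchange (w : Fin n → ℕ) {u : Fin n} {a : ℕ}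
    (ha : ∀ d, Ref G cl U x₀ d → cl d = cl u → a = w d)
    (ha' : (¬ ∃ d, Ref G cl U x₀ d ∧ cl d = cl u) → a = 0) :
    ∑ i ∈ exchange G cl U x₀ u, w i =
      ∑ i ∈ Finset.univ.filter (fun i => Ref G cl U x₀ i), w i - a + w u := by
  have h1 : exchange G cl U x₀ u =
      insert u (Finset.univ.filter fun i => Ref G cl U x₀ i ∧ cl i ≠ cl u) := by
    ext i
    simp [mem_exchange]
  have h2 : ∑ i ∈ Finset.univ.filter (fun i => Ref G cl U x₀ i), w i =
      ∑ i ∈ Finset.univ.filter (fun i => Ref G cl U x₀ i ∧ cl i ≠ cl u), w i + a := by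
    have : Finset.univ.filter (fun i => Ref G cl U x₀ i) =
        (Finset.univ.filter fun i => Ref G cl U x₀ i ∧ cl i ≠ cl u) ∪
          Finset.univ.filter fun i => Ref G cl U x₀ i ∧ cl i = cl u := by
      ext i
      simp only [Finset.mem_filter, Finset.mem_univ, true_and, Finset.mem_union]
      tauto
    rw [this, Finset.sum_union]
    · congr 1
      by_cases h : ∃ d, Ref G cl U x₀ d ∧ cl d = cl u
      · obtain ⟨d, hd, hdu⟩ := h
        have : (Finset.univ.filter fun i => Ref G cl U x₀ i ∧ cl i = cl u) = {d} := by
          ext i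
          simp only [Finset.mem_filter, Finset.mem_univ, true_and, Finset.mem_singleton]
          exact ⟨fun h => h.1.eq hd (h.2.trans hdu.symm), by rintro rfl; exact ⟨hd, hdu⟩⟩
        rw [this, Finset.sum_singleton, ha d hd hdu]
      · rw [ha' h]
        apply Finset.sum_eq_zero
        intro i hi
        exact absurd ⟨i, by simpa using hi⟩ h
    · rw [Finset.disjoint_filter]
      rintro i - h h'
      exact h.2 h'.2
  rw [h1, Finset.sum_insert (by simp), h2]
  omega

end Exchange

end WED

namespace WED

/-! ## The algorithm for `G_v` -/

namespace Pass

open _root_.WED.Expr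

/-- A vertex with `c` of least value; `v'` is the value of the vertex `j` when the accumulator
holds `j + 1`. -/
def argmin (a : ℕ) (c v v' : Expr) : Pass :=
  ⟨false, a, lit 0, lit 0, band c (bor (bnot (reg 4)) (lt v v')), add (reg 2) (lit 1)⟩

theorem argmin_spec {n : ℕ} {G : SimpleGraph (Fin n)} [DecidableRel G.Adj] {num : Fin n → ℕ}
    {s : Mem} (H : HoldsGraph G num s) {a : ℕ} {c v v' : Expr} (h : (argmin a c v v').Holds s)
    (C : Fin n → Prop) (w : Fin n → ℕ)
    (hC : ∀ (i : Fin n) (acc : ℕ), c.eval (s.at i 0 acc) ≠ 0 ↔ C i)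
    (hv : ∀ (i : Fin n) (acc : ℕ), v.eval (s.at i 0 acc) = w i)
    (hv' : ∀ (i j : Fin n), v'.eval (s.at i 0 (j + 1)) = w j) :
    (s.arr a 0 = 0 ∧ ∀ i, ¬ C i) ∨ ∃ i : Fin n, C i ∧ s.arr a 0 = i + 1 ∧ ∀ j, C j → w i ≤ w j := by
  classical
  simp only [Holds, argmin, Bool.false_eq_true, if_false] at h
  rw [h, total]
  simp only [H.size]
  have h0 : upd (.lit 0) (.lit 0) s 0 0 0 = 0 := rfl
  rw [h0]
  have key : ∀ k ≤ n, ∀ acc, acc = foldRange (fun i acc => upd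
      (band c (bor (bnot (reg 4)) (lt v v'))) (add (reg 2) (lit 1)) s i 0 acc) 0 k 0 →
      (acc = 0 ∧ ∀ i : Fin n, (i : ℕ) < k → ¬ C i) ∨
      ∃ i : Fin n, C i ∧ acc = i + 1 ∧ ∀ j : Fin n, (j : ℕ) < k → C j → w i ≤ w j := by
    intro k
    induction k with
    | zero =>
      intro _ acc h
      exact .inl ⟨h, fun i hi => absurd hi (Nat.not_lt_zero _)⟩
    | succ k ih =>
      intro hk acc h
      simp only [foldRange, zero_add] at h
      specialize ih (by omega) _ rfl
      set b := foldRange (fun i acc => upd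
        (band c (bor (bnot (reg 4)) (lt v v'))) (add (reg 2) (lit 1)) s i 0 acc) 0 k 0
      have hCk := hC ⟨k, hk⟩ b
      have hvk := hv ⟨k, hk⟩ b
      simp only at hCk hvk
      have e4 : Expr.eval (s.at k 0 b) (reg 4) = b := by simp [Expr.eval, Mem.at]
      have e2 : Expr.eval (s.at k 0 b) (add (reg 2) (lit 1)) = k + 1 := by simp [Expr.eval, Mem.at]
      have elt : Expr.eval (s.at k 0 b) (lt v v') =
        if w ⟨k, hk⟩ < Expr.eval (s.at k 0 b) v' then 1 else 0 := by simp only [Expr.eval, hvk]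
      have htest : (band c (bor (bnot (reg 4)) (lt v v'))).eval (s.at k 0 b) ≠ 0 ↔
          C ⟨k, hk⟩ ∧ (b = 0 ∨ w ⟨k, hk⟩ < v'.eval (s.at k 0 b)) := by
        rw [eval_band, eval_bor, eval_bnot, e4, elt, ← hCk]
        have : ∀ p q : Prop, (¬ p → q) ↔ p ∨ q := fun p q => by tauto
        simp [this]
      rw [upd, if_congr htest e2 rfl] at h
      have hlast : ∀ j : Fin n, (j : ℕ) < k + 1 → (j : ℕ) < k ∨ j = ⟨k, hk⟩ := fun j hj => by
        rcases Nat.lt_succ_iff_lt_or_eq.1 hj with h | h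
        · exact .inl h
        · exact .inr (Fin.ext h)
      rcases ih with ⟨hb, hn⟩ | ⟨i, hi, hb, hmin⟩
      · by_cases hc : C ⟨k, hk⟩
        · refine .inr ⟨⟨k, hk⟩, hc, by simpa [hb, hc] using h, fun j hj hCj => ?_⟩
          rcases hlast j hj with h' | rfl
          · exact absurd hCj (hn j h')
          · exact le_rfl
        · refine .inl ⟨by simpa [hb, hc] using h, fun j hj => ?_⟩
          rcases hlast j hj with h' | rfl
          · exact hn j h'
          · exact hc
      · have hv'k := hv' ⟨k, hk⟩ i
        rw [← hb] at hv'k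
        simp only at hv'k
        rw [hv'k] at h
        by_cases hc : C ⟨k, hk⟩ ∧ w ⟨k, hk⟩ < w i
        · refine .inr ⟨⟨k, hk⟩, hc.1, by simpa [hb, hc] using h, fun j hj hCj => ?_⟩
          rcases hlast j hj with h' | rfl
          · exact hc.2.le.trans (hmin j h' hCj)
          · exact le_rfl
        · refine .inr ⟨i, hi, ?_, fun j hj hCj => ?_⟩
          · rw [h, if_neg, hb]
            rintro ⟨h1, h2⟩
            exact hc ⟨h1, h2.resolve_left (by omega)⟩
          · rcases hlast j hj with h' | rfl
            · exact hmin j h' hCj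
            · by_contra h'
              exact hc ⟨hCj, by omega⟩
  rcases key n le_rfl _ rfl with ⟨h1, h2⟩ | ⟨i, h1, h2, h3⟩
  · exact .inl ⟨h1, fun i => h2 i i.2⟩
  · exact .inr ⟨i, h1, h2, fun j => h3 j j.2⟩

end Pass

section Program

open _root_.WED.Expr Pass

/-- The current vertex. -/
def eI : Expr := reg 2
/-- The code of the current vertex. -/
def eI' : Expr := add (reg 2) (lit 1)
/-- The current neighbour. -/
def eJ : Expr := get 1 (reg 3)
def eJ' : Expr := add (get 1 (reg 3)) (lit 1)
def atI (a : ℕ) : Expr := get a (reg 2)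
def atJ (a : ℕ) : Expr := get a (get 1 (reg 3))
/-- A single value. -/
def sc (a : ℕ) : Expr := get a (lit 0)
/-- The weight of a vertex. -/
def wt (κ : ℕ) (e : Expr) : Expr := sub (get 2 e) (lit κ)

/-- The levels, and the components of `G[R]`. -/
def levelPasses (κ : ℕ) : List Pass :=
  [cnt 4 (lit 0) (eq eJ (reg 1)),
   cnt 5 (lit 0) (atJ 4),
   mark 6 (band (bnot (eq eI (reg 1))) (band (bnot (atI 4)) (atI 5))),
   mark 7 (band (bnot (eq eI (reg 1))) (band (bnot (atI 4)) (bnot (atI 5)))),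
   cnt 8 (lit 0) (atJ 7),
   cnt 9 (lit 0) (band (atJ 7) (lt (atI 8) (atJ 8))),
   mark 10 (band (atI 7) (bnot (atI 9))),
   mx 11 (atI 10) eI' (atJ 10) eJ',
   -- Nonzero where coherence fails: a vertex of R without a code, or with a neighbour in R of
   -- another code.
   cnt 12 (band (atI 7) (bnot (atI 11)))
     (band (band (atI 7) (atJ 7)) (bnot (eq (atI 11) (atJ 11)))),
   count 34 (atI 12),
   -- With weight codes κ is 1, which bars the code 0 of ∞ and makes the number minus κ the weight;
   -- with plain weights κ is 0.
   mark 13 (band (atI 10) (bnot (lt (get 2 (reg 2)) (lit κ)))),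
   -- The value is constant: any vertex of N_2 will do as x₀. The result is 0 if there is none.
   argmin 14 (atI 6) (lit 0) (lit 0)]

/-- The reference set. -/
def refPasses : List Pass :=
  [cnt 15 (lit 0) (eq eJ' (sc 14)),
   mark 16 (band (atI 13) (bnot (atI 15))),
   cnt 17 (atI 16) (atJ 16),
   mx 18 (atI 16) eI' (atJ 16) eJ',
   mark 19 (band (atI 16) (eq (atI 18) eI')),
   cnt 20 (lit 0) (atJ 19),
   mx 21 (lit 0) (lit 0) (atJ 19) (atJ 11)]

/-- The neighbours that must be hit. -/
def must : Expr := bor (bnot (atJ 20)) (band (eq (atJ 20) (lit 1)) (eq (atJ 21) (atI 11)))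

/-- The valid exchanges. -/
def testPasses (κ : ℕ) : List Pass :=
  [count 23 (band (atI 6) (bnot (atI 20))),
   count 24 (band (atI 6) (eq (atI 20) (lit 2))),
   count 25 (band (atI 6) (lt (lit 2) (atI 20))),
   cnt 26 (lit 0) (band (atJ 6) (eq (atJ 20) (lit 1))),
   cnt 27 (lit 0) (band (atJ 6) (eq (atJ 20) (lit 2))),
   cnt 28 (lit 0) (band (atJ 6) must),
   cnt 29 (lit 0) (band (atJ 6) (bnot must)),
   -- Classes are counted through their centers, the vertices of R that carry their own code.
   count 30 (band (atI 7) (band (eq (atI 11) eI') (lt (lit 1) (atI 17)))),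
   count 31 (band (atI 7) (band (eq (atI 11) eI') (bnot (eq (atI 17) (lit 1))))),
   mark 32 (band (atI 13) (atI 15)),
   -- The inner comparison is 1 if the class of the current vertex is itself bad, so the outer one
   -- detects another bad class.
   count 33 (band (atI 32) (lt (lt (lit 1) (atI 17)) (sc 30))),
   -- Array 18 points, shifted by one, to the reference vertex that would be discarded; where it is
   -- 0 nothing is discarded and the entry is 0.
   map 35 (atI 18) (get 26 (sub (atI 18) (lit 1))),
   map 36 (atI 18) (get 27 (sub (atI 18) (lit 1))),
   map 37 (atI 18) (wt κ (sub (atI 18) (lit 1))),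
   mark 38 (band (band (atI 32) (bnot (lt (bnot (eq (atI 17) (lit 1))) (sc 31))))
     (band (band (bnot (lt (atI 28) (sc 23))) (eq (sub (atI 28) (sc 23)) (atI 35)))
       (band (bnot (atI 29)) (band (bnot (sc 25)) (eq (sc 24) (atI 36)))))),
   sum 39 (atI 19) (wt κ eI),
   map 40 (lit 1) (add (sub (sc 39) (atI 37)) (wt κ eI))]

/-- The best exchange. -/
def bestPasses (κ : ℕ) : List Pass :=
  [argmin 41 (atI 38) (atI 40) (get 40 (sub (reg 4) (lit 1))),
   -- Success: coherence holds, and either N_2 is empty or no candidate was rejected and a valid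
   -- exchange exists.
   const 42 (band (bnot (sc 34)) (bor (bnot (sc 14)) (band (bnot (sc 33)) (sc 41)))) (lit 1),
   const 43 (lit 1) (get 11 (sub (sc 41) (lit 1))),
   mark 3 (bor (eq eI' (sc 41)) (band (atI 19) (bnot (eq (atI 11) (sc 43))))),
   sum 44 (atI 3) (wt κ eI)]

def subPasses (κ : ℕ) : List Pass :=
  levelPasses κ ++ (refPasses ++ (testPasses κ ++ bestPasses κ))

end Program


end WED

/-! ### The tables for levels, classes and the reference set are correct -/

namespace WED

open _root_.WED.Expr Pass

/-- The vertices at distance two from `v`. -/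
def InN2 {n : ℕ} (G : SimpleGraph (Fin n)) (v x : Fin n) : Prop :=
  x ≠ v ∧ ¬ G.Adj x v ∧ ∃ j, G.Adj x j ∧ G.Adj j v

/-- The vertices at distance at least three from `v`. -/
def InR {n : ℕ} (G : SimpleGraph (Fin n)) (v x : Fin n) : Prop :=
  x ≠ v ∧ ¬ G.Adj x v ∧ ¬ ∃ j, G.Adj x j ∧ G.Adj j v

theorem not_inR_of_inN2 {n : ℕ} {G : SimpleGraph (Fin n)} {v x : Fin n} (h : InN2 G v x) :
    ¬ InR G v x := fun h' => h'.2.2 h.2.2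

/-- The vertices that may be chosen. -/
def InU {n : ℕ} (G : SimpleGraph (Fin n)) (v : Fin n) (κ : ℕ) (num : Fin n → ℕ)
    (i : Fin n) : Prop :=
  LocMax G (InR G v) i ∧ κ ≤ num i

theorem Coherent.isChoice_iff {n : ℕ} {G : SimpleGraph (Fin n)} {num : Fin n → ℕ} {v : Fin n}
    (hco : Coherent G (InR G v)) {κ : ℕ} {D : Finset (Fin n)} :
    (IsRestrictedED G (InN2 G v) (InR G v) D ∧ ∀ d ∈ D, κ ≤ num d) ↔
      IsChoice G (code G (InR G v)) (InR G v) (InN2 G v) (InU G v κ num) D := by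
  rw [hco.isRestrictedED_iff fun x => not_inR_of_inN2]
  constructor
  · rintro ⟨⟨h1, h2, h3⟩, h4⟩
    exact ⟨fun d hd => ⟨h1 d hd, h4 d hd⟩, h2, h3⟩
  · rintro ⟨h1, h2, h3⟩
    exact ⟨⟨fun d hd => (h1 d hd).1, h2, h3⟩, fun d hd => (h1 d hd).2⟩

section

variable {n : ℕ} {G : SimpleGraph (Fin n)} [DecidableRel G.Adj] {num : Fin n → ℕ} {s : Mem}

structure LevelSpec (G : SimpleGraph (Fin n)) (v : Fin n) (κ : ℕ) (num : Fin n → ℕ) (s : Mem) :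
    Prop where
  inN2 : ∀ i : Fin n, s.arr 6 i ≠ 0 ↔ InN2 G v i
  inR : ∀ i : Fin n, s.arr 7 i ≠ 0 ↔ InR G v i
  code : ∀ i : Fin n, s.arr 11 i = code G (InR G v) i
  coherent : s.arr 34 0 = 0 ↔ Coherent G (InR G v)
  inU : ∀ i : Fin n, s.arr 13 i ≠ 0 ↔ InU G v κ num i
  first : (s.arr 14 0 = 0 ∧ ∀ x, ¬ InN2 G v x) ∨ ∃ x, InN2 G v x ∧ s.arr 14 0 = x + 1

theorem levelSpec (H : HoldsGraph G num s) {v : Fin n} (hv : s.reg 1 = v) {κ : ℕ}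
    (h : ∀ P ∈ levelPasses κ, P.Holds s) : LevelSpec G v κ num s := by
  classical
  simp only [levelPasses, List.forall_mem_cons] at h
  obtain ⟨h4, h5, h6, h7, h8, h9, h10, h11, h12, h34, h13, h14, -⟩ := h
  have e4 : ∀ i : Fin n, s.arr 4 i ≠ 0 ↔ G.Adj i v := by
    intro i
    rw [cnt_eq H h4 (fun _ => False) (fun _ j => j = v) (by simp [eval])
      (fun i j p acc hj => by simp [eval, eJ, Mem.at, hj, hv, Fin.ext_iff])]
    simp only [if_false, zero_add, Finset.card_ne_zero]
    constructor
    · rintro ⟨j, hj⟩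
      simp only [Finset.mem_filter] at hj
      obtain ⟨-, h, rfl⟩ := hj
      exact h
    · exact fun h => ⟨v, by simp [h]⟩
  have e5 : ∀ i : Fin n, s.arr 5 i ≠ 0 ↔ ∃ j, G.Adj i j ∧ G.Adj j v := by
    intro i
    rw [cnt_eq H h5 (fun _ => False) (fun _ j => G.Adj j v) (by simp [eval])
      (fun i j p acc hj => by rw [← e4]; simp [eval, atJ, Mem.at, hj])]
    simp only [if_false, zero_add, Finset.card_ne_zero]
    exact ⟨fun ⟨j, hj⟩ => ⟨j, by simpa using hj⟩, fun ⟨j, hj⟩ => ⟨j, by simpa using hj⟩⟩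
  have e6 : ∀ i : Fin n, s.arr 6 i ≠ 0 ↔ InN2 G v i := by
    intro i
    rw [mark_iff H h6, InN2, ← e4, ← e5]
    simp [eval, atI, eI, Mem.at, hv, Fin.ext_iff]
  have e7 : ∀ i : Fin n, s.arr 7 i ≠ 0 ↔ InR G v i := by
    intro i
    rw [mark_iff H h7, InR, ← e4, ← e5]
    simp [eval, atI, eI, Mem.at, hv, Fin.ext_iff]
  have e8 : ∀ i : Fin n, s.arr 8 i = degIn G (InR G v) i := by
    intro i
    rw [cnt_eq H h8 (fun _ => False) (fun _ j => InR G v j) (by simp [eval])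
      (fun i j p acc hj => by rw [← e7]; simp [eval, atJ, Mem.at, hj])]
    simp only [if_false, zero_add, degIn]
    congr!
  have e9 : ∀ i : Fin n, s.arr 9 i = 0 ↔
      ∀ j, G.Adj i j → InR G v j → degIn G (InR G v) j ≤ degIn G (InR G v) i := by
    intro i
    rw [cnt_eq H h9 (fun _ => False)
      (fun i j => InR G v j ∧ degIn G (InR G v) i < degIn G (InR G v) j) (by simp [eval])
      (fun i j p acc hj => by rw [← e7, ← e8, ← e8]; simp [eval, atI, atJ, Mem.at, hj])]
    simp only [if_false, zero_add, Finset.card_eq_zero, Finset.filter_eq_empty_iff,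
      Finset.mem_univ, true_implies, not_and, not_lt]
  have e10 : ∀ i : Fin n, s.arr 10 i ≠ 0 ↔ LocMax G (InR G v) i := by
    intro i
    rw [mark_iff H h10, LocMax, ← e7, ← e9]
    simp [eval, atI, Mem.at]
  have e11 : ∀ i : Fin n, s.arr 11 i = code G (InR G v) i := by
    intro i
    rw [mx_closed H h11 (fun j => LocMax G (InR G v) j) (fun j => (j : ℕ) + 1)
      (fun i => by rw [← e10]; simp [eval, atI, Mem.at]) (fun i => by simp [eval, eI', Mem.at])
      (fun i j p acc hj => by rw [← e10]; simp [eval, atJ, Mem.at, hj])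
      (fun i j p acc hj => by simp [eval, eJ', Mem.at, hj])]
    unfold code
    congr!
  have e12 : ∀ i : Fin n, s.arr 12 i = 0 ↔ ¬ (InR G v i ∧ code G (InR G v) i = 0) ∧
      ∀ j, G.Adj i j → InR G v i → InR G v j → code G (InR G v) i = code G (InR G v) j := by
    intro i
    rw [cnt_eq H h12 (fun i => InR G v i ∧ code G (InR G v) i = 0)
      (fun i j => (InR G v i ∧ InR G v j) ∧ code G (InR G v) i ≠ code G (InR G v) j)
      (fun i => by rw [← e7, ← e11]; simp [eval, atI, Mem.at])
      (fun i j p acc hj => by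
        rw [← e7, ← e7, ← e11, ← e11]; simp [eval, atI, atJ, Mem.at, hj, and_assoc])]
    simp only [Nat.add_eq_zero_iff, Finset.card_eq_zero, Finset.filter_eq_empty_iff,
      Finset.mem_univ, true_implies]
    refine and_congr (by split_ifs with h <;> simp [h]) (forall_congr' fun j => ?_)
    tauto
  refine ⟨e6, e7, e11, ?_, ?_, ?_⟩
  · rw [count_eq H h34 (fun i => ¬ s.arr 12 i = 0) (fun i acc => by simp [eval, atI, Mem.at])]
    simp only [Finset.card_eq_zero, Finset.filter_eq_empty_iff, Finset.mem_univ, true_implies,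
      not_not, e12, Coherent]
    constructor
    · exact fun h => ⟨fun i hi hc => (h (x := i)).1 ⟨hi, hc⟩,
        fun i j hi hj hij => (h (x := i)).2 j hij hi hj⟩
    · exact fun h i => ⟨fun hi => h.1 i hi.1 hi.2, fun j hij hi hj => h.2 i j hi hj hij⟩
  · intro i
    rw [mark_iff H h13, InU, ← e10, ← H.number]
    simp [eval, atI, Mem.at]
  · rcases argmin_spec H h14 (InN2 G v) (fun _ => 0)
      (fun i acc => by rw [← e6]; simp [eval, atI, Mem.at]) (by simp [eval]) (by simp [eval])
      with h | ⟨x, h1, h2, -⟩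
    · exact .inl h
    · exact .inr ⟨x, h1, h2⟩

/-- The data of a class are gathered over closed neighbourhoods. They are asserted only at local
maxima, where coherence makes the closed neighbourhood within R the entire class. -/
structure RefSpec (G : SimpleGraph (Fin n)) (v : Fin n) (κ : ℕ) (num : Fin n → ℕ) (x₀ : Fin n)
    (s : Mem) : Prop where
  adj : ∀ i : Fin n, s.arr 15 i ≠ 0 ↔ G.Adj i x₀
  missCount : ∀ i, LocMax G (InR G v) i →
    s.arr 17 i = missCount G (code G (InR G v)) (InU G v κ num) x₀ (code G (InR G v) i)
  missCode : ∀ i, LocMax G (InR G v) i →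
    s.arr 18 i = missCode G (code G (InR G v)) (InU G v κ num) x₀ (code G (InR G v) i)
  ref : ∀ i : Fin n, s.arr 19 i ≠ 0 ↔ Ref G (code G (InR G v)) (InU G v κ num) x₀ i
  hits : ∀ i : Fin n, s.arr 20 i = hits G (code G (InR G v)) (InU G v κ num) x₀ i
  hitClass : ∀ i : Fin n, s.arr 21 i = hitClass G (code G (InR G v)) (InU G v κ num) x₀ i

theorem refSpec (H : HoldsGraph G num s) {v : Fin n} {κ : ℕ} (L : LevelSpec G v κ num s)
    (hco : Coherent G (InR G v)) {x₀ : Fin n} (hx₀ : s.arr 14 0 = x₀ + 1)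
    (h : ∀ P ∈ refPasses, P.Holds s) : RefSpec G v κ num x₀ s := by
  classical
  simp only [refPasses, List.forall_mem_cons] at h
  obtain ⟨h15, h16, h17, h18, h19, h20, h21, -⟩ := h
  have e15 : ∀ i : Fin n, s.arr 15 i ≠ 0 ↔ G.Adj i x₀ := by
    intro i
    rw [cnt_eq H h15 (fun _ => False) (fun _ j => j = x₀) (by simp [eval])
      (fun i j p acc hj => by simp [eval, eJ', sc, Mem.at, hj, hx₀, Fin.ext_iff])]
    simp only [if_false, zero_add, Finset.card_ne_zero]
    constructor
    · rintro ⟨j, hj⟩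
      simp only [Finset.mem_filter] at hj
      obtain ⟨-, h, rfl⟩ := hj
      exact h
    · exact fun h => ⟨x₀, by simp [h]⟩
  have e16 : ∀ i : Fin n, s.arr 16 i ≠ 0 ↔ Missed G (InU G v κ num) x₀ i := by
    intro i
    rw [mark_iff H h16, Missed, ← e15, ← L.inU]
    simp [eval, atI, Mem.at]
  have hset : ∀ i, LocMax G (InR G v) i →
      (Finset.univ.filter fun j => (j = i ∨ G.Adj i j) ∧ Missed G (InU G v κ num) x₀ j) =
      Finset.univ.filter fun j => Missed G (InU G v κ num) x₀ j ∧
        code G (InR G v) j = code G (InR G v) i := by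
    intro i hi
    ext j
    simp only [Finset.mem_filter, Finset.mem_univ, true_and]
    constructor
    · rintro ⟨h1, h2⟩
      exact ⟨h2, (hco.code_eq_iff hi h2.1.1.1).2 h1⟩
    · rintro ⟨h2, h1⟩
      exact ⟨(hco.code_eq_iff hi h2.1.1.1).1 h1, h2⟩
  have e17 : ∀ i, LocMax G (InR G v) i →
      s.arr 17 i = missCount G (code G (InR G v)) (InU G v κ num) x₀ (code G (InR G v) i) := by
    intro i hi
    rw [cnt_closed H h17 (fun j => Missed G (InU G v κ num) x₀ j)
      (fun i => by rw [← e16]; simp [eval, atI, Mem.at])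
      (fun i j p acc hj => by rw [← e16]; simp [eval, atJ, Mem.at, hj]), hset i hi]
    unfold missCount
    congr!
  have e18' : ∀ i : Fin n, s.arr 18 i =
      (Finset.univ.filter fun j => (j = i ∨ G.Adj i j) ∧ Missed G (InU G v κ num) x₀ j).sup
        fun j => (j : ℕ) + 1 := by
    intro i
    rw [mx_closed H h18 (fun j => Missed G (InU G v κ num) x₀ j) (fun j => (j : ℕ) + 1)
      (fun i => by rw [← e16]; simp [eval, atI, Mem.at]) (fun i => by simp [eval, eI', Mem.at])
      (fun i j p acc hj => by rw [← e16]; simp [eval, atJ, Mem.at, hj])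
      (fun i j p acc hj => by simp [eval, eJ', Mem.at, hj])]
  have e18 : ∀ i, LocMax G (InR G v) i →
      s.arr 18 i = missCode G (code G (InR G v)) (InU G v κ num) x₀ (code G (InR G v) i) := by
    intro i hi
    rw [e18', hset i hi]
    unfold missCode
    congr!
  have e19 : ∀ i : Fin n,
      s.arr 19 i ≠ 0 ↔ Ref G (code G (InR G v)) (InU G v κ num) x₀ i := by
    intro i
    rw [mark_iff H h19]
    have h1 : (band (atI 16) (eq (atI 18) eI')).eval (s.at i 0 0) ≠ 0 ↔
        Missed G (InU G v κ num) x₀ i ∧ s.arr 18 i = i + 1 := by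
      rw [← e16]
      simp [eval, atI, eI', Mem.at]
    rw [h1, Ref]
    exact and_congr_right fun h => by rw [e18 i h.1.1]
  refine ⟨e15, e17, e18, e19, ?_, ?_⟩
  · intro i
    rw [cnt_eq H h20 (fun _ => False)
      (fun _ j => Ref G (code G (InR G v)) (InU G v κ num) x₀ j) (by simp [eval])
      (fun i j p acc hj => by rw [← e19]; simp [eval, atJ, Mem.at, hj])]
    simp only [if_false, zero_add, WED.hits]
    congr!
  · intro i
    rw [mx_eq H h21 (fun _ => False)
      (fun j => Ref G (code G (InR G v)) (InU G v κ num) x₀ j) (code G (InR G v)) (by simp [eval])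
      (fun i j p acc hj => by rw [← e19]; simp [eval, atJ, Mem.at, hj])
      (fun i j p acc hj => by rw [← L.code]; simp [eval, atJ, Mem.at, hj])]
    simp only [if_false, zero_le, sup_of_le_right, WED.hitClass]
    congr!

end

/-- Counting the classes with a property, by their centers. -/
theorem Coherent.card_centers_le_iff {n : ℕ} {G : SimpleGraph (Fin n)} {R : Fin n → Prop}
    (H : Coherent G R) (p : ℕ → Prop) [DecidablePred p] [DecidablePred R] {u : Fin n} (hu : R u) :
    (Finset.univ.filter fun i : Fin n => R i ∧ code G R i = i + 1 ∧ p (code G R i)).card ≤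
      (if p (code G R u) then 1 else 0) ↔ ∀ r, R r → code G R r ≠ code G R u →
          ¬ p (code G R r) := by
  obtain ⟨c, -, hc, hcu, hcc⟩ := H.code_center hu
  constructor
  · intro h r hr hru hp
    obtain ⟨d, -, hd, hdr, hdd⟩ := H.code_center hr
    have hcd : c ≠ d := by
      rintro rfl
      exact hru (hdr.trans hcu.symm)
    have hmem : d ∈ Finset.univ.filter
        fun i : Fin n => R i ∧ code G R i = i + 1 ∧ p (code G R i) := by
      simp only [Finset.mem_filter, Finset.mem_univ, true_and]
      exact ⟨hd.1, hdd, by rwa [hdd, ← hdr]⟩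
    split_ifs at h with h'
    · refine hcd (Finset.card_le_one.1 h c ?_ d hmem)
      simp only [Finset.mem_filter, Finset.mem_univ, true_and]
      exact ⟨hc.1, hcc, by rwa [hcc, ← hcu]⟩
    · rw [Nat.le_zero, Finset.card_eq_zero] at h
      exact Finset.notMem_empty d (h ▸ hmem)
  · intro h
    have hsub : (Finset.univ.filter fun i : Fin n => R i ∧ code G R i = i + 1 ∧ p (code G R i)) ⊆
        if p (code G R u) then {c} else ∅ := by
      intro i hi
      simp only [Finset.mem_filter, Finset.mem_univ, true_and] at hi
      have hiu : code G R i = code G R u := by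
        by_contra h'
        exact h i hi.1 h' hi.2.2
      have hic : i = c := Fin.ext (by have := hi.2.1; omega)
      rw [if_pos (hiu ▸ hi.2.2), hic]
      simp
    refine (Finset.card_le_card hsub).trans ?_
    split_ifs <;> simp

end WED

/-! ### The exchange test, and correctness of the algorithm for G_v -/

namespace WED

open _root_.WED.Expr Pass

section

variable {n : ℕ} {G : SimpleGraph (Fin n)} [DecidableRel G.Adj] {num : Fin n → ℕ} {s : Mem}

/-- The exchange at `u` chooses one vertex in each class, as far as the reference set does. -/
def OthersOnce (G : SimpleGraph (Fin n)) (v : Fin n) (κ : ℕ) (num : Fin n → ℕ) (x₀ u : Fin n) :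
    Prop :=
  ∀ r, InR G v r → code G (InR G v) r ≠ code G (InR G v) u →
    missCount G (code G (InR G v)) (InU G v κ num) x₀ (code G (InR G v) r) = 1

structure TestSpec (G : SimpleGraph (Fin n)) (v : Fin n) (κ : ℕ) (num : Fin n → ℕ) (x₀ : Fin n)
    (s : Mem) : Prop where
  reject : s.arr 33 0 = 0 ↔ ∀ u, InU G v κ num u → G.Adj u x₀ →
    ∀ r, InR G v r → code G (InR G v) r ≠ code G (InR G v) u →
      missCount G (code G (InR G v)) (InU G v κ num) x₀ (code G (InR G v) r) ≤ 1
  valid : ∀ u : Fin n, s.arr 38 u ≠ 0 ↔ (InU G v κ num u ∧ G.Adj u x₀) ∧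
    OthersOnce G v κ num x₀ u ∧ ∀ x, InN2 G v x →
      ∃! d, d ∈ exchange G (code G (InR G v)) (InU G v κ num) x₀ u ∧ G.Adj d x
  weight : ∀ u, InU G v κ num u → s.arr 40 u =
    ∑ i ∈ exchange G (code G (InR G v)) (InU G v κ num) x₀ u, (num i - κ)

theorem testSpec (H : HoldsGraph G num s) {v : Fin n} {κ : ℕ} (L : LevelSpec G v κ num s)
    (hco : Coherent G (InR G v)) {x₀ : Fin n} (S : RefSpec G v κ num x₀ s)
    (h : ∀ P ∈ testPasses κ, P.Holds s) : TestSpec G v κ num x₀ s := by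
  classical
  simp only [testPasses, List.forall_mem_cons] at h
  obtain ⟨h23, h24, h25, h26, h27, h28, h29, h30, h31, h32, h33, h35, h36, h37, h38, h39, h40,
    -⟩ := h
  have e23 : s.arr 23 0 =
      (Finset.univ.filter fun x => InN2 G v x ∧ hits G (code G (InR G v))
          (InU G v κ num) x₀ x = 0).card :=
    count_eq H h23 _ fun i acc => by rw [← L.inN2, ← S.hits]; simp [eval, atI, Mem.at]
  have e24 : s.arr 24 0 =
      (Finset.univ.filter fun x => InN2 G v x ∧ hits G (code G (InR G v))
          (InU G v κ num) x₀ x = 2).card :=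
    count_eq H h24 _ fun i acc => by rw [← L.inN2, ← S.hits]; simp [eval, atI, Mem.at]
  have e25 : s.arr 25 0 =
      (Finset.univ.filter fun x => InN2 G v x ∧ 2 < hits G (code G (InR G v))
          (InU G v κ num) x₀ x).card :=
    count_eq H h25 _ fun i acc => by rw [← L.inN2, ← S.hits]; simp [eval, atI, Mem.at]
  have e26 : ∀ i : Fin n, s.arr 26 i = hitDegree G (code G (InR G v)) (InU G v κ num) x₀
      (InN2 G v) 1 i := by
    intro i
    rw [cnt_eq H h26 (fun _ => False) (fun _ x => InN2 G v x ∧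
        hits G (code G (InR G v)) (InU G v κ num) x₀ x = 1)
      (by simp [eval])
      (fun i j p acc hj => by rw [← L.inN2, ← S.hits]; simp [eval, atJ, Mem.at, hj])]
    simp only [if_false, zero_add, hitDegree]
    congr!
  have e27 : ∀ i : Fin n, s.arr 27 i = hitDegree G (code G (InR G v)) (InU G v κ num) x₀
      (InN2 G v) 2 i := by
    intro i
    rw [cnt_eq H h27 (fun _ => False) (fun _ x => InN2 G v x ∧
        hits G (code G (InR G v)) (InU G v κ num) x₀ x = 2)
      (by simp [eval])
      (fun i j p acc hj => by rw [← L.inN2, ← S.hits]; simp [eval, atJ, Mem.at, hj])]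
    simp only [if_false, zero_add, hitDegree]
    congr!
  have hmust : ∀ (i j : Fin n) (p acc : ℕ), s.arr 1 p = j →
      (must.eval (s.at i p acc) ≠ 0 ↔ MustHit G (code G (InR G v)) (InU G v κ num) x₀ i j) := by
    intro i j p acc hj
    rw [MustHit, ← S.hits, ← S.hitClass, ← L.code]
    simp only [must, eval_bor]
    simp [eval, atJ, atI, Mem.at, hj]
    tauto
  have e28 : ∀ i : Fin n, s.arr 28 i =
      (Finset.univ.filter fun x => G.Adj i x ∧ InN2 G v x ∧
          MustHit G (code G (InR G v)) (InU G v κ num) x₀ i x).card := by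
    intro i
    rw [cnt_eq H h28 (fun _ => False) (fun i x => InN2 G v x ∧
        MustHit G (code G (InR G v)) (InU G v κ num) x₀ i x)
      (by simp [eval])
      (fun i j p acc hj => by
        rw [← L.inN2, ← hmust i j p acc hj]; simp [eval, atJ, Mem.at, hj])]
    simp only [if_false, zero_add]
  have e29 : ∀ i : Fin n, s.arr 29 i =
      (Finset.univ.filter fun x => G.Adj i x ∧ InN2 G v x ∧
          ¬ MustHit G (code G (InR G v)) (InU G v κ num) x₀ i x).card := by
    intro i
    rw [cnt_eq H h29 (fun _ => False) (fun i x => InN2 G v x ∧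
        ¬ MustHit G (code G (InR G v)) (InU G v κ num) x₀ i x)
      (by simp [eval])
      (fun i j p acc hj => by
        rw [← L.inN2, ← hmust i j p acc hj]; simp [eval, atJ, Mem.at, hj])]
    simp only [if_false, zero_add]
  -- a center is a local maximum
  have hcen : ∀ i : Fin n, code G (InR G v) i = i + 1 → LocMax G (InR G v) i := by
    intro i hi
    obtain ⟨c, -, hc, hci⟩ := exists_of_code_ne_zero (G := G) (R := InR G v) (i := i)
        (by rw [hi]; omega)
    have : c = i := Fin.ext (by omega)
    exact this ▸ hc
  have e30 : s.arr 30 0 = (Finset.univ.filter fun i : Fin n => InR G v i ∧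
      code G (InR G v) i = i + 1 ∧
      1 < missCount G (code G (InR G v)) (InU G v κ num) x₀ (code G (InR G v) i)).card := by
    refine count_eq H h30 _ fun i acc => ?_
    have : (InR G v i ∧ code G (InR G v) i = i + 1 ∧ 1 < missCount G (code G (InR G v))
        (InU G v κ num) x₀ (code G (InR G v) i)) ↔
        InR G v i ∧ code G (InR G v) i = i + 1 ∧ 1 < s.arr 17 i :=
      and_congr_right fun _ => and_congr_right fun hi => by rw [S.missCount i (hcen i hi)]
    rw [this, ← L.inR, ← L.code]
    simp [eval, atI, eI', Mem.at]
  have e31 : s.arr 31 0 = (Finset.univ.filter fun i : Fin n => InR G v i ∧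
      code G (InR G v) i = i + 1 ∧
      missCount G (code G (InR G v)) (InU G v κ num) x₀ (code G (InR G v) i) ≠ 1).card := by
    refine count_eq H h31 _ fun i acc => ?_
    have : (InR G v i ∧ code G (InR G v) i = i + 1 ∧ missCount G (code G (InR G v))
        (InU G v κ num) x₀ (code G (InR G v) i) ≠ 1) ↔
        InR G v i ∧ code G (InR G v) i = i + 1 ∧ s.arr 17 i ≠ 1 :=
      and_congr_right fun _ => and_congr_right fun hi => by rw [S.missCount i (hcen i hi)]
    rw [this, ← L.inR, ← L.code]
    simp [eval, atI, eI', Mem.at]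
  have e32 : ∀ u : Fin n, s.arr 32 u ≠ 0 ↔ InU G v κ num u ∧ G.Adj u x₀ := by
    intro u
    rw [mark_iff H h32, ← L.inU, ← S.adj]
    simp [eval, atI, Mem.at]
  have hrej : ∀ u, InU G v κ num u → (s.arr 30 0 ≤ (if 1 < s.arr 17 u then 1 else 0) ↔
      ∀ r, InR G v r → code G (InR G v) r ≠ code G (InR G v) u →
          missCount G (code G (InR G v)) (InU G v κ num) x₀ (code G (InR G v) r) ≤ 1) := by
    intro u hu
    rw [S.missCount u hu.1, e30]
    have := hco.card_centers_le_iff (fun k => 1 < missCount G (code G (InR G v))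
        (InU G v κ num) x₀ k) hu.1.1
    simpa only [not_lt] using this
  have honce : ∀ u, InU G v κ num u → (s.arr 31 0 ≤ (if s.arr 17 u ≠ 1 then 1 else 0) ↔
      OthersOnce G v κ num x₀ u) := by
    intro u hu
    rw [S.missCount u hu.1, e31]
    have := hco.card_centers_le_iff (fun k => missCount G (code G (InR G v))
        (InU G v κ num) x₀ k ≠ 1) hu.1.1
    simpa only [not_not, OthersOnce] using this
  -- At a candidate `u`, array 18 is a pointer to the vertex that `u` replaces, or 0.
  have hw : ∀ u : Fin n, (∀ d, Ref G (code G (InR G v)) (InU G v κ num) x₀ d →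
      code G (InR G v) d = code G (InR G v) u → InU G v κ num u → s.arr 18 u = d + 1) ∧
      (InU G v κ num u → (¬ ∃ d, Ref G (code G (InR G v)) (InU G v κ num) x₀ d ∧
          code G (InR G v) d = code G (InR G v) u) → s.arr 18 u = 0) := by
    intro u
    refine ⟨fun d hd hdu hu => ?_, fun hu hne => ?_⟩
    · rw [S.missCode u hu.1, ← hdu]
      exact hd.missCode_eq
    · rw [S.missCode u hu.1]
      by_contra h
      exact hne (missCode_ne_zero.1 h)
  have e35 := fun u : Fin n => map_eq H h35 u
  have e36 := fun u : Fin n => map_eq H h36 u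
  have e37 := fun u : Fin n => map_eq H h37 u
  simp only [eval, atI, Mem.at, wt] at e35 e36 e37
  simp at e35 e36 e37
  refine ⟨?_, ?_, ?_⟩
  · rw [count_eq H h33 (fun u => (InU G v κ num u ∧ G.Adj u x₀) ∧
        (if 1 < s.arr 17 u then 1 else 0) < s.arr 30 0)
      (fun i acc => by rw [← e32]; simp [eval, atI, sc, Mem.at])]
    simp only [Finset.card_eq_zero, Finset.filter_eq_empty_iff, Finset.mem_univ, true_implies]
    constructor
    · intro h u hu hux
      exact (hrej u hu).1 (not_lt.1 fun h' => h (x := u) ⟨⟨hu, hux⟩, h'⟩)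
    · rintro h u ⟨⟨hu, hux⟩, h'⟩
      exact absurd ((hrej u hu).2 (h u hu hux)) (not_le.2 h')
  · intro u
    have h1 : s.arr 38 u ≠ 0 ↔ ((s.arr 32 u ≠ 0) ∧
        s.arr 31 0 ≤ (if s.arr 17 u ≠ 1 then 1 else 0)) ∧
        s.arr 28 u = s.arr 23 0 + s.arr 35 u ∧ s.arr 29 u = 0 ∧ s.arr 25 0 = 0 ∧
          s.arr 24 0 = s.arr 36 u := by
      rw [mark_iff H h38]
      -- The program subtracts, since adding two table entries would not be tame; the comparison
      -- rules out truncation.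
      have h2 : s.arr 28 u = s.arr 23 0 + s.arr 35 u ↔
        (¬ s.arr 28 u < s.arr 23 0) ∧ s.arr 28 u - s.arr 23 0 = s.arr 35 u := by omega
      rw [h2, ← not_lt]
      simp only [eval_band, eval_bnot]
      simp [eval, atI, sc, Mem.at]
      tauto
    rw [h1, e32, and_assoc]
    refine and_congr_right fun hu => and_congr (honce u hu.1) ?_
    rw [← hitTest_iff (c₁ := s.arr 35 u) (c₂ := s.arr 36 u) hu.2, HitTest, e23, e24, e25,
      e28, e29]
    · congr!
    · intro d hd hdu
      rw [e35, e36, (hw u).1 d hd hdu hu.1]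
      simp [e26, e27]
    · intro hne
      rw [e35, e36, (hw u).2 hu.1 hne]
      simp
  · intro u hu
    rw [map_eq H h40, sum_exchange (fun i => num i - κ) (a := s.arr 37 u)]
    · have h1 := sum_eq H h39 (fun i => Ref G (code G (InR G v)) (InU G v κ num) x₀ i)
        (fun i => num i - κ)
        (fun i acc => by rw [← S.ref]; simp [eval, atI, Mem.at])
        (fun i acc => by rw [← H.number]; simp [eval, wt, eI, Mem.at])
      rw [← h1, ← H.number]
      simp [eval, sc, atI, wt, eI, Mem.at]
    · intro d hd hdu
      rw [e37, (hw u).1 d hd hdu hu]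
      simp [H.number]
    · intro hne
      rw [e37, (hw u).2 hu hne]
      simp

/-- What the algorithm for `G_v` has computed. -/
structure SubSpec (G : SimpleGraph (Fin n)) (v : Fin n) (κ : ℕ) (num : Fin n → ℕ) (s : Mem) :
    Prop where
  found : s.arr 42 0 ≠ 0 → ∃ D : Finset (Fin n), IsRestrictedED G (InN2 G v) (InR G v) D ∧
    (∀ d ∈ D, κ ≤ num d) ∧ (∀ i : Fin n, s.arr 3 i ≠ 0 ↔ i ∈ D) ∧
    s.arr 44 0 = ∑ i ∈ D, (num i - κ) ∧
    ∀ D', IsRestrictedED G (InN2 G v) (InR G v) D' → (∀ d ∈ D', κ ≤ num d) →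
      ∑ i ∈ D, (num i - κ) ≤ ∑ i ∈ D', (num i - κ)
  notFound : s.arr 42 0 = 0 → NoPathIn G (InR G v) → EdgesMet G (InN2 G v) (InR G v) →
    ¬ ∃ D, IsRestrictedED G (InN2 G v) (InR G v) D ∧ ∀ d ∈ D, κ ≤ num d

/-- A positive answer rests on the tests alone. For a negative one, `NoPathIn` excludes a failure of
coherence and `EdgesMet` excludes a rejected candidate, given that a solution exists. -/
theorem subSpec (H : HoldsGraph G num s) {v : Fin n} (hv : s.reg 1 = v) {κ : ℕ}
    (hNR : (∀ x, ¬ InN2 G v x) → ∀ x, ¬ InR G v x)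
    (h : ∀ P ∈ subPasses κ, P.Holds s) : SubSpec G v κ num s := by
  classical
  simp only [subPasses, List.forall_mem_append] at h
  obtain ⟨hl, hr, ht, hb⟩ := h
  have L := levelSpec H hv hl
  simp only [bestPasses, List.forall_mem_cons] at hb
  obtain ⟨h41, h42, h43, h3, h44, -⟩ := hb
  have e42 : s.arr 42 0 ≠ 0 ↔ s.arr 34 0 = 0 ∧ (s.arr 14 0 = 0 ∨ s.arr 33 0 = 0 ∧
      s.arr 41 0 ≠ 0) := by
    rw [const_eq h42]
    simp only [eval_band, eval_bnot, eval_bor]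
    simp [eval, sc, Mem.at]
    tauto
  have e44 : ∀ D : Finset (Fin n), (∀ i : Fin n, s.arr 3 i ≠ 0 ↔ i ∈ D) →
      s.arr 44 0 = ∑ i ∈ D, (num i - κ) := by
    intro D hD
    rw [sum_eq H h44 (fun i => i ∈ D) (fun i => num i - κ)
      (fun i acc => by rw [← hD]; simp [eval, atI, Mem.at])
      (fun i acc => by rw [← H.number]; simp [eval, wt, eI, Mem.at])]
    simp
  have e43 : ∀ u : Fin n, s.arr 41 0 = u + 1 → s.arr 43 0 = code G (InR G v) u := by
    intro u hu
    rw [const_eq h43, ← L.code]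
    simp [eval, sc, Mem.at, hu]
  have e3 : ∀ i : Fin n, s.arr 3 i ≠ 0 ↔
      i + 1 = s.arr 41 0 ∨ s.arr 19 i ≠ 0 ∧ s.arr 11 i ≠ s.arr 43 0 := by
    intro i
    rw [mark_iff H h3]
    simp only [eval_band, eval_bnot, eval_bor]
    simp [eval, sc, atI, eI', Mem.at]
    tauto
  by_cases hco : Coherent G (InR G v)
  swap
  · refine ⟨fun h => absurd (L.coherent.1 (e42.1 h).1) hco, fun _ hP _ ⟨D, hD, _⟩ => ?_⟩
    exact hco (coherent_of_isRestrictedED hP hD)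
  rcases L.first with ⟨h14, hN⟩ | ⟨x₀, hx₀, h14⟩
  · have hR := hNR hN
    have hU : ∀ i : Fin n, ¬ InU G v κ num i := fun i hi => hR i hi.1.1
    have hD : IsRestrictedED G (InN2 G v) (InR G v) ∅ :=
      ⟨by simp, fun x hx => absurd hx (by simp [hN, hR])⟩
    refine ⟨fun _ => ⟨∅, hD, by simp, ?_⟩, fun h => ?_⟩
    -- There is no x₀ here, so the tables built from it have lost their meaning. But there are no
    -- candidates either, so arrays 19 and 38 vanish on the vertices, array 41 reports no exchange,
    -- and array 3 spells the empty set.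
    · simp only [refPasses, List.forall_mem_cons] at hr
      simp only [testPasses, List.forall_mem_cons] at ht
      obtain ⟨-, h16, -, -, h19, -⟩ := hr
      obtain ⟨-, -, -, -, -, -, -, -, -, h32, -, -, -, -, h38, -⟩ := ht
      have e13 : ∀ i : Fin n, s.arr 13 i = 0 := fun i => by
        by_contra h
        exact hU i ((L.inU i).1 h)
      have e16 : ∀ i : Fin n, s.arr 16 i = 0 := fun i => by
        by_contra h
        rw [← ne_eq, mark_iff H h16] at h
        simp [eval, atI, Mem.at, e13] at h
      have e19 : ∀ i : Fin n, s.arr 19 i = 0 := fun i => by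
        by_contra h
        rw [← ne_eq, mark_iff H h19] at h
        simp [eval, atI, Mem.at, e16] at h
      have e32 : ∀ i : Fin n, s.arr 32 i = 0 := fun i => by
        by_contra h
        rw [← ne_eq, mark_iff H h32] at h
        simp [eval, atI, Mem.at, e13] at h
      have e38 : ∀ i : Fin n, s.arr 38 i = 0 := fun i => by
        by_contra h
        rw [← ne_eq, mark_iff H h38] at h
        simp only [eval_band] at h
        simp [eval, atI, Mem.at, e32] at h
      have e41 : s.arr 41 0 = 0 := by
        rcases argmin_spec H h41 (fun u => s.arr 38 u ≠ 0) (fun u => s.arr 40 u)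
          (fun i acc => by simp [eval, atI, Mem.at]) (fun i acc => by simp [eval, atI, Mem.at])
          (fun i j => by simp [eval, Mem.at]) with h | ⟨i, hi, -⟩
        · exact h.1
        · exact absurd (e38 i) hi
      have hmem : ∀ i : Fin n, s.arr 3 i ≠ 0 ↔ i ∈ (∅ : Finset (Fin n)) := fun i => by
        rw [e3]
        simp [e41, e19]
      exact ⟨hmem, e44 _ hmem, by simp⟩
    · exact absurd h (e42.2 ⟨L.coherent.2 hco, .inl h14⟩)
  · have S := refSpec H L hco h14 hr
    have T := testSpec H L hco S ht
    have hUR : ∀ u, InU G v κ num u → InR G v u := fun u hu => hu.1.1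
    -- If no candidate is rejected, every solution is the exchange at a valid `u`; hence the best
    -- valid exchange is optimal.
    have hsol : ∀ D', IsRestrictedED G (InN2 G v) (InR G v) D' → (∀ d ∈ D', κ ≤ num d) →
        s.arr 33 0 = 0 → ∃ u : Fin n, s.arr 38 u ≠ 0 ∧
          D' = exchange G (code G (InR G v)) (InU G v κ num) x₀ u := by
      intro D' h1 h2 h33
      have hch := hco.isChoice_iff.1 ⟨h1, h2⟩
      obtain ⟨u, hu, hux, hrest⟩ := hch.eq_exchange hUR hx₀
      obtain ⟨h3, h4⟩ := hrest (T.reject.1 h33 u hu hux)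
      exact ⟨u, (T.valid u).2 ⟨⟨hu, hux⟩, h3, h4 ▸ hch.hit⟩, h4⟩
    have hbest := argmin_spec H h41 (fun u => s.arr 38 u ≠ 0) (fun u => s.arr 40 u)
      (fun i acc => by simp [eval, atI, Mem.at]) (fun i acc => by simp [eval, atI, Mem.at])
      (fun i j => by simp [eval, Mem.at])
    constructor
    · intro h
      obtain ⟨-, h⟩ := e42.1 h
      obtain ⟨h33, hne⟩ := h.resolve_left (by omega)
      obtain ⟨u, hu, h41u, hmin⟩ := hbest.resolve_left fun h => hne h.1
      obtain ⟨⟨hU, hux⟩, hoth, hhit⟩ := (T.valid u).1 hu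
      have hch := exchange_isChoice hU hoth hhit
      have hmem : ∀ i : Fin n, s.arr 3 i ≠ 0 ↔
          i ∈ exchange G (code G (InR G v)) (InU G v κ num) x₀ u := by
        intro i
        rw [e3, mem_exchange, S.ref, e43 u h41u, L.code, h41u, Fin.ext_iff]
        simp
      obtain ⟨h1, h2⟩ := hco.isChoice_iff.2 hch
      refine ⟨_, h1, h2, hmem, e44 _ hmem, fun D' h1' h2' => ?_⟩
      obtain ⟨u', hu', rfl⟩ := hsol D' h1' h2' h33
      rw [← T.weight u hU, ← T.weight u' ((T.valid u').1 hu').1.1]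
      exact hmin u' hu'
    · rintro h42 hP hE ⟨D, hD, hfin⟩
      have h34 := L.coherent.2 hco
      -- Two missed candidates of one class are adjacent, both being universal in it, and `u`, from
      -- another class, sees neither. Their edge contradicts `EdgesMet`.
      have h33 : s.arr 33 0 = 0 := by
        rw [T.reject]
        intro u hu hux r hr hru
        by_contra hcon
        obtain ⟨a, ha, b, hb, hab⟩ := Finset.one_lt_card.1 (not_le.1 hcon)
        simp only [Finset.mem_filter, Finset.mem_univ, true_and] at ha hb
        have hua : ∀ a, Missed G (InU G v κ num) x₀ a →
            code G (InR G v) a = code G (InR G v) r → u ≠ a ∧ ¬ G.Adj u a := by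
          intro a ha har
          have := (hco.code_eq_iff hu.1 (hUR a ha.1)).not.1 (by rw [har]; exact hru)
          push Not at this
          exact ⟨this.1.symm, this.2⟩
        have hadj : G.Adj a b := by
          have := (hco.code_eq_iff ha.1.1.1 (hUR b hb.1.1)).1 (hb.2.trans ha.2.symm)
          exact this.resolve_left hab.symm
        exact hE x₀ u a b hx₀ (hUR u hu) (hUR a ha.1.1) (hUR b hb.1.1) hux.symm hadj
          (fun h => ha.1.2 h.symm) (fun h => hb.1.2 h.symm) (hua a ha.1 ha.2).1 (hua b hb.1 hb.2).1
          (hua a ha.1 ha.2).2 (hua b hb.1 hb.2).2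
      obtain ⟨u, hu, -⟩ := hsol D hD hfin h33
      rcases hbest with ⟨-, hn⟩ | ⟨i, -, hi, -⟩
      · exact hn u hu
      · exact e42.2 ⟨h34, .inr ⟨h33, by omega⟩⟩ h42

end

end WED

namespace WED

/-! ## Distance levels, freeness, and efficient domination of `G` and `G_v` -/

section

variable {n : ℕ} {G : SimpleGraph (Fin n)}

theorem mem_level_one {v x : Fin n} : x ∈ level G v 1 ↔ G.Adj x v := by
  rw [level, Set.mem_ofPred_eq, Nat.cast_one, SimpleGraph.edist_eq_one_iff_adj, G.adj_comm]

theorem mem_level_two {v x : Fin n} : x ∈ level G v 2 ↔ InN2 G v x := by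
  rw [level, Set.mem_ofPred_eq, InN2]
  constructor
  · intro h
    have hne : x ≠ v := by
      rintro rfl
      simp at h
    have hadj : ¬ G.Adj x v := by
      intro h'
      rw [SimpleGraph.edist_eq_one_iff_adj.2 h'.symm] at h
      exact absurd h (by decide)
    refine ⟨hne, hadj, ?_⟩
    obtain ⟨p, hp⟩ := SimpleGraph.exists_walk_of_edist_ne_top (G := G) (u := v) (v := x)
      (by rw [h]; decide)
    rw [h] at hp
    have hp2 : p.length = 2 := by exact_mod_cast hp
    cases p with
    | nil => simp at hp2
    | cons h1 q =>
      cases q with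
      | nil => simp at hp2
      | cons h2 q =>
        cases q with
        | nil => exact ⟨_, h2.symm, h1.symm⟩
        | cons h3 q => simp at hp2
  · rintro ⟨hne, hadj, j, hxj, hjv⟩
    apply le_antisymm
    · exact SimpleGraph.edist_le (.cons hjv.symm (.cons hxj.symm .nil))
    · have h0 : G.edist v x ≠ 0 := by rw [Ne, SimpleGraph.edist_eq_zero_iff]; exact hne.symm
      have h1 : G.edist v x ≠ 1 := by
        rw [Ne, SimpleGraph.edist_eq_one_iff_adj]; exact fun h => hadj h.symm
      generalize G.edist v x = d at h0 h1
      induction d using ENat.recTopCoe with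
      | top => exact le_top
      | coe d =>
        norm_cast at h0 h1 ⊢
        omega

theorem mem_farSet {v x : Fin n} : x ∈ farSet G v ↔ InR G v x := by
  have h : x ∈ farSet G v ↔ ¬ ((x = v ∨ x ∈ level G v 1) ∨ x ∈ level G v 2) := by
    simp [farSet]
  rw [h, mem_level_one, mem_level_two, InN2, InR]
  by_cases h1 : x = v <;> by_cases h2 : G.Adj x v <;> simp [h1, h2]

theorem mem_subVerts {v x : Fin n} : x ∈ subVerts G v ↔ InN2 G v x ∨ InR G v x := by
  rw [subVerts, Set.mem_union, mem_level_two, mem_farSet]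

/-- Follow a walk to `v` backwards from its end: the first vertex outside N[v] would lie in N_2. -/
theorem not_inR_of_not_inN2 (hG : G.Connected) {v : Fin n} (h : ∀ x, ¬ InN2 G v x) (x : Fin n) :
    ¬ InR G v x := by
  have key : ∀ {x y : Fin n}, G.Walk x y → y = v → x = v ∨ G.Adj x v := by
    intro x y p
    induction p with
    | nil => exact .inl
    | @cons a b c hab p ih =>
      intro hc
      by_contra hcon
      push Not at hcon
      rcases ih hc with rfl | hb
      · exact hcon.2 hab
      · exact h a ⟨hcon.1, hcon.2, b, hab, hb⟩
  obtain ⟨p⟩ := hG.preconnected x v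
  rintro ⟨h1, h2, -⟩
  exact (key p rfl).elim h1 h2

/-- Apart from `a ≠ d`, the six vertices are distinct because coincidences would contradict the
prescribed adjacencies; for instance `a = c` would make `a` adjacent to `d`. -/
theorem P4P2Free.false_of_adj (hG : P4P2Free G) {a b c d e f : Fin n} (hab : G.Adj a b)
    (hbc : G.Adj b c) (hcd : G.Adj c d) (hef : G.Adj e f) (hac : ¬ G.Adj a c) (hbd : ¬ G.Adj b d)
    (had : ¬ G.Adj a d) (hne : a ≠ d) (hae : ¬ G.Adj a e) (haf : ¬ G.Adj a f)
    (hbe : ¬ G.Adj b e) (hbf : ¬ G.Adj b f) (hce : ¬ G.Adj c e) (hcf : ¬ G.Adj c f)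
    (hde : ¬ G.Adj d e) (hdf : ¬ G.Adj d f) : False := by
  have key : ∀ x y, G.Adj (Sum.elim ![a, b, c, d] ![e, f] x) (Sum.elim ![a, b, c, d] ![e, f] y) ↔
      (SimpleGraph.pathGraph 4 ⊕g SimpleGraph.pathGraph 2).Adj x y := by
    rintro (x | x) (y | y) <;> fin_cases x <;> fin_cases y <;>
      simp [SimpleGraph.pathGraph_adj, hab, hbc, hcd, hef, hac, hbd, had, hae, haf, hbe, hbf, hce,
        hcf, hde, hdf, hab.symm, hbc.symm, hcd.symm, hef.symm, G.adj_comm c a, G.adj_comm d b,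
        G.adj_comm d a, G.adj_comm e a, G.adj_comm f a, G.adj_comm e b, G.adj_comm f b,
        G.adj_comm e c, G.adj_comm f c, G.adj_comm e d, G.adj_comm f d]
  have hinj : Function.Injective (Sum.elim ![a, b, c, d] ![e, f]) := by
    have n1 := hab.ne; have n2 := hbc.ne; have n3 := hcd.ne; have n4 := hef.ne
    have n5 : a ≠ c := by rintro rfl; exact had hcd
    have n6 : b ≠ d := by rintro rfl; exact had hab
    have n7 : a ≠ e := by rintro rfl; exact haf hef
    have n8 : a ≠ f := by rintro rfl; exact hae hef.symm
    have n9 : b ≠ e := by rintro rfl; exact hbf hef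
    have n10 : b ≠ f := by rintro rfl; exact hbe hef.symm
    have n11 : c ≠ e := by rintro rfl; exact hcf hef
    have n12 : c ≠ f := by rintro rfl; exact hce hef.symm
    have n13 : d ≠ e := by rintro rfl; exact hdf hef
    have n14 : d ≠ f := by rintro rfl; exact hde hef.symm
    rintro (x | x) (y | y) <;> fin_cases x <;> fin_cases y <;>
      simp [*, Ne.symm]
  exact hG.false ⟨⟨_, hinj⟩, key _ _⟩

/-- Any edge `v y` serves as the P_2: vertices at distance at least three from `v` see neither of
its ends. -/
theorem P4P2Free.noPathIn (hG : P4P2Free G) (hc : G.Connected) (v : Fin n) :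
    NoPathIn G (InR G v) := by
  intro a b c d ha hb hcR hd hab hbc hcd _ _ hac hbd had hne
  -- a neighbour of `v`
  obtain ⟨y, hy⟩ : ∃ y, G.Adj v y := by
    obtain ⟨p⟩ := hc.preconnected v a
    cases p with
    | nil => exact absurd rfl ha.1
    | cons h _ => exact ⟨_, h⟩
  have h1 : ∀ {x}, InR G v x → ¬ G.Adj x v ∧ ¬ G.Adj x y := fun hx =>
    ⟨hx.2.1, fun h => hx.2.2 ⟨y, h, hy.symm⟩⟩
  exact hG.false_of_adj hab hbc hcd hy hac hbd had hne (h1 ha).1 (h1 ha).2 (h1 hb).1 (h1 hb).2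
    (h1 hcR).1 (h1 hcR).2 (h1 hd).1 (h1 hd).2

/-- For a common neighbour `y` of `v` and `x`, the vertices `v`, `y`, `x`, `u` form an induced path,
and `a b` is the P_2. -/
theorem P4P2Free.edgesMet (hG : P4P2Free G) (v : Fin n) : EdgesMet G (InN2 G v) (InR G v) := by
  intro x u a b hx hu ha hb hxu hab hxa hxb _ _ hua hub
  obtain ⟨hxv, hxv', y, hxy, hyv⟩ := hx
  have h1 : ∀ {z}, InR G v z → ¬ G.Adj v z ∧ ¬ G.Adj y z := fun hz =>
    ⟨fun h => hz.2.1 h.symm, fun h => hz.2.2 ⟨y, h.symm, hyv⟩⟩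
  exact hG.false_of_adj hyv.symm hxy.symm hxu hab (fun h => hxv' h.symm) (h1 hu).2 (h1 hu).1
    hu.1.symm (h1 ha).1 (h1 hb).1 (h1 ha).2 (h1 hb).2 hxa hxb hua hub

/-- The efficient dominating sets of `G` that contain `v`. -/
theorem IsED.erase {v : Fin n} {D : Finset (Fin n)} (hD : IsED G D) (hv : v ∈ D) :
    IsRestrictedED G (InN2 G v) (InR G v) (D.erase v) := by
  have huniq : ∀ {x d d'}, d ∈ D → d' ∈ D → (d = x ∨ G.Adj d x) → (d' = x ∨ G.Adj d' x) → d = d' :=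
    fun h1 h2 h3 h4 => (hD _).unique ⟨h1, h3⟩ ⟨h2, h4⟩
  refine ⟨fun d hd => ?_, fun x hx => ?_⟩
  · obtain ⟨hne, hd⟩ := Finset.mem_erase.1 hd
    refine ⟨hne, fun h => hne (huniq hd hv (.inr h) (.inl rfl)), ?_⟩
    rintro ⟨j, hdj, hjv⟩
    exact hne (huniq hd hv (.inr hdj) (.inr hjv.symm))
  · obtain ⟨d, ⟨hd, hdx⟩, hu⟩ := hD x
    refine ⟨d, ⟨Finset.mem_erase.2 ⟨?_, hd⟩, hdx⟩, fun d' hd' =>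
      hu d' ⟨Finset.mem_of_mem_erase hd'.1, hd'.2⟩⟩
    rintro rfl
    have h1 : x ≠ d ∧ ¬ G.Adj x d := hx.elim (fun h => ⟨h.1, h.2.1⟩) fun h => ⟨h.1, h.2.1⟩
    exact hdx.elim (fun h => h1.1 h.symm) fun h => h1.2 h.symm

/-- Vertices of R are too far from `v` to dominate anything in N[v], and `v` dominates nothing else,
so the two dominations do not interfere. -/
theorem IsRestrictedED.insert {v : Fin n} {D : Finset (Fin n)}
    (hD : IsRestrictedED G (InN2 G v) (InR G v) D) : v ∉ D ∧ IsED G (insert v D) := by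
  have hvD : v ∉ D := fun h => (hD.1 v h).1 rfl
  refine ⟨hvD, fun x => ?_⟩
  by_cases hx : x = v ∨ G.Adj x v
  · refine ⟨v, ⟨Finset.mem_insert_self _ _, hx.imp Eq.symm fun h => h.symm⟩, fun d hd => ?_⟩
    refine (Finset.mem_insert.1 hd.1).resolve_right fun hdD => ?_
    obtain ⟨h1, h2, h3⟩ := hD.1 d hdD
    rcases hx with rfl | hx
    · exact hd.2.elim h1 h2
    · rcases hd.2 with rfl | h
      · exact h2 hx
      · exact h3 ⟨x, h, hx⟩
  · push Not at hx
    have hx' : InN2 G v x ∨ InR G v x := by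
      by_cases h : ∃ j, G.Adj x j ∧ G.Adj j v
      · exact .inl ⟨hx.1, hx.2, h⟩
      · exact .inr ⟨hx.1, hx.2, h⟩
    obtain ⟨d, ⟨hd, hdx⟩, hu⟩ := hD.2 x hx'
    refine ⟨d, ⟨Finset.mem_insert_of_mem hd, hdx⟩, fun d' hd' => ?_⟩
    rcases Finset.mem_insert.1 hd'.1 with rfl | h
    · exact (hd'.2.elim (fun h => hx.1 h.symm) fun h => hx.2 h.symm).elim
    · exact hu d' ⟨h, hd'.2⟩

/-! ### The weights on `G_v` -/

theorem subWeight_of_inR {v : Fin n} {w : Fin n → ℕ∞} {x : subVerts G v} (hx : InR G v x) :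
    subWeight G v w x = w x := by
  rw [subWeight, if_neg]
  rw [mem_level_two]
  exact fun h => not_inR_of_inN2 h hx

theorem subWeight_ne_top_iff {v : Fin n} {w : Fin n → ℕ∞} {x : subVerts G v} :
    subWeight G v w x ≠ ⊤ ↔ InR G v x ∧ 1 ≤ weightCode (w x) := by
  have hw : ∀ a : ℕ∞, a ≠ ⊤ ↔ 1 ≤ weightCode a := by
    intro a
    induction a using ENat.recTopCoe with
    | top => exact ⟨fun h => absurd rfl h, fun h => absurd h (by decide)⟩
    | coe k => exact ⟨fun _ => Nat.le_add_left 1 k, fun _ => ENat.natCast_ne_top k⟩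
  rcases mem_subVerts.1 x.2 with h | h
  · rw [subWeight, if_pos (mem_level_two.2 h)]
    exact ⟨fun h => absurd rfl h, fun h' => absurd h'.1 (not_inR_of_inN2 h)⟩
  · rw [subWeight_of_inR h, hw]
    exact (and_iff_right h).symm

theorem sum_subWeight {v : Fin n} {w : Fin n → ℕ∞} {D : Finset (subVerts G v)}
    (hD : ∀ x ∈ D, InR G v x ∧ 1 ≤ weightCode (w x)) :
    ∑ x ∈ D, subWeight G v w x =
      ((∑ x ∈ D.map (Function.Embedding.subtype _), (weightCode (w x) - 1) : ℕ) : ℕ∞) := by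
  rw [Finset.sum_map, Nat.cast_sum]
  refine Finset.sum_congr rfl fun x hx => ?_
  rw [subWeight_of_inR (hD x hx).1]
  have := (hD x hx).2
  simp only [Function.Embedding.coe_subtype]
  generalize w x = a at this
  induction a using ENat.recTopCoe with
  | top => exact absurd this (by decide)
  | coe k => rfl

theorem sum_subWeight_ne_top_iff {v : Fin n} {w : Fin n → ℕ∞} {D : Finset (subVerts G v)} :
    ∑ x ∈ D, subWeight G v w x ≠ ⊤ ↔ ∀ x ∈ D, InR G v x ∧ 1 ≤ weightCode (w x) := by
  constructor
  · intro h x hx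
    rw [← subWeight_ne_top_iff]
    intro h'
    exact h (top_le_iff.1 (h' ▸ Finset.single_le_sum (f := subWeight G v w) 
      (fun _ _ => zero_le) hx))
  · intro h
    rw [sum_subWeight h]
    exact ENat.natCast_ne_top _

/-- The efficient dominating sets of `G_v` of finite weight. -/
theorem isED_subGraph_iff {v : Fin n} {w : Fin n → ℕ∞} {D : Finset (subVerts G v)} :
    (IsED (subGraph G v) D ∧ ∑ x ∈ D, subWeight G v w x ≠ ⊤) ↔
      IsRestrictedED G (InN2 G v) (InR G v) (D.map (Function.Embedding.subtype _)) ∧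
        ∀ d ∈ D.map (Function.Embedding.subtype _), 1 ≤ weightCode (w d) := by
  rw [sum_subWeight_ne_top_iff]
  have hmem : ∀ d, d ∈ D.map (Function.Embedding.subtype _) ↔
      ∃ h : d ∈ subVerts G v, ⟨d, h⟩ ∈ D := by
    intro d
    simp
  constructor
  · rintro ⟨h1, h2⟩
    refine ⟨⟨fun d hd => ?_, fun x hx => ?_⟩, fun d hd => ?_⟩
    · obtain ⟨h, hd⟩ := (hmem d).1 hd
      exact (h2 _ hd).1
    · obtain ⟨d, ⟨hd, hdx⟩, hu⟩ := h1 ⟨x, mem_subVerts.2 hx⟩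
      refine ⟨d, ⟨(hmem d).2 ⟨d.2, hd⟩, hdx.imp (fun h => congrArg Subtype.val h) id⟩, ?_⟩
      rintro d' ⟨hd', hdx'⟩
      obtain ⟨h, hd'⟩ := (hmem d').1 hd'
      exact congrArg Subtype.val (hu ⟨d', h⟩ ⟨hd', hdx'.imp Subtype.ext id⟩)
    · obtain ⟨h, hd⟩ := (hmem d).1 hd
      exact (h2 _ hd).2
  · rintro ⟨⟨h1, h2⟩, h3⟩
    refine ⟨fun x => ?_, fun x hx => ?_⟩
    · obtain ⟨d, ⟨hd, hdx⟩, hu⟩ := h2 x (mem_subVerts.1 x.2)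
      obtain ⟨h, hd⟩ := (hmem d).1 hd
      exact ⟨⟨d, h⟩, ⟨hd, hdx.imp Subtype.ext id⟩, fun d' hd' => Subtype.ext
        (hu d' ⟨(hmem d').2 ⟨d'.2, hd'.1⟩, hd'.2.imp (fun h => congrArg Subtype.val h) id⟩)⟩
    · have := (hmem x).2 ⟨x.2, hx⟩
      exact ⟨h1 x this, h3 x this⟩

theorem exists_map_eq {v : Fin n} {D : Finset (Fin n)} (hD : ∀ d ∈ D, InR G v d) :
    ∃ D' : Finset (subVerts G v), D'.map (Function.Embedding.subtype _) = D := by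
  classical
  refine ⟨D.subtype _, ?_⟩
  rw [Finset.subtype_map, Finset.filter_true_of_mem]
  exact fun d hd => mem_subVerts.2 (.inr (hD d hd))

end

end WED

namespace WED

open _root_.WED.Expr Pass

/-! ## The word bound -/

section

variable {n : ℕ} {G : SimpleGraph (Fin n)} [DecidableRel G.Adj] {num : Fin n → ℕ} {s : Mem}

theorem card_le_edges (hG : G.Connected) : n ≤ G.edgeFinset.card + 1 := by
  have := hG.card_vert_le_card_edgeSet_add_one
  rwa [Nat.card_eq_fintype_card, Fintype.card_fin, Nat.card_eq_fintype_card,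
    ← SimpleGraph.edgeFinset_card] at this

theorem two_mul_edges_le (G : SimpleGraph (Fin n)) [DecidableRel G.Adj] :
    2 * G.edgeFinset.card ≤ n * n := by
  rw [← G.sum_degrees_eq_twice_card_edges]
  refine (Finset.sum_le_card_nsmul _ _ n fun v _ => ?_).trans (by simp)
  exact (G.degree_lt_card_verts v).le.trans (by simp)

/-- Offsets are at most 2m ≤ n², and array 1 holds vertices; everything else is a given number or 0.
-/
theorem IsInput.bounded {aux : ℕ} (hs : IsInput G num aux s) (haux : aux ≤ n) :
    s.Bounded ((n + Finset.univ.sup num + 2) ^ 2) ∧ ∀ i, s.arr 2 i ≤ Finset.univ.sup num := by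
  have H := hs.holdsGraph
  set M := Finset.univ.sup num with hM
  have h2 : ∀ i, s.arr 2 i ≤ M := by
    intro i
    by_cases hi : i < n
    · have := hs.number ⟨i, hi⟩
      simp only at this
      rw [this]
      exact Finset.le_sup (Finset.mem_univ _)
    · rw [hs.number_zero i (by omega)]
      exact Nat.zero_le _
  have hX : n * n + n + M ≤ (n + M + 2) ^ 2 := by
    nlinarith [Nat.zero_le (n * M), Nat.zero_le (M * M)]
  have hmono : ∀ k ≤ n, s.arr 0 k ≤ s.arr 0 n := by
    intro k hk
    rw [hs.offset k hk, hs.offset n le_rfl]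
    refine Finset.sum_le_sum fun j _ => ?_
    rw [if_pos j.2]
    split_ifs
    · exact le_rfl
    · exact Nat.zero_le _
  have hlast : s.arr 0 n ≤ n * n := by
    have := H.offset_last
    rw [hs.size] at this
    rw [this]
    exact two_mul_edges_le G
  have h1 : ∀ p, s.arr 1 p ≤ n := by
    intro p
    by_cases hp : s.arr 0 n ≤ p
    · rw [hs.neighbour_zero p hp]
      exact Nat.zero_le _
    -- A position below the last offset lies in the block of some vertex, so its entry is a vertex.
    · have key : ∀ k ≤ n, p < s.arr 0 k → ∃ i < n, s.arr 0 i ≤ p ∧ p < s.arr 0 (i + 1) := by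
        intro k
        induction k with
        | zero =>
          intro _ h
          rw [hs.offset 0 (Nat.zero_le _)] at h
          simp at h
        | succ k ih =>
          intro hk h
          by_cases h' : p < s.arr 0 k
          · exact ih (by omega) h'
          · exact ⟨k, hk, not_lt.1 h', h⟩
      obtain ⟨i, hi, hp1, hp2⟩ := key n le_rfl (not_le.1 hp)
      obtain ⟨j, -, hj⟩ := H.block_mem (i := ⟨i, hi⟩) (p := p) (Finset.mem_Ico.2 ⟨hp1, hp2⟩)
      rw [hj]
      exact j.2.le
  refine ⟨⟨fun x => ?_, fun a i => ?_⟩, h2⟩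
  · by_cases hx0 : x = 0
    · rw [hx0, hs.size]; omega
    · by_cases hx1 : x = 1
      · rw [hx1, hs.aux]; omega
      · rw [hs.reg_zero x (by omega)]; omega
  · match a with
    | 0 =>
      by_cases hi : i ≤ n
      · have := hmono i hi; omega
      · rw [hs.offset_zero i (by omega)]; omega
    | 1 => have := h1 i; omega
    | 2 => have := h2 i; omega
    | a + 3 => rw [hs.arr_zero (a + 3) i (by omega)]; omega

/-- From entries below X², where X = n + M + 2, a tame run of `t` steps stays below X² + t(M + 2) ≤
(C + 1)X⁴. The constant factor is absorbed by the exponent, as X ≥ 2 gives C + 1 ≤ X^(C + 1). -/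
theorem IsInput.run {aux : ℕ} (hs : IsInput G num aux s) (haux : aux ≤ n) {P : Prog}
    (hP : P.tame) {t : ℕ} {s' : Mem} (h : Exec P s t s') {C : ℕ} (ht : t ≤ C * (n ^ 3 + 1)) :
    Run (wordBound (C + 6) num) P s t s' := by
  obtain ⟨B, hB⟩ := h
  obtain ⟨hb, hM⟩ := hs.bounded haux
  refine (hB.tame_run hP hM hb).2.2 _ ?_
  rw [wordBound]
  set M := Finset.univ.sup num
  set X := n + M + 2 with hX
  have h2 : 2 ≤ X := by omega
  have h1 : n ^ 3 + 1 ≤ X ^ 3 := by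
    have : (n + 1) ^ 3 ≤ X ^ 3 := Nat.pow_le_pow_left (by omega) 3
    nlinarith [Nat.zero_le (n ^ 2), Nat.zero_le n]
  have h3 : C + 1 ≤ X ^ (C + 1) := (Nat.lt_two_pow_self).le.trans (Nat.pow_le_pow_left h2 _)
  calc X ^ 2 + t * (M + 2) ≤ X ^ 2 + C * X ^ 3 * X := by
        have : t * (M + 2) ≤ C * X ^ 3 * X :=
          Nat.mul_le_mul (ht.trans (Nat.mul_le_mul_left _ h1)) (by omega)
        omega
    _ ≤ X ^ 4 + C * X ^ 3 * X := by
        have : X ^ 2 ≤ X ^ 4 := Nat.pow_le_pow_right (by omega) (by omega)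
        omega
    _ = (C + 1) * X ^ 4 := by ring
    _ ≤ X ^ (C + 1) * X ^ 4 := Nat.mul_le_mul_right _ h3
    _ = X ^ (C + 5) := by ring
    _ ≤ X ^ (C + 6) := Nat.pow_le_pow_right (by omega) (by omega)

theorem exec_subPasses (hs : HoldsGraph G num s) {Ps : List Pass} (hPs : ssa Ps) :
    ∃ t s', Exec (passesProg Ps) s t s' ∧ t ≤ passesSize Ps * (n + 2 * G.edgeFinset.card + 1) ∧
      s.EqOff (Ps.map Pass.tgt) s' ∧ (∀ P ∈ Ps, P.Holds s') ∧ HoldsGraph G num s' := by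
  obtain ⟨t, s', h1, h2, h3, h4⟩ := exec_passesProg hPs s hs.mono
  rw [hs.offset_last, hs.size] at h2
  exact ⟨t, s', h1, h2, h3, h4, hs.eqOff h3 (ssa_two_lt hPs)⟩

end

/-! ## The algorithm for a given `v` -/

/-- The program for `G_v`, with `v` in register `1`. -/
def subProg : Prog := .seq (passesProg (subPasses 1)) (.assign 0 (lt (lit 0) (sc 42)))

theorem subProg_tame : subProg.tame = true := by decide

/-- Connectedness gives n ≤ m + 1, which makes n + 2m + 1 linear in m + 1, and makes R empty when
N_2 is. An e.d. of infinite weight cannot beat the one found, so comparing with the finite ones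
suffices. -/
theorem subProg_correct {n : ℕ} (G : SimpleGraph (Fin n)) [DecidableRel G.Adj] (v : Fin n)
    (w : Fin n → ℕ∞) (s : Mem) (hG : G.Connected)
    (hs : IsInput G (fun x => weightCode (w x)) v s) :
    ∃ t s', Exec subProg s t s' ∧
      t ≤ (3 * passesSize (subPasses 1) + 10) * (G.edgeFinset.card + 1) ∧
      ((∃ D : Finset (subVerts G v), IsMinFiniteSubED G v w D ∧
          Answers s' (D.map (Function.Embedding.subtype _))) ∨
        (Rejects s' ∧ (¬ P4P2Free G ∨ ¬ ∃ D : Finset (subVerts G v),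
          IsED (subGraph G v) D ∧ ∑ x ∈ D, subWeight G v w x ≠ ⊤))) := by
  obtain ⟨t, s₁, h1, ht, h3, h4, H⟩ := exec_subPasses hs.holdsGraph (Ps := subPasses 1) (by decide)
  have hv : s₁.reg 1 = v := by rw [h3.reg 1 (by decide) (by decide) (by decide), hs.aux]
  have S := subSpec H hv (fun h x => not_inR_of_not_inN2 hG h x) h4
  refine ⟨_, _, h1.seq (.assign s₁ 0 _), ?_, ?_⟩
  · have := card_le_edges hG
    have h5 : passesSize (subPasses 1) * (n + 2 * G.edgeFinset.card + 1) ≤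
        passesSize (subPasses 1) * (3 * (G.edgeFinset.card + 1)) := Nat.mul_le_mul_left _ (by omega)
    have h6 : (lt (lit 0) (sc 42)).cost = 4 := rfl
    rw [add_mul, mul_assoc, mul_left_comm]
    omega
  · by_cases h42 : s₁.arr 42 0 = 0
    · right
      refine ⟨by simp [Rejects, Mem.setReg, eval, sc, h42], ?_⟩
      by_contra hcon
      push Not at hcon
      obtain ⟨hfree, D, hD⟩ := hcon
      exact S.notFound h42 (hfree.noPathIn hG v) (hfree.edgesMet v) ⟨_, isED_subGraph_iff.1 hD⟩
    · left
      obtain ⟨D, hD, hfin, hmem, -, hmin⟩ := S.found h42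
      obtain ⟨D', rfl⟩ := exists_map_eq hD.1
      have hD' := isED_subGraph_iff.2 ⟨hD, hfin⟩
      refine ⟨D', ⟨⟨hD'.1, fun E hE => ?_⟩, hD'.2⟩, ?_, hmem⟩
      · by_cases hE' : ∑ x ∈ E, subWeight G v w x = ⊤
        · rw [hE']
          exact le_top
        · obtain ⟨h5, h6⟩ := isED_subGraph_iff.1 ⟨hE, hE'⟩
          rw [sum_subWeight (sum_subWeight_ne_top_iff.1 hD'.2),
            sum_subWeight (sum_subWeight_ne_top_iff.1 hE')]
          exact Nat.cast_le.2 (hmin _ h5 h6)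
      · simp [Mem.setReg, eval, sc, Nat.pos_of_ne_zero h42]

/-! ## The algorithm for the whole problem -/

/-- An update that ignores the step has the effect of a single one, provided that there is a step at
all. This turns a loop over the vertices into a choice between two values. -/
theorem foldRange_ite {c : Prop} [Decidable c] {w : ℕ} {f : ℕ → ℕ → ℕ} {lo : ℕ} :
    ∀ {k acc : ℕ}, 0 < k → (∀ p a, f p a = if c then w else a) →
      foldRange f lo k acc = if c then w else acc
  | 1, acc, _, h => by simp only [foldRange]; rw [h]
  | k + 2, acc, _, h => by
    rw [foldRange, h, foldRange_ite (k := k + 1) (by omega) h]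
    split_ifs <;> rfl

/-- The value `v` if `c` holds, else `v₀`. -/
def Pass.choice (a : ℕ) (c v v₀ : Expr) : Pass := ⟨false, a, lit 1, v₀, c, v⟩

theorem Pass.choice_eq {n : ℕ} {G : SimpleGraph (Fin n)} [DecidableRel G.Adj] {num : Fin n → ℕ}
    {s : Mem} (H : HoldsGraph G num s) (hn : 0 < n) {a : ℕ} {c v v₀ : Expr}
    (h : (choice a c v v₀).Holds s) (C : Prop) (w : ℕ) [Decidable C]
    (hC : ∀ i acc : ℕ, c.eval (s.at i 0 acc) ≠ 0 ↔ C)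
    (hw : ∀ i acc : ℕ, v.eval (s.at i 0 acc) = w) :
    s.arr a 0 = if C then w else v₀.eval (s.at 0 0 0) := by
  simp only [Holds, choice, Bool.false_eq_true, if_false] at h
  rw [h, total]
  simp only
  rw [foldRange_ite (c := C) (w := w) (by rw [H.size]; exact hn)]
  · simp [upd, eval]
  · intro p a
    simp only [upd, hw]
    exact if_congr (hC p a) rfl rfl

/-- Comparing the result for `v` with the best one so far. -/
def updPasses : List Pass :=
  [const 45 (lit 1) (add (sc 44) (get 2 (reg 1))),
   const 46 (band (sc 42) (bor (bnot (sc 51)) (lt (sc 45) (sc 52)))) (lit 1),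
   const 47 (bor (sc 46) (sc 51)) (lit 1),
   choice 48 (sc 46) (sc 45) (sc 52),
   mark 49 (bor (band (sc 46) (bor (atI 3) (eq eI (reg 1)))) (band (bnot (sc 46)) (atI 53)))]

/-- These arrays carry the best result from trial to trial. They are read by `updPasses` and so must
be overwritten in a separate single-assignment block. -/
def copyPasses : List Pass :=
  [const 51 (lit 1) (sc 47), const 52 (lit 1) (sc 48), mark 53 (atI 49)]

def tryPasses : List Pass := subPasses 0 ++ updPasses

/-- Tries the vertex in register `1`. -/
def tryProg : Prog := .seq (passesProg tryPasses) (passesProg copyPasses)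

/-- A degree is a difference of consecutive offsets; the accumulator is the best vertex plus one, so
it already indexes the upper offset. -/
def degreePasses : List Pass :=
  [argmin 50 (lit 1) (sub (get 0 eI') (get 0 eI))
    (sub (get 0 (reg 4)) (get 0 (sub (reg 4) (lit 1))))]

def resultPasses : List Pass := [mark 3 (atI 53)]

def fullProg : Prog :=
  .seq (passesProg degreePasses) (.seq (.assign 5 (sub (sc 50) (lit 1)))
    (.seq (.assign 1 (reg 5)) (.seq tryProg
      (.seq (forRange 6 (get 0 (reg 5)) (get 0 (add (reg 5) (lit 1)))
          (.seq (.assign 1 (get 1 (reg 6))) tryProg))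
        (.seq (passesProg resultPasses) (.assign 0 (sc 51)))))))

theorem fullProg_tame : fullProg.tame = true := by decide

section

variable {n : ℕ} {G : SimpleGraph (Fin n)} [DecidableRel G.Adj] {num : Fin n → ℕ}

/-- Array `53` holds the best efficient dominating set that contains a vertex of `S`. -/
structure BestOf (G : SimpleGraph (Fin n)) (num : Fin n → ℕ) (S : Fin n → Prop)
    (s : Mem) : Prop where
  none : s.arr 51 0 = 0 → ∀ v, S v → ∀ D, IsED G D → v ∉ D
  some : s.arr 51 0 ≠ 0 → s.arr 51 0 = 1 ∧ ∃ D, IsED G D ∧ (∀ i : Fin n, s.arr 53 i ≠ 0 ↔ i ∈ D) ∧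
    s.arr 52 0 = ∑ i ∈ D, num i ∧
    ∀ v, S v → ∀ D', IsED G D' → v ∈ D' → ∑ i ∈ D, num i ≤ ∑ i ∈ D', num i

/-- Adding `v` to the solutions for G_v shifts all weights by the weight of `v`, so minima
correspond. By freeness a failed search means that no e.d. contains `v`. Otherwise the better of the
old and the new set is kept. -/
theorem exec_tryProg (hG : G.Connected) (hfree : P4P2Free G) {s : Mem} (hs : HoldsGraph G num s)
    {v : Fin n} (hv : s.reg 1 = v) {S : Fin n → Prop} (hS : BestOf G num S s) :
    ∃ t s', Exec tryProg s t s' ∧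
      t ≤ (passesSize tryPasses + passesSize copyPasses) * (n + 2 * G.edgeFinset.card + 1) ∧
      HoldsGraph G num s' ∧ (∀ r, r ≠ 2 → r ≠ 3 → r ≠ 4 → s'.reg r = s.reg r) ∧
      s'.arr 0 = s.arr 0 ∧ s'.arr 1 = s.arr 1 ∧ BestOf G num (fun u => S u ∨ u = v) s' := by
  classical
  obtain ⟨t, s₁, e1, ht, hs1, hP, H1⟩ := exec_subPasses hs (Ps := tryPasses) (by decide)
  obtain ⟨u, s₂, e2, hu, hs2, hQ, H2⟩ := exec_subPasses H1 (Ps := copyPasses) (by decide)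
  have hr1 := hs1.reg
  have hr2 := hs2.reg
  refine ⟨_, s₂, e1.seq e2, by rw [add_mul]; omega, H2, fun r h2 h3 h4 => by
    rw [hr2 r h2 h3 h4, hr1 r h2 h3 h4],
    (hs2.arr 0 (by decide)).trans (hs1.arr 0 (by decide)),
    (hs2.arr 1 (by decide)).trans (hs1.arr 1 (by decide)), ?_⟩
  have hv1 : s₁.reg 1 = v := by rw [hr1 1 (by decide) (by decide) (by decide), hv]
  have k51 : s₁.arr 51 = s.arr 51 := hs1.arr 51 (by decide)
  have k52 : s₁.arr 52 = s.arr 52 := hs1.arr 52 (by decide)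
  have k53 : s₁.arr 53 = s.arr 53 := hs1.arr 53 (by decide)
  have k47 : s₂.arr 47 = s₁.arr 47 := hs2.arr 47 (by decide)
  have k48 : s₂.arr 48 = s₁.arr 48 := hs2.arr 48 (by decide)
  have k49 : s₂.arr 49 = s₁.arr 49 := hs2.arr 49 (by decide)
  simp only [tryPasses, List.forall_mem_append] at hP
  obtain ⟨hsub, hP⟩ := hP
  have T := subSpec H1 hv1 (fun h x => not_inR_of_not_inN2 hG h x) hsub
  simp only [updPasses, List.forall_mem_cons] at hP
  obtain ⟨h45, h46, h47, h48, h49, -⟩ := hP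
  simp only [copyPasses, List.forall_mem_cons] at hQ
  obtain ⟨h51, h52, h53, -⟩ := hQ
  have e45 : s₁.arr 45 0 = s₁.arr 44 0 + num v := by
    rw [const_eq h45, ← H1.number]
    simp [eval, sc, Mem.at, hv1]
  have e46 : s₁.arr 46 0 ≠ 0 ↔ s₁.arr 42 0 ≠ 0 ∧ (s.arr 51 0 = 0 ∨ s₁.arr 45 0 < s.arr 52 0) := by
    rw [const_eq h46, ← k51, ← k52]
    simp only [eval_band, eval_bnot, eval_bor]
    simp [eval, sc, Mem.at]
    tauto
  have e51 : s₂.arr 51 0 = if s₁.arr 46 0 ≠ 0 ∨ s.arr 51 0 ≠ 0 then 1 else 0 := by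
    have h1 : s₂.arr 51 0 = s₂.arr 47 0 := by
      rw [const_eq h51]
      simp [eval, sc, Mem.at]
    rw [h1, k47, const_eq h47, ← k51]
    simp only [eval_bor]
    simp only [eval, sc, Mem.at]
    exact if_congr (by split_ifs with h <;> simp [h]) rfl rfl
  have e52 : s₂.arr 52 0 = if s₁.arr 46 0 ≠ 0 then s₁.arr 45 0 else s.arr 52 0 := by
    have h1 : s₂.arr 52 0 = s₂.arr 48 0 := by
      rw [const_eq h52]
      simp [eval, sc, Mem.at]
    rw [h1, k48, choice_eq H1 v.pos h48 (s₁.arr 46 0 ≠ 0) (s₁.arr 45 0)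
      (fun _ _ => by simp [eval, sc, Mem.at]) (fun _ _ => by simp [eval, sc, Mem.at]), ← k52]
    simp [eval, sc, Mem.at]
  have e53 : ∀ i : Fin n, s₂.arr 53 i ≠ 0 ↔
      if s₁.arr 46 0 ≠ 0 then s₁.arr 3 i ≠ 0 ∨ i = v else s.arr 53 i ≠ 0 := by
    intro i
    rw [mark_iff H2 h53]
    have h2 : (atI 49).eval (s₂.at i 0 0) = s₁.arr 49 i := by simp [eval, atI, Mem.at, k49]
    rw [h2, mark_iff H1 h49, ← k53]
    simp only [eval_band, eval_bnot, eval_bor]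
    by_cases h : s₁.arr 46 0 = 0
    · simp [eval, sc, atI, Mem.at, h]
    · simp [eval, sc, atI, eI, Mem.at, hv1, Fin.ext_iff, h]
      tauto
  -- every efficient dominating set with `v` is obtained from one of `G_v`
  have hsol : ∀ D', IsED G D' → v ∈ D' →
      IsRestrictedED G (InN2 G v) (InR G v) (D'.erase v) ∧ ∀ d ∈ D'.erase v, 0 ≤ num d :=
    fun D' hD' hvD' => ⟨hD'.erase hvD', fun d _ => Nat.zero_le _⟩
  have hno : s₁.arr 42 0 = 0 → ∀ D', IsED G D' → v ∉ D' := fun h D' hD' hvD' =>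
    T.notFound h (hfree.noPathIn hG v) (hfree.edgesMet v) ⟨_, hsol D' hD' hvD'⟩
  have hyes : s₁.arr 42 0 ≠ 0 → ∃ D, IsED G D ∧ (∀ i : Fin n, s₁.arr 3 i ≠ 0 ∨ i = v ↔ i ∈ D) ∧
      s₁.arr 45 0 = ∑ i ∈ D, num i ∧
      ∀ D', IsED G D' → v ∈ D' → ∑ i ∈ D, num i ≤ ∑ i ∈ D', num i := by
    intro h
    obtain ⟨D, hD, -, hmem, hsum, hmin⟩ := T.found h
    obtain ⟨hvD, hED⟩ := hD.insert
    have hw : ∑ i ∈ insert v D, num i = s₁.arr 45 0 := by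
      rw [Finset.sum_insert hvD, e45, hsum, add_comm]
      simp
    refine ⟨insert v D, hED, fun i => ?_, hw.symm, fun D' hD' hvD' => ?_⟩
    · rw [hmem, Finset.mem_insert, or_comm]
    · have := hmin _ (hsol D' hD' hvD').1 (hsol D' hD' hvD').2
      simp only [Nat.sub_zero] at this
      rw [Finset.sum_insert hvD, ← Finset.add_sum_erase D' num hvD']
      omega
  by_cases hup : s₁.arr 46 0 = 0
  · simp only [hup, ne_eq, not_true, false_or, if_false] at e51 e52 e53
    have hno' : ¬ (s₁.arr 42 0 ≠ 0 ∧ (s.arr 51 0 = 0 ∨ s₁.arr 45 0 < s.arr 52 0)) :=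
      fun h => e46.2 h hup
    constructor
    · intro h u hu D hD
      have h51 : s.arr 51 0 = 0 := by
        by_contra h'
        simp [h'] at e51
        omega
      rcases hu with hu | rfl
      · exact hS.none h51 u hu D hD
      · refine hno ?_ D hD
        by_contra h42
        exact hno' ⟨h42, .inl h51⟩
    · intro h
      have h51 : s.arr 51 0 ≠ 0 := by
        intro h'
        simp [h'] at e51
        exact h e51
      obtain ⟨-, D, hD, hmem, hsum, hmin⟩ := hS.some h51
      refine ⟨by simp [e51, h51], D, hD, fun i => (e53 i).trans (hmem i), by rw [e52, hsum], ?_⟩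
      rintro u (hu | rfl) D' hD' huD'
      · exact hmin u hu D' hD' huD'
      · by_cases h42 : s₁.arr 42 0 = 0
        · exact absurd huD' (hno h42 D' hD')
        · obtain ⟨E, -, -, hEsum, hEmin⟩ := hyes h42
          have h1 := hEmin D' hD' huD'
          have h2 : ¬ s₁.arr 45 0 < s.arr 52 0 := fun h => hno' ⟨h42, .inr h⟩
          omega
  · have hup' : s₁.arr 46 0 ≠ 0 := hup
    simp only [hup', ne_eq, not_false_eq_true, true_or, if_true] at e51 e52 e53
    obtain ⟨h42, hbetter⟩ := e46.1 hup'
    obtain ⟨D, hD, hmem, hsum, hmin⟩ := hyes h42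
    refine ⟨fun h => absurd (e51.symm.trans h) one_ne_zero, fun _ => ⟨e51, D, hD,
      fun i => (e53 i).trans (hmem i), by rw [e52, hsum], ?_⟩⟩
    rintro u (hu | rfl) D' hD' huD'
    · rcases hbetter with h51 | hlt
      · exact absurd huD' (hS.none h51 u hu D' hD')
      · by_cases h51 : s.arr 51 0 = 0
        · exact absurd huD' (hS.none h51 u hu D' hD')
        · obtain ⟨-, E, -, -, hEsum, hEmin⟩ := hS.some h51
          have := hEmin u hu D' hD' huD'
          omega
    · exact hmin D' hD' huD'

end

end WED

/-! ### The search over the closed neighbourhood of a vertex of minimum degree -/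

namespace WED

open _root_.WED.Expr Pass

theorem BestOf.congr {n : ℕ} {G : SimpleGraph (Fin n)} {num : Fin n → ℕ} {S S' : Fin n → Prop}
    {s s' : Mem}
    (h : BestOf G num S s) (hS : ∀ u, S' u → S u) (h' : s'.arr = s.arr) : BestOf G num S' s' := by
  constructor
  · rw [h']
    exact fun h0 v hv => h.none h0 v (hS v hv)
  · rw [h']
    intro h0
    obtain ⟨h1, D, hD, h2, h3, h4⟩ := h.some h0
    exact ⟨h1, D, hD, h2, h3, fun v hv => h4 v (hS v hv)⟩

section

variable {n : ℕ} {G : SimpleGraph (Fin n)} [DecidableRel G.Adj] {num : Fin n → ℕ}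

theorem HoldsGraph.setReg {s : Mem} (H : HoldsGraph G num s) {r : ℕ} (hr : r ≠ 0) (k : ℕ) :
    HoldsGraph G num (s.setReg r k) :=
  H.congr (by simp [Mem.setReg, hr.symm]) rfl rfl rfl

theorem exec_degreePasses (hn : 0 < n) {s : Mem} (hs : HoldsGraph G num s) :
    ∃ t s', Exec (passesProg degreePasses) s t s' ∧
      t ≤ passesSize degreePasses * (n + 2 * G.edgeFinset.card + 1) ∧ s.EqOff [50] s' ∧
      HoldsGraph G num s' ∧ ∃ z : Fin n, s'.arr 50 0 = z + 1 ∧ G.degree z = G.minDegree := by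
  obtain ⟨t, s₁, e, ht, hs1, hP, H⟩ := exec_subPasses hs (Ps := degreePasses) (by decide)
  refine ⟨t, s₁, e, ht, hs1, H, ?_⟩
  have : Nonempty (Fin n) := ⟨⟨0, hn⟩⟩
  rcases argmin_spec H (hP _ (List.mem_singleton_self _)) (fun _ => True) (fun j => G.degree j)
    (fun i acc => by simp [eval])
    (fun i acc => by
      have := H.offset_succ i
      simp [eval, eI, eI', Mem.at, this])
    (fun i j => by
      have := H.offset_succ j
      simp [eval, Mem.at, this]) with h | ⟨z, -, hz, hmin⟩
  · exact absurd trivial (h.2 ⟨0, hn⟩)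
  · exact ⟨z, hz, le_antisymm (G.le_minDegree_of_forall_le_degree _ fun j => hmin j trivial)
      (G.minDegree_le_degree z)⟩


/-- The invariant speaks of the vertices listed at positions already visited, which at the end are
all neighbours of `z`. Registers 5 and 6 lie outside the working registers, so the trials preserve
them. -/
theorem exec_neighbours (hG : G.Connected) (hfree : P4P2Free G) {s : Mem}
    (hs : HoldsGraph G num s) {z : Fin n} (hz : s.reg 5 = z)
    (hS : BestOf G num (fun u => u = z) s) :
    ∃ t s', Exec (forRange 6 (get 0 (reg 5)) (get 0 (add (reg 5) (lit 1)))
          (.seq (.assign 1 (get 1 (reg 6))) tryProg)) s t s' ∧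
      t ≤ G.degree z * ((passesSize tryPasses + passesSize copyPasses) *
        (n + 2 * G.edgeFinset.card + 1) + 15) + 15 ∧
      HoldsGraph G num s' ∧ BestOf G num (fun u => u = z ∨ G.Adj z u) s' := by
  have hdeg := hs.offset_succ z
  obtain ⟨t, s', e, ht, H, -, -, h0, h1, hB⟩ := Exec.forRange (r := 6) (lo := get 0 (reg 5))
    (hi := get 0 (add (reg 5) (lit 1))) (body := .seq (.assign 1 (get 1 (reg 6))) tryProg)
    (fun k m => HoldsGraph G num m ∧ m.reg 5 = z ∧ m.reg 6 = k ∧ m.arr 0 = s.arr 0 ∧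
      m.arr 1 = s.arr 1 ∧
      BestOf G num (fun u => u = z ∨ ∃ p, s.arr 0 z ≤ p ∧ p < k ∧ s.arr 1 p = u) m)
    (fun _ => (passesSize tryPasses + passesSize copyPasses) *
        (n + 2 * G.edgeFinset.card + 1) + 3) (s.arr 0 z) (s.arr 0 (z + 1)) (by omega)
    (fun k m hm => hm.2.2.1)
    (fun k m hm => by simp [eval, hm.2.1, hm.2.2.2.1])
    (by
      rintro k hk1 hk2 m ⟨hm, h5, h6, h0, h1, hB⟩
      obtain ⟨j, -, hj⟩ := hs.block_mem (i := z) (Finset.mem_Ico.2 ⟨hk1, hk2⟩)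
      have ev : (get 1 (reg 6)).eval m = j := by simp [eval, h6, h1, hj]
      have e1 := Exec.assign m 1 (get 1 (reg 6))
      rw [ev] at e1
      obtain ⟨t, m', e2, ht, hm', hr, k0, k1, hB'⟩ := exec_tryProg hG hfree
        (hm.setReg (r := 1) one_ne_zero (j : ℕ)) (v := j) (by simp [Mem.setReg])
        (hB.congr (fun _ => id) rfl)
      have r5 : m'.reg 5 = z := by
        rw [hr 5 (by decide) (by decide) (by decide)]
        simpa [Mem.setReg] using h5
      have r6 : m'.reg 6 = k := by
        rw [hr 6 (by decide) (by decide) (by decide)]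
        simpa [Mem.setReg] using h6
      refine ⟨_, m', e1.seq e2, ?_, r6, hm'.setReg (by decide) _, by simpa [Mem.setReg] using r5,
        by simp [Mem.setReg], k0.trans h0, k1.trans h1, hB'.congr ?_ rfl⟩
      · simp only [cost]
        omega
      · rintro u (hu | ⟨p, hp1, hp2, hp⟩)
        · exact .inl (.inl hu)
        · rcases Nat.lt_succ_iff_lt_or_eq.1 hp2 with h | rfl
          · exact .inl (.inr ⟨p, hp1, h, hp⟩)
          · exact .inr (Fin.ext (hp.symm.trans hj)))
    s (by simp [eval, hz])
    ⟨hs.setReg (by decide) _, by simpa [Mem.setReg] using hz, by simp [Mem.setReg], rfl, rfl,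
      hS.congr (by
        rintro u (hu | ⟨p, hp1, hp2, -⟩)
        · exact hu
        · omega) rfl⟩
  refine ⟨t, s', e, ht.trans ?_, H, hB.congr ?_ rfl⟩
  · simp only [Finset.sum_const, Nat.card_Ico, smul_eq_mul, cost]
    rw [hdeg, Nat.add_sub_cancel_left]
  · rintro u (hu | hu)
    · exact .inl hu
    · exact .inr ((hs.neighbour z u).1 hu)

theorem exec_resultPasses {s : Mem} (hs : HoldsGraph G num s) :
    ∃ t s', Exec (passesProg resultPasses) s t s' ∧
      t ≤ passesSize resultPasses * (n + 2 * G.edgeFinset.card + 1) ∧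
      s'.arr 51 = s.arr 51 ∧ ∀ i : Fin n, s'.arr 3 i ≠ 0 ↔ s.arr 53 i ≠ 0 := by
  obtain ⟨t, s₁, e, ht, hs1, hP, H⟩ := exec_subPasses hs (Ps := resultPasses) (by decide)
  refine ⟨t, s₁, e, ht, hs1.arr 51 (by decide), fun i => ?_⟩
  rw [mark_iff H (hP _ (List.mem_singleton_self _)), ← hs1.arr 53 (by decide)]
  simp [eval, atI, Mem.at]

/-- The constant in the time bound. -/
def fullSize : ℕ :=
  passesSize degreePasses + 2 * (passesSize tryPasses + passesSize copyPasses) +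
    passesSize resultPasses + 60

/-- In a connected graph δ = 0 forces n = 1 and m = 0; the summand 1 on the right is there for this
case. Otherwise δ, m ≥ 1 and n ≤ m + 1 bound the left side by 2δ(3m + 2) ≤ 10δm. -/
theorem degree_edges_bound (hG : G.Connected) {k : ℕ} (hk : k = G.minDegree) :
    (k + 1) * (n + 2 * G.edgeFinset.card + 1) ≤ 12 * (k * G.edgeFinset.card + 1) := by
  have h1 := card_le_edges hG
  have hne := hG.nonempty
  rcases Nat.eq_zero_or_pos k with h0 | hpos
  · have hm : G.edgeFinset.card = 0 := by
      rw [hk] at h0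
      obtain ⟨z, hz⟩ := G.exists_minimal_degree_vertex
      have hs : Subsingleton (Fin n) := by
        by_contra hcon
        rw [not_subsingleton_iff_nontrivial] at hcon
        have := hG.preconnected.degree_pos_of_nontrivial z
        omega
      have h2 : Fintype.card (Fin n) ≤ 1 := Fintype.card_le_one_iff_subsingleton.2 hs
      have h3 := two_mul_edges_le G
      rw [Fintype.card_fin] at h2
      have : n * n ≤ 1 * 1 := Nat.mul_le_mul h2 h2
      omega
    rw [h0, hm]
    omega
  · have hm : 1 ≤ G.edgeFinset.card := by
      by_contra hcon
      have hn : n ≤ 1 := by omega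
      have := G.minDegree_lt_card
      rw [Fintype.card_fin] at this
      omega
    nlinarith [Nat.mul_le_mul hpos hm]

/-- Whatever dominates `z` lies in N[z], so every e.d. competes in one of the δ + 1 trials. The
trials start with array 51 equal to 0, the record for the empty set of tried vertices. -/
theorem fullProg_correct {s : Mem} (hG : G.Connected) (hfree : P4P2Free G)
    (hs : IsInput G num 0 s) :
    ∃ t s', Exec fullProg s t s' ∧
      t ≤ 12 * fullSize * (G.minDegree * G.edgeFinset.card + 1) ∧
      ((∃ D : Finset (Fin n), IsMinED G num D ∧ Answers s' D) ∨
        (Rejects s' ∧ ¬ ∃ D : Finset (Fin n), IsED G D)) := by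
  have hn : 0 < n := Fin.pos_iff_nonempty.2 hG.nonempty
  obtain ⟨t₁, s₁, e1, ht1, hs1, H1, z, hz, hdeg⟩ := exec_degreePasses hn hs.holdsGraph
  have e2 := Exec.assign s₁ 5 (sub (sc 50) (lit 1))
  rw [show (sub (sc 50) (lit 1)).eval s₁ = z by simp [eval, sc, hz]] at e2
  have e3 := Exec.assign (s₁.setReg 5 z) 1 (reg 5)
  rw [show (reg 5).eval (s₁.setReg 5 z) = z by simp [eval, Mem.setReg]] at e3
  have h51 : s₁.arr 51 0 = 0 := by
    rw [hs1.arr 51 (by decide)]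
    exact hs.arr_zero 51 0 (by decide)
  obtain ⟨t₄, s₄, e4, ht4, H4, hr4, -, -, B4⟩ := exec_tryProg hG hfree
    (s := (s₁.setReg 5 z).setReg 1 z) ((H1.setReg (by decide) _).setReg (by decide) _) (v := z)
    (by simp [Mem.setReg]) (S := fun _ => False)
    ⟨fun _ _ h => h.elim, fun h => absurd h51 h⟩
  have r5 : s₄.reg 5 = z := by
    rw [hr4 5 (by decide) (by decide) (by decide)]
    simp [Mem.setReg]
  obtain ⟨t₅, s₅, e5, ht5, H5, B5⟩ := exec_neighbours hG hfree H4 r5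
    (B4.congr (fun u hu => .inr hu) rfl)
  obtain ⟨t₆, s₆, e6, ht6, h651, h63⟩ := exec_resultPasses H5
  have e7 := Exec.assign s₆ 0 (sc 51)
  have hdom : ∀ D, IsED G D → ∃ v, (v = z ∨ G.Adj z v) ∧ v ∈ D := by
    intro D hD
    obtain ⟨d, ⟨hd, h⟩, -⟩ := hD z
    exact ⟨d, h.imp id fun h => h.symm, hd⟩
  refine ⟨_, _, e1.seq (e2.seq (e3.seq (e4.seq (e5.seq (e6.seq e7))))), ?_, ?_⟩
  · refine le_trans ?_ ((Nat.mul_le_mul_left fullSize (degree_edges_bound hG rfl)).trans_eq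
      (by ring))
    rw [hdeg] at ht5
    simp only [cost, sc]
    set X := n + 2 * G.edgeFinset.card + 1 with hX
    have hX1 : 1 ≤ X := by omega
    set K := passesSize tryPasses + passesSize copyPasses
    have h1 : fullSize * ((G.minDegree + 1) * X) = passesSize degreePasses * X + K * X +
        passesSize resultPasses * X + 45 * X + (G.minDegree * (K * X) + G.minDegree * (15 * X)) +
        (passesSize degreePasses + K + passesSize resultPasses + 45) * (G.minDegree * X) +
        K * X + 15 * X := by
      simp only [fullSize]
      ring
    have h2 : G.minDegree * (K * X + 15) ≤ G.minDegree * (K * X) + G.minDegree * (15 * X) := by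
      rw [← mul_add]
      exact Nat.mul_le_mul_left _ (by omega)
    rw [h1]
    omega
  · have hreg : (s₆.setReg 0 ((sc 51).eval s₆)).reg 0 = s₅.arr 51 0 := by
      simp [Mem.setReg, eval, sc, h651]
    by_cases h : s₅.arr 51 0 = 0
    · right
      refine ⟨hreg.trans h, ?_⟩
      rintro ⟨D, hD⟩
      obtain ⟨v, hv, hvD⟩ := hdom D hD
      exact B5.none h v hv D hD hvD
    · left
      obtain ⟨h1, D, hD, hmem, hsum, hmin⟩ := B5.some h
      refine ⟨D, ⟨hD, fun D' hD' => ?_⟩, hreg.trans h1, fun i => (h63 i).trans (hmem i)⟩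
      obtain ⟨v, hv, hvD⟩ := hdom D' hD'
      exact hmin v hv D' hD' hvD

theorem minDegree_mul_le (hn : 0 < n) : G.minDegree * G.edgeFinset.card + 1 ≤ n ^ 3 + 1 := by
  have : Nonempty (Fin n) := ⟨⟨0, hn⟩⟩
  have h1 : G.minDegree ≤ n := by simpa using G.minDegree_lt_card.le
  have h2 : G.edgeFinset.card ≤ n * n := by have := two_mul_edges_le G; omega
  calc _ ≤ n * (n * n) + 1 := Nat.add_le_add_right (Nat.mul_le_mul h1 h2) 1
    _ = n ^ 3 + 1 := by ring

theorem edges_le (hn : 0 < n) : G.edgeFinset.card + 1 ≤ n ^ 3 + 1 := by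
  have h2 : G.edgeFinset.card ≤ n * n := by have := two_mul_edges_le G; omega
  have : n * n * 1 ≤ n * n * n := Nat.mul_le_mul_left _ hn
  calc _ ≤ n * n * n + 1 := by omega
    _ = n ^ 3 + 1 := by ring

end

end WED

/-! ### Both algorithms within their time and word bounds -/

theorem mainTheorem3 :
    -- the subproblem on a prime graph `G_v`, in time `O(m)`
    (∃ (P : WED.Prog) (C : ℕ),
      ∀ (n : ℕ) (G : SimpleGraph (Fin n)) [DecidableRel G.Adj] (v : Fin n) (w : Fin n → ℕ∞)
        (s : WED.Mem),
        G.Connected →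
        WED.IsPrimeGraph (WED.subGraph G v) →
        WED.IsInput G (fun x => WED.weightCode (w x)) v s →
        ∃ (t : ℕ) (s' : WED.Mem),
          WED.Run (WED.wordBound C fun x => WED.weightCode (w x)) P s t s' ∧
          t ≤ C * (G.edgeFinset.card + 1) ∧
          ((∃ D : Finset (WED.subVerts G v), WED.IsMinFiniteSubED G v w D ∧
              WED.Answers s' (D.map (Function.Embedding.subtype _))) ∨
            (WED.Rejects s' ∧
              (¬ WED.P4P2Free G ∨
                ¬ ∃ D : Finset (WED.subVerts G v),
                  WED.IsED (WED.subGraph G v) D ∧ ∑ x ∈ D, WED.subWeight G v w x ≠ ⊤)))) ∧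
    -- the whole problem on `(P_4+P_2)`-free graphs, in time `O(δ(G) m)`
    (∃ (P : WED.Prog) (C : ℕ),
      ∀ (n : ℕ) (G : SimpleGraph (Fin n)) [DecidableRel G.Adj] (w : Fin n → ℕ) (s : WED.Mem),
        G.Connected →
        WED.P4P2Free G →
        WED.IsInput G w 0 s →
        ∃ (t : ℕ) (s' : WED.Mem),
          WED.Run (WED.wordBound C w) P s t s' ∧
          t ≤ C * (G.minDegree * G.edgeFinset.card + 1) ∧
          ((∃ D : Finset (Fin n), WED.IsMinED G w D ∧ WED.Answers s' D) ∨
            (WED.Rejects s' ∧ ¬ ∃ D : Finset (Fin n), WED.IsED G D))) := by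
  constructor
  · refine ⟨WED.subProg, 3 * WED.passesSize (WED.subPasses 1) + 10 + 6, ?_⟩
    intro n G _ v w s hG _ hs
    obtain ⟨t, s', h, ht, hres⟩ := WED.subProg_correct G v w s hG hs
    exact ⟨t, s', hs.run v.2.le WED.subProg_tame h
      (ht.trans (Nat.mul_le_mul_left _ (WED.edges_le v.pos))),
      ht.trans (Nat.mul_le_mul_right _ (Nat.le_add_right _ 6)), hres⟩
  · refine ⟨WED.fullProg, 12 * WED.fullSize + 6, ?_⟩
    intro n G _ w s hG hfree hs
    obtain ⟨t, s', h, ht, hres⟩ := WED.fullProg_correct hG hfree hs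
    exact ⟨t, s', hs.run (Nat.zero_le _) WED.fullProg_tame h
      (ht.trans (Nat.mul_le_mul_left _
        (WED.minDegree_mul_le (Fin.pos_iff_nonempty.2 hG.nonempty)))),
      ht.trans (Nat.mul_le_mul_right _ (Nat.le_add_right _ 6)), hres⟩
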